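/- **Setting.** Let $\mathbb T^d=(\mathbb R/\mathbb Z)^d$ with its normalized Haar measure $dx$, let $L^2_x=L^2(\mathbb T^d,\mathbb R)$ and $\mathcal C^n_x=\mathcal C^n(\mathbb T^d,\mathbb R)$, and let $H^{-\varsigma}_x=H^{-\varsigma}(\mathbb T^d,\mathbb R)$, $\varsigma\in(0,1]$, be the Sobolev space of real distributions $u$ with $\sum_{k\in\mathbb Z^d}(1+|k|^2)^{-\varsigma}|\hat u(k)|^2<\infty$. For $T\in(0,\infty)$ write $\mathcal C^0_TH^{-\varsigma}_x=\mathcal C^0([0,T],H^{-\varsigma}_x)$. The bracket $(u,\xi)$ denotes the $L^2_x$ inner product and its extension to the duality between $H_x^{-\varsigma}$ and $H_x^{\varsigma}$. *Coefficients.* Let $(V,\mu)$ be a $\sigma$-finite measure space and let $\mathcal M:V\to(0,\infty)$ be measurable with $\int_V\mathcal M\,d\mu=1$. Let $a,b:V\to\mathbb R^d$ be bounded and measurable with $\int_V a\,\mathcal M\,d\mu=0$. Let $L^2(\mathcal M^{-1})$ be the real $L^2$ space of $\mathbb T^d\times V$ for the measure $dx\,d\mu(v)/\mathcal M(v)$.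 For $f\in L^2(\mathcal M^{-1})$ put $\langle f\rangle=\int_V f\,d\mu\in L^2_x$ and $Lf=\langle f\rangle\mathcal M-f$. For $\epsilon>0$ let $A^\epsilon=(\epsilon^{-1}a(v)+b(v))\cdot\nabla_x$, so that $(e^{-tA^\epsilon}f)(x,v)=f\big(x-t(\epsilon^{-1}a(v)+b(v)),v\big)$. Let $E$ be a Banach space and let $\sigma:E\to\mathcal C_x^{\lfloor d/2\rfloor+2}$ be Lipschitz continuous. *Driving process.* Let $(m_\ell)_{\ell\in E}$ be an $E$-valued Markov process, $m_\ell(0)=\ell$, that is ergodic with unique invariant probability distribution $\nu$, and $\int_E\|\ell\|_E\,d\nu(\ell)<\infty$. Assume that there is a nonnegative $\gamma_{\rm mix}\in L^1(\mathbb R^+)$ such that for all $\ell_1,\ell_2\in E$ there is a coupling $(m^*_{\ell_1},m^*_{\ell_2})$ of $(m_{\ell_1},m_{\ell_2})$ with $\mathbb E\|m^*_{\ell_1}(t)-m^*_{\ell_2}(t)\|_E\le\gamma_{\rm mix}(t)\|\ell_1-\ell_2\|_E$ for all $t\ge0$. Fix $\ell_0\in E$ and let $m=m_{\ell_0}$,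 jointly measurable in time and randomness, be such that $\sup_{i\in\mathbb N_0}\mathbb E\big[\sup_{t\in[i,i+1]}\|m(t)\|_E^\gamma\big]<\infty$ for some $\gamma\in(2,\infty)$. For $\delta>0$ put $m^\delta(t)=m(t/\delta^2)$. *Kinetic equation.* Let $\epsilon_0,\delta_0>0$. For $\epsilon\in(0,\epsilon_0]$ and $\delta\in(0,\delta_0]$ let $f_0^{\epsilon,\delta}$ be an $L^2(\mathcal M^{-1})$-valued random variable, with $\sup_{\epsilon,\delta}\mathbb E\|f_0^{\epsilon,\delta}\|_{L^2(\mathcal M^{-1})}^{12}<\infty$, such that $\langle f_0^{\epsilon,\delta}\rangle$ converges in distribution in $L^2_x$, as $(\epsilon,\delta)\to(0,0)$, to some $L^2_x$-valued random variable $\bar\rho_0$. Let $f^{\epsilon,\delta}\in\mathcal C^0([0,T],L^2(\mathcal M^{-1}))$ be the mild solution of $$\partial_tf^{\epsilon,\delta}+\Big(\frac1\epsilon a(v)+b(v)\Big)\cdot\nabla_xf^{\epsilon,\delta}+\sigma(m^\delta)f^{\epsilon,\delta}=\frac1{\epsilon^2}Lf^{\epsilon,\delta},\qquad f^{\epsilon,\delta}(0)=f^{\epsilon,\delta}_0,$$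 that is, almost surely, for all $t\in[0,T]$, $$f^{\epsilon,\delta}(t)=e^{-tA^\epsilon}f_0^{\epsilon,\delta}+\int_0^te^{-(t-s)A^\epsilon}\Big(\frac1{\epsilon^2}Lf^{\epsilon,\delta}(s)-\sigma(m^\delta(s))f^{\epsilon,\delta}(s)\Big)ds ,$$ and put $\rho^{\epsilon,\delta}=\langle f^{\epsilon,\delta}\rangle$. *Limit generator.* Put $K=\int_Va\otimes a\,\mathcal M\,d\mu$, $J=\int_Vb\,\mathcal M\,d\mu$ and $\bar\sigma=\int_E\sigma(\ell)\,d\nu(\ell)$. Let $\Theta_{\lim}$ be the class of functions $\varphi(\rho)=\chi((\rho,\xi))$ with $\xi\in\mathcal C^3_x$ and $\chi\in\mathcal C^3(\mathbb R,\mathbb R)$ bounded together with its derivatives up to order three. For such $\varphi$ let $$\mathcal L\varphi(\rho)=D\varphi(\rho)\cdot\big(\mathrm{div}(K\nabla\rho)-J\cdot\nabla\rho-\bar\sigma\rho\big)=\chi'\big((\rho,\xi)\big)\,\big(\rho,\ \mathrm{div}(K\nabla\xi)+J\cdot\nabla\xi-\bar\sigma\xi\big).$$ **Proposition 4.6.**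 Let $\varsigma\in(0,1]$, and let $\rho_\infty$ be a $\mathcal C^0_TH^{-\varsigma}_x$-valued random variable such that $\rho^{\epsilon_i,\delta_i}\to\rho_\infty$ in distribution in $\mathcal C^0_TH^{-\varsigma}_x$ as $i\to\infty$, for some sequence $(\epsilon_i,\delta_i)\in(0,\epsilon_0]\times(0,\delta_0]$ with $(\epsilon_i,\delta_i)\to(0,0)$. Then, for every $\varphi\in\Theta_{\lim}$, almost surely, for all $t\in[0,T]$, the function $s\mapsto\mathcal L\varphi(\rho_\infty(s))$ is integrable on $[0,t]$ and $$\varphi(\rho_\infty(t))-\varphi(\rho_\infty(0))-\int_0^t\mathcal L\varphi(\rho_\infty(s))\,ds=0 .$$ -/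

import Mathlib

open MeasureTheory ProbabilityTheory Filter Topology Set
open scoped ENNReal NNReal ComplexConjugate

noncomputable section

namespace KineticLimit

/-! ### The torus -/

/-- The flat `d`-dimensional torus `(ℝ / ℤ)^d`. -/
abbrev Torus (d : ℕ) : Type := UnitAddTorus (Fin d)

/-- The (translation invariant, normalised) measure `dx` on the torus. -/
def dx (d : ℕ) : Measure (Torus d) := Measure.pi fun _ => AddCircle.haarAddCircle

instance (d : ℕ) : IsProbabilityMeasure (dx d) := by
  unfold dx; infer_instance

instance (d : ℕ) : (dx d).IsAddHaarMeasure := by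
  unfold dx; infer_instance

/-- The periodic function on `ℝ^d` associated with a function on the torus. -/
def lift {d : ℕ} (g : Torus d → ℝ) : EuclideanSpace ℝ (Fin d) → ℝ :=
  fun y => g fun i => ((y i : ℝ) : UnitAddCircle)

/-- `g` belongs to `C^n` of the torus. -/
def IsCk {d : ℕ} (n : ℕ) (g : Torus d → ℝ) : Prop := ContDiff ℝ n (lift g)

/-- The `C^n` norm of `g`, i.e. the supremum over the torus of all derivatives of order at most
`n`, is bounded by `c`. -/
def CkNormLE {d : ℕ} (n : ℕ) (g : Torus d → ℝ) (c : ℝ) : Prop :=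
  ∀ j ≤ n, ∀ y, ‖iteratedFDeriv ℝ j (lift g) y‖ ≤ c

/-- The partial derivative `∂ g / ∂ x_i` of a function on the torus. -/
def partialD {d : ℕ} (i : Fin d) (g : Torus d → ℝ) : Torus d → ℝ :=
  fun x => deriv (fun h : ℝ => g (x + Pi.single i (h : UnitAddCircle))) 0

/-- The real Hilbert space `L²_x` of the torus. -/
abbrev L2x (d : ℕ) : Type := Lp ℝ 2 (dx d)

instance (d : ℕ) : MeasurableSpace (L2x d) := borel _

instance (d : ℕ) : BorelSpace (L2x d) := ⟨rfl⟩

/-! ### The kinetic model -/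

/-- The velocity space `(V, μ)` is equipped with a positive density `M` of total mass one (the
Maxwellian) and with bounded velocity fields `a` and `b`, where `a` is centred. -/
structure VelocityModel (d : ℕ) {V : Type*} [MeasurableSpace V] (μ : Measure V) where
  M : V → ℝ
  a : V → EuclideanSpace ℝ (Fin d)
  b : V → EuclideanSpace ℝ (Fin d)
  measurable_M : Measurable M
  M_pos : ∀ v, 0 < M v
  integrable_M : Integrable M μ
  integral_M : ∫ v, M v ∂μ = 1
  measurable_a : Measurable a
  measurable_b : Measurable b
  bounded_a : ∃ c, ∀ v, ‖a v‖ ≤ c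
  bounded_b : ∃ c, ∀ v, ‖b v‖ ≤ c
  centred_a : ∫ v, M v • a v ∂μ = 0

namespace VelocityModel

variable {d : ℕ} {V : Type*} [MeasurableSpace V] {μ : Measure V} (C : VelocityModel d μ)

/-- The measure `dμ(v) / M(v)`. -/
def invM : Measure V := μ.withDensity fun v => ENNReal.ofReal (C.M v)⁻¹

/-- The measure `dx dμ(v) / M(v)`. -/
def weight : Measure (Torus d × V) := (dx d).prod C.invM

/-- The weighted Hilbert space `L²(M⁻¹)`. -/
abbrev L2M : Type _ := Lp ℝ 2 C.weight


theorem withDensity_M : C.invM.withDensity (fun v => ENNReal.ofReal (C.M v)) = μ := by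
  have h1 : Measurable fun v => ENNReal.ofReal (C.M v)⁻¹ := C.measurable_M.inv.ennreal_ofReal
  have h2 : (fun v => ENNReal.ofReal (C.M v)) = (fun v => ENNReal.ofReal (C.M v)⁻¹)⁻¹ := by
    funext v
    simp [ENNReal.ofReal_inv_of_pos (C.M_pos v)]
  rw [h2]
  exact withDensity_inv_same h1 (ae_of_all _ fun v => by simpa using C.M_pos v)
    (ae_of_all _ fun v => ENNReal.ofReal_ne_top)

theorem lintegral_eq (g : V → ℝ≥0∞) :
    ∫⁻ v, g v ∂μ = ∫⁻ v, ENNReal.ofReal (C.M v) * g v ∂C.invM := by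
  conv_lhs => rw [← C.withDensity_M]
  exact lintegral_withDensity_eq_lintegral_mul_non_measurable _ C.measurable_M.ennreal_ofReal
    (ae_of_all _ fun v => ENNReal.ofReal_lt_top) g

theorem lintegral_M_sq : ∫⁻ v, ENNReal.ofReal (C.M v) ^ 2 ∂C.invM = 1 := by
  have h : ∫⁻ v, ENNReal.ofReal (C.M v) ∂μ = 1 := by
    rw [← ofReal_integral_eq_lintegral_ofReal C.integrable_M
      (ae_of_all _ fun v => (C.M_pos v).le), C.integral_M, ENNReal.ofReal_one]
  rw [← h, C.lintegral_eq]
  simp [sq]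

/-- Cauchy--Schwarz in the velocity variable. -/
theorem sq_lintegral_le {g : V → ℝ≥0∞} (hg : AEMeasurable g C.invM) :
    (∫⁻ v, g v ∂μ) ^ 2 ≤ ∫⁻ v, g v ^ 2 ∂C.invM := by
  rw [C.lintegral_eq]
  have h := ENNReal.lintegral_mul_le_Lp_mul_Lq C.invM Real.HolderConjugate.two_two
    C.measurable_M.ennreal_ofReal.aemeasurable hg
  simp only [Pi.mul_apply, ENNReal.rpow_two, C.lintegral_M_sq, ENNReal.one_rpow, one_mul] at h
  calc _ ≤ ((∫⁻ v, g v ^ 2 ∂C.invM) ^ (1 / 2 : ℝ)) ^ 2 := by gcongr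
    _ = _ := by
      rw [← ENNReal.rpow_two, ← ENNReal.rpow_mul]; norm_num

/-- The velocity field `ε⁻¹ a + b`. -/
def speed (ε : ℝ) (v : V) : EuclideanSpace ℝ (Fin d) := ε⁻¹ • C.a v + C.b v

theorem measurable_speed (ε : ℝ) : Measurable (C.speed ε) :=
  (C.measurable_a.const_smul ε⁻¹).add C.measurable_b

theorem memLp_mulX (g : C(Torus d, ℝ)) (f : C.L2M) :
    MemLp (fun p : Torus d × V => g p.1 * f p) 2 C.weight :=
  (Lp.memLp f).of_le_mul (c := ‖g‖)
    ((g.continuous.measurable.comp measurable_fst).aestronglyMeasurable.mul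
      (Lp.aestronglyMeasurable f))
    (ae_of_all _ fun p => by
      rw [norm_mul]
      exact mul_le_mul_of_nonneg_right (g.norm_coe_le_norm p.1) (norm_nonneg _))

/-- Multiplication of `f` by the continuous function `g` of `x`. -/
def mulX (g : C(Torus d, ℝ)) (f : C.L2M) : C.L2M := (C.memLp_mulX g f).toLp

variable [SigmaFinite μ]

instance : SigmaFinite C.invM := by
  unfold invM; infer_instance

instance : SigmaFinite C.weight := by
  unfold weight; infer_instance

theorem ac_weight : (dx d).prod μ ≪ C.weight := by
  have h : μ ≪ C.invM := by
    conv_lhs => rw [← C.withDensity_M]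
    exact withDensity_absolutelyContinuous _ _
  exact Measure.AbsolutelyContinuous.rfl.prod h

/-- The spatial density `⟨f⟩(x) = ∫ f(x, v) dμ(v)`, as a function. -/
def densityFun (f : Torus d × V → ℝ) : Torus d → ℝ := fun x => ∫ v, f (x, v) ∂μ

theorem aestronglyMeasurable_prod (f : C.L2M) : AEStronglyMeasurable f ((dx d).prod μ) :=
  (Lp.aestronglyMeasurable f).mono_ac C.ac_weight

theorem eLpNorm_sq {α : Type*} [MeasurableSpace α] (κ : Measure α) (g : α → ℝ) :
    eLpNorm g 2 κ ^ 2 = ∫⁻ x, ‖g x‖ₑ ^ 2 ∂κ := by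
  rw [eLpNorm_eq_lintegral_rpow_enorm_toReal (by norm_num) (by norm_num), ← ENNReal.rpow_two,
    ← ENNReal.rpow_mul]
  norm_num

theorem lintegral_sq_le (f : C.L2M) :
    ∫⁻ x, (∫⁻ v, ‖f (x, v)‖ₑ ∂μ) ^ 2 ∂(dx d) ≤ eLpNorm f 2 C.weight ^ 2 := by
  have hf : AEStronglyMeasurable f ((dx d).prod C.invM) := Lp.aestronglyMeasurable f
  rw [eLpNorm_sq]
  refine le_trans (lintegral_mono_ae ?_)
    (lintegral_prod (μ := dx d) (ν := C.invM) (fun p => ‖f p‖ₑ ^ 2) (hf.enorm.pow_const 2)).ge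
  filter_upwards [hf.prodMk_left] with x hx
  exact C.sq_lintegral_le hx.enorm

theorem eLpNorm_densityFun_le (f : C.L2M) :
    eLpNorm (densityFun (μ := μ) f) 2 (dx d) ≤ eLpNorm f 2 C.weight := by
  have h : eLpNorm (densityFun (μ := μ) f) 2 (dx d) ^ 2 ≤ eLpNorm f 2 C.weight ^ 2 := by
    refine le_trans ?_ (C.lintegral_sq_le f)
    rw [eLpNorm_sq]
    gcongr with x
    exact enorm_integral_le_lintegral_enorm _
  exact (ENNReal.pow_le_pow_left_iff two_ne_zero).1 h

theorem memLp_densityFun (f : C.L2M) : MemLp (densityFun (μ := μ) f) 2 (dx d) :=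
  ⟨(C.aestronglyMeasurable_prod f).integral_prod_right',
    (C.eLpNorm_densityFun_le f).trans_lt (Lp.eLpNorm_lt_top f)⟩

theorem ae_integrable (f : C.L2M) : ∀ᵐ x ∂(dx d), Integrable (fun v => f (x, v)) μ := by
  have h1 := (C.aestronglyMeasurable_prod f)
  have h2 : ∀ᵐ x ∂(dx d), (∫⁻ v, ‖f (x, v)‖ₑ ∂μ) ^ 2 < ∞ := by
    refine ae_lt_top' ?_ ((C.lintegral_sq_le f).trans_lt ?_).ne
    · exact (h1.enorm.lintegral_prod_right').pow_const 2
    · exact ENNReal.pow_lt_top (Lp.eLpNorm_lt_top f)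
  filter_upwards [h1.prodMk_left, h2] with x hx hx2
  refine ⟨hx, ?_⟩
  by_contra hne
  simp only [HasFiniteIntegral, not_lt, top_le_iff] at hne
  simp [hne] at hx2

/-- The spatial density `f ↦ ρ = ⟨f⟩ = ∫ f dμ`, from `L²(M⁻¹)` to `L²_x`. -/
def density : C.L2M →L[ℝ] L2x d :=
  LinearMap.mkContinuous
    { toFun := fun f => (C.memLp_densityFun f).toLp
      map_add' := fun f g => by
        rw [← MemLp.toLp_add]
        refine MemLp.toLp_congr _ _ ?_
        have h := Measure.ae_ae_of_ae_prod (C.ac_weight.ae_le (Lp.coeFn_add f g))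
        filter_upwards [h, C.ae_integrable f, C.ae_integrable g] with x hx hf hg
        simp only [densityFun, Pi.add_apply]
        rw [← integral_add hf hg]
        exact integral_congr_ae hx
      map_smul' := fun c f => by
        rw [RingHom.id_apply, ← MemLp.toLp_const_smul]
        refine MemLp.toLp_congr _ _ ?_
        have h := Measure.ae_ae_of_ae_prod (C.ac_weight.ae_le (Lp.coeFn_smul c f))
        filter_upwards [h] with x hx
        simp only [densityFun, Pi.smul_apply]
        rw [← integral_smul]
        exact integral_congr_ae hx } 1 fun f => by
      rw [one_mul]
      change ‖(C.memLp_densityFun f).toLp‖ ≤ ‖f‖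
      rw [Lp.norm_toLp, Lp.norm_def]
      exact ENNReal.toReal_mono (Lp.eLpNorm_ne_top f) (C.eLpNorm_densityFun_le f)

theorem memLp_equilibrium (r : L2x d) :
    MemLp (fun p : Torus d × V => r p.1 * C.M p.2) 2 C.weight := by
  have hm : AEStronglyMeasurable (fun p : Torus d × V => r p.1 * C.M p.2) C.weight :=
    (Lp.aestronglyMeasurable r).comp_fst.mul C.measurable_M.aestronglyMeasurable.comp_snd
  refine ⟨hm, ?_⟩
  have h : eLpNorm (fun p : Torus d × V => r p.1 * C.M p.2) 2 C.weight ^ 2 < ∞ := by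
    rw [eLpNorm_sq]
    have : ∀ p : Torus d × V, ‖r p.1 * C.M p.2‖ₑ ^ 2
        = ‖r p.1‖ₑ ^ 2 * ENNReal.ofReal (C.M p.2) ^ 2 := fun p => by
      rw [enorm_mul, mul_pow, Real.enorm_eq_ofReal (C.M_pos p.2).le]
    simp_rw [this]
    rw [weight, lintegral_prod_mul ((Lp.aestronglyMeasurable r).enorm.pow_const 2)
      (C.measurable_M.ennreal_ofReal.pow_const 2).aemeasurable, C.lintegral_M_sq, mul_one,
      ← eLpNorm_sq]
    exact ENNReal.pow_lt_top (Lp.eLpNorm_lt_top r)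
  by_contra hne
  simp only [not_lt, top_le_iff] at hne
  simp [hne] at h

/-- The local equilibrium `(x, v) ↦ ρ(x) M(v)` in `L²(M⁻¹)`. -/
def equilibrium (r : L2x d) : C.L2M := (C.memLp_equilibrium r).toLp

/-- The Bhatnagar--Gross--Krook operator `L f = ρ M - f`. -/
def bgk (f : C.L2M) : C.L2M := C.equilibrium (C.density f) - f

/-- The flow of the free transport equation with velocity field `c`. -/
def flow (c : V → EuclideanSpace ℝ (Fin d)) (t : ℝ) (p : Torus d × V) : Torus d × V :=
  (p.1 + fun i => ((t * c p.2 i : ℝ) : UnitAddCircle), p.2)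

theorem measurePreserving_flow {c : V → EuclideanSpace ℝ (Fin d)} (hc : Measurable c) (t : ℝ) :
    MeasurePreserving (flow c t) C.weight C.weight := by
  have hg : Measurable (Function.uncurry fun (v : V) (x : Torus d) =>
      x + fun i => ((t * c v i : ℝ) : UnitAddCircle)) := by
    refine measurable_snd.add (measurable_pi_iff.2 fun i => ?_)
    have h1 : Measurable fun p : V × Torus d => t * c p.1 i := by fun_prop
    exact (AddCircle.measurable_mk' (a := (1 : ℝ))).comp h1
  have h := (MeasurePreserving.id C.invM).skew_product (μc := dx d) (μd := dx d) hg
    (ae_of_all _ fun v => map_add_right_eq_self (dx d) _)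
  have h' := (Measure.measurePreserving_swap.comp h).comp
    (Measure.measurePreserving_swap (μ := dx d) (ν := C.invM))
  exact h'

/-- The group `exp (- t A^ε)` on `L²(M⁻¹)` generated by minus the transport operator
`A^ε f = (ε⁻¹ a(v) + b(v)) · ∇_x f`: it maps `f` to
`(x, v) ↦ f (x - t (ε⁻¹ a(v) + b(v)), v)`. -/
def transport (ε t : ℝ) (f : C.L2M) : C.L2M :=
  Lp.compMeasurePreserving (flow (C.speed ε) (-t))
    (C.measurePreserving_flow (C.measurable_speed ε) (-t)) f

/-- For `T ≥ 0`, a path `f` in `C⁰([0,T]; L²(M⁻¹))` is the mild solution of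
`∂_t f + (ε⁻¹ a + b) · ∇_x f + σ(m) f = ε⁻² L f`, `f(0) = f₀`, where `r(s) = σ(m(s))` are the
values of the rate along the given path of the driving process: for all `t` in `[0,T]`,
`f(t) = exp (-t A^ε) f₀ + ∫_0^t exp (-(t-s) A^ε) (ε⁻² L f(s) - σ(m(s)) f(s)) ds`,
the integrand being (Bochner) integrable. -/
def IsMildSolution {T : ℝ} (hT : 0 ≤ T) (ε : ℝ) (r : ℝ → C(Torus d, ℝ)) (f₀ : C.L2M)
    (f : C(Icc (0 : ℝ) T, C.L2M)) : Prop :=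
  ∀ t : Icc (0 : ℝ) T,
    let G : ℝ → C.L2M := fun s =>
      C.transport ε (t - s) ((ε ^ 2)⁻¹ • C.bgk (f (projIcc 0 T hT s))
        - C.mulX (r s) (f (projIcc 0 T hT s)))
    IntervalIntegrable G volume 0 t ∧ f t = C.transport ε t f₀ + ∫ s in (0 : ℝ)..t, G s

/-- The diffusion matrix `K = ∫ a ⊗ a M dμ`. -/
def K (i j : Fin d) : ℝ := ∫ v, C.a v i * C.a v j * C.M v ∂μ

/-- The drift vector `J = ∫ b M dμ`. -/
def J (i : Fin d) : ℝ := ∫ v, C.b v i * C.M v ∂μ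

end VelocityModel

/-! ### The driving process -/

section Driving

variable {E : Type*} [NormedAddCommGroup E] [MeasurableSpace E]

/-- The rate `σ` maps `E` to `C^n` of the torus and is Lipschitz continuous for the `C^n` norm. -/
def LipschitzIntoCk {d : ℕ} (n : ℕ) (σ : E → C(Torus d, ℝ)) : Prop :=
  (∀ ℓ, IsCk n (σ ℓ)) ∧
    ∃ c : ℝ, ∀ ℓ₁ ℓ₂, CkNormLE n (fun x => σ ℓ₁ x - σ ℓ₂ x) (c * ‖ℓ₁ - ℓ₂‖)

/-- `P` is a Markov transition semigroup on `E` which is ergodic, with unique invariant probability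
distribution `ν`, and `ν` is integrable. -/
structure IsErgodicMarkovSemigroup (P : ℝ≥0 → Kernel E E) (ν : Measure E) : Prop where
  isMarkovKernel : ∀ t, IsMarkovKernel (P t)
  zero : P 0 = Kernel.id
  add : ∀ s t, P (s + t) = P t ∘ₖ P s
  isProbabilityMeasure : IsProbabilityMeasure ν
  invariant : ∀ t, (P t).Invariant ν
  unique : ∀ ν' : Measure E, IsProbabilityMeasure ν' → (∀ t, (P t).Invariant ν') → ν' = ν
  integrable : Integrable (fun ℓ => ‖ℓ‖) ν

variable {Ω : Type*} [MeasurableSpace Ω]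

/-- The σ-algebra generated by the process `X` up to time `s`. -/
@[reducible]
def past (X : ℝ≥0 → Ω → E) (s : ℝ≥0) : MeasurableSpace Ω :=
  ⨆ r ∈ Iic s, MeasurableSpace.comap (X r) inferInstance

/-- Under the probability `μ`, the process `X` is a Markov process with transition semigroup `P`
and initial value `ℓ`, i.e. it is a version of the process `m_ℓ`. The last field says that
`P t (X s) A` is the conditional probability of `X (s + t) ∈ A` given the past up to time `s`. -/
structure IsMarkovFrom (P : ℝ≥0 → Kernel E E) (ℓ : E) (μ : Measure Ω) (X : ℝ≥0 → Ω → E) :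
    Prop where
  measurable : ∀ t, Measurable (X t)
  initial : ∀ᵐ ω ∂μ, X 0 ω = ℓ
  markov : ∀ s t : ℝ≥0, ∀ B : Set Ω, MeasurableSet[past X s] B → ∀ A : Set E, MeasurableSet A →
    μ (B ∩ X (s + t) ⁻¹' A) = ∫⁻ ω in B, P t (X s ω) A ∂μ

/-- Uniform moments: for some `γ > 2`, `sup_i 𝔼 [sup_{t ∈ [i, i+1]} ‖m(t)‖^γ] < ∞`. -/
def HasUniformMoments (μ : Measure Ω) (m : ℝ≥0 → Ω → E) : Prop :=
  ∃ γ : ℝ, 2 < γ ∧ (⨆ i : ℕ, ∫⁻ ω, (⨆ t ∈ Icc (i : ℝ≥0) (i + 1), ‖m t ω‖ₑ ^ γ) ∂μ) < ∞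

/-- Mixing: there is a nonnegative integrable function `γmix` on the half line such that all initial
values `ℓ₁, ℓ₂` admit a coupling of the processes `m_ℓ₁` and `m_ℓ₂` (realised on the product of two
path spaces) with `𝔼 ‖m_ℓ₁(t) - m_ℓ₂(t)‖ ≤ γmix(t) ‖ℓ₁ - ℓ₂‖` for all `t ≥ 0`. -/
def IsMixing (P : ℝ≥0 → Kernel E E) : Prop :=
  ∃ γmix : ℝ → ℝ, (∀ t, 0 ≤ γmix t) ∧ IntegrableOn γmix (Ici 0) ∧
    ∀ ℓ₁ ℓ₂ : E, ∃ π : Measure ((ℝ≥0 → E) × (ℝ≥0 → E)), IsProbabilityMeasure π ∧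
      IsMarkovFrom P ℓ₁ π (fun t w => w.1 t) ∧ IsMarkovFrom P ℓ₂ π (fun t w => w.2 t) ∧
      ∀ t : ℝ≥0, ∫⁻ w, ‖w.1 t - w.2 t‖ₑ ∂π ≤ ENNReal.ofReal (γmix t * ‖ℓ₁ - ℓ₂‖)

/-- The averaged rate `σ̄ = ∫ σ(ℓ) dν(ℓ)`, a function on the torus. -/
def meanRate {d : ℕ} (σ : E → C(Torus d, ℝ)) (ν : Measure E) : Torus d → ℝ :=
  fun x => ∫ ℓ, σ ℓ x ∂ν

end Driving

/-! ### Sobolev spaces of negative order -/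

/-- The Japanese bracket `(1 + |k|²)^(1/2)` of a frequency. -/
def bracket {d : ℕ} (k : Fin d → ℤ) : ℝ := √(1 + ∑ i, (k i : ℝ) ^ 2)

theorem one_le_bracket {d : ℕ} (k : Fin d → ℤ) : 1 ≤ bracket k := by
  unfold bracket
  rw [Real.one_le_sqrt]
  have : 0 ≤ ∑ i, (k i : ℝ) ^ 2 := Finset.sum_nonneg fun i _ => sq_nonneg _
  linarith

/-- The Sobolev space `H^{-s}` of real distributions on the torus. A distribution with Fourier
coefficients `c k` is represented by the square summable sequence `k ↦ ⟨k⟩^{-s} c k`, so that its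
norm is `(∑ ⟨k⟩^{-2s} |c k|²)^{1/2}`; it is real when `c (-k)` is the conjugate of `c k`. -/
def Hneg (d : ℕ) (_s : ℝ) : Submodule ℝ (lp (fun _ : Fin d → ℤ => ℂ) 2) where
  carrier := {u | ∀ k, u (-k) = conj (u k)}
  add_mem' := fun {u v} hu hv k => by simp [hu k, hv k]
  zero_mem' := fun k => by simp
  smul_mem' := fun c u hu k => by simp [hu k]

/-- The complexification of a square integrable real function. -/
def complexify {d : ℕ} : L2x d →L[ℝ] Lp ℂ 2 (dx d) := Complex.ofRealCLM.compLpL 2 (dx d)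

/-- The Fourier coefficients of a square integrable real function on the torus. -/
def fourierX {d : ℕ} (r : L2x d) (k : Fin d → ℤ) : ℂ :=
  UnitAddTorus.mFourierCoeff (fun x => (r x : ℂ)) k

/-- The isometry of Parseval's identity. -/
def parseval (d : ℕ) : Lp ℂ 2 (dx d) ≃ₗᵢ[ℂ] lp (fun _ : Fin d → ℤ => ℂ) 2 :=
  UnitAddTorus.mFourierBasis.repr

theorem fourierX_eq {d : ℕ} (r : L2x d) (k : Fin d → ℤ) :
    fourierX r k = parseval d (complexify r) k := by
  refine Eq.trans ?_ (UnitAddTorus.mFourierBasis_repr (complexify r) k).symm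
  refine integral_congr_ae ?_
  have h : ∀ᵐ x ∂(dx d), complexify r x = (r x : ℂ) := Complex.ofRealCLM.coeFn_compLp r
  exact h.mono fun x hx => congrArg (fun z => UnitAddTorus.mFourier (-k) x • z) hx.symm

theorem fourierX_add {d : ℕ} (r r' : L2x d) (k : Fin d → ℤ) :
    fourierX (r + r') k = fourierX r k + fourierX r' k := by
  rw [fourierX_eq, fourierX_eq, fourierX_eq, map_add, map_add]
  rfl

theorem complexify_smul {d : ℕ} (c : ℝ) (r : L2x d) :
    complexify (c • r) = (c : ℂ) • complexify r := by
  rw [map_smul]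
  ext1
  filter_upwards [Lp.coeFn_smul c (complexify r),
    Lp.coeFn_smul (c : ℂ) (complexify r)] with x h1 h2
  rw [h1, h2]
  simp

theorem fourierX_smul {d : ℕ} (c : ℝ) (r : L2x d) (k : Fin d → ℤ) :
    fourierX (c • r) k = (c : ℂ) * fourierX r k := by
  rw [fourierX_eq, fourierX_eq, complexify_smul, map_smul]
  rfl

theorem fourierX_neg {d : ℕ} (r : L2x d) (k : Fin d → ℤ) :
    fourierX r (-k) = conj (fourierX r k) := by
  unfold fourierX UnitAddTorus.mFourierCoeff
  rw [← integral_conj]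
  congr 1
  funext x
  simp [UnitAddTorus.mFourier_neg]

theorem norm_weighted_le {d : ℕ} {s : ℝ} (hs : 0 ≤ s) (k : Fin d → ℤ) (z : ℂ) :
    ‖((bracket k ^ (-s) : ℝ) : ℂ) * z‖ ≤ ‖z‖ := by
  have h1 : bracket k ^ (-s) ≤ 1 :=
    Real.rpow_le_one_of_one_le_of_nonpos (one_le_bracket k) (by linarith)
  have h0 : 0 ≤ bracket k ^ (-s) := Real.rpow_nonneg (zero_le_one.trans (one_le_bracket k)) _
  rw [norm_mul, Complex.norm_real, Real.norm_of_nonneg h0]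
  exact mul_le_of_le_one_left (norm_nonneg _) h1

theorem memlp_weighted {d : ℕ} {s : ℝ} (hs : 0 ≤ s) (r : L2x d) :
    Memℓp (fun k => ((bracket k ^ (-s) : ℝ) : ℂ) * fourierX r k) 2 := by
  refine memℓp_gen ?_
  refine Summable.of_nonneg_of_le (fun k => by positivity) (fun k => ?_)
    ((lp.memℓp (parseval d (complexify r))).summable (by norm_num))
  rw [← fourierX_eq]
  exact Real.rpow_le_rpow (norm_nonneg _) (norm_weighted_le hs k _) (by norm_num)

namespace Hneg

variable {d : ℕ} {s : ℝ}

/-- The Fourier coefficients of a distribution in `H^{-s}`. -/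
def coeff (u : Hneg d s) (k : Fin d → ℤ) : ℂ := ((bracket k ^ s : ℝ) : ℂ) * u.1 k

/-- The duality pairing `(u, ξ)` of a distribution in `H^{-s}` with a real function on the torus;
it extends the `L²_x` inner product. -/
def pair (u : Hneg d s) (ξ : Torus d → ℝ) : ℝ :=
  (∑' k, coeff u k * conj (UnitAddTorus.mFourierCoeff (fun x => (ξ x : ℂ)) k)).re

/-- The canonical embedding of `L²_x` into `H^{-s}`, for `s ≥ 0`. -/
def ofL2 (hs : 0 ≤ s) : L2x d →L[ℝ] Hneg d s :=
  LinearMap.mkContinuous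
    { toFun := fun r => ⟨⟨fun k => ((bracket k ^ (-s) : ℝ) : ℂ) * fourierX r k,
        memlp_weighted hs r⟩, fun k => by
          change ((bracket (-k) ^ (-s) : ℝ) : ℂ) * fourierX r (-k)
            = conj (((bracket k ^ (-s) : ℝ) : ℂ) * fourierX r k)
          rw [fourierX_neg, map_mul, Complex.conj_ofReal]
          simp [bracket]⟩
      map_add' := fun r r' => by
        ext k
        change ((bracket k ^ (-s) : ℝ) : ℂ) * fourierX (r + r') k
          = ((bracket k ^ (-s) : ℝ) : ℂ) * fourierX r k
            + ((bracket k ^ (-s) : ℝ) : ℂ) * fourierX r' k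
        rw [fourierX_add, mul_add]
      map_smul' := fun c r => by
        ext k
        change ((bracket k ^ (-s) : ℝ) : ℂ) * fourierX (c • r) k
          = c • (((bracket k ^ (-s) : ℝ) : ℂ) * fourierX r k)
        rw [fourierX_smul, Complex.real_smul]
        ring } 1 fun r => by
      rw [one_mul]
      have h : ‖complexify r‖ ≤ ‖r‖ := by
        refine (Complex.ofRealCLM.norm_compLp_le r).trans ?_
        simp
      refine le_trans ?_ h
      rw [← (parseval d).norm_map (complexify r)]
      refine lp.norm_le_of_forall_sum_le (by norm_num) (norm_nonneg _) fun S => ?_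
      refine le_trans (Finset.sum_le_sum fun k _ => ?_)
        (lp.sum_rpow_le_norm_rpow (by norm_num)
          (parseval d (complexify r)) S)
      rw [← fourierX_eq]
      exact Real.rpow_le_rpow (norm_nonneg _) (norm_weighted_le hs k _) (by norm_num)

end Hneg

/-- The path space `C⁰_T H^{-s} = C⁰([0,T]; H^{-s})`, with the supremum norm. -/
abbrev PathSpace (d : ℕ) (s T : ℝ) : Type := C(Icc (0 : ℝ) T, Hneg d s)

instance (d : ℕ) (s T : ℝ) : MeasurableSpace (PathSpace d s T) := borel _

instance (d : ℕ) (s T : ℝ) : BorelSpace (PathSpace d s T) := ⟨rfl⟩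

/-- The path `t ↦ ρ(t) = ⟨f(t)⟩` in `C⁰_T H^{-s}` of the density of a path `f` in `L²(M⁻¹)`. -/
def VelocityModel.densityPath {d : ℕ} {V : Type*} [MeasurableSpace V] {μ : Measure V}
    [SigmaFinite μ] (C : VelocityModel d μ) {s T : ℝ} (hs : 0 ≤ s)
    (f : C(Icc (0 : ℝ) T, C.L2M)) : PathSpace d s T :=
  ((Hneg.ofL2 hs).comp C.density : C(C.L2M, Hneg d s)).comp f

/-! ### The limit generator -/

/-- The data of a test function `φ(ρ) = χ((ρ, ξ))` of the class `Θ_lim`: `χ` is of class `C³` and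
bounded together with its derivatives up to order three, and `ξ` is of class `C³` on the torus. -/
structure TestFunction (d : ℕ) where
  χ : ℝ → ℝ
  ξ : Torus d → ℝ
  contDiff_χ : ContDiff ℝ 3 χ
  bounded_χ : ∀ j ≤ 3, ∃ c, ∀ u, |iteratedDeriv j χ u| ≤ c
  contDiff_ξ : IsCk 3 ξ

/-- The value `φ(u) = χ((u, ξ))` of the test function at `u` in `H^{-s}`. -/
def TestFunction.eval {d : ℕ} {s : ℝ} (φ : TestFunction d) (u : Hneg d s) : ℝ :=
  φ.χ (Hneg.pair u φ.ξ)

/-- The distribution `div(K∇u) - J·∇u - c u`, for `u` in `H^{-s}`, tested against `ξ`: by definition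
of the derivatives of a distribution, this is `(u, div(K∇ξ) + J·∇ξ - c ξ)`. -/
def limitDrift {d : ℕ} {s : ℝ} (K : Fin d → Fin d → ℝ) (J : Fin d → ℝ) (c : Torus d → ℝ)
    (u : Hneg d s) (ξ : Torus d → ℝ) : ℝ :=
  Hneg.pair u fun x =>
    (∑ i, partialD i (fun y => ∑ j, K i j * partialD j ξ y) x) + (∑ i, J i * partialD i ξ x)
      - c x * ξ x

/-- The limit generator `ℒφ(u) = Dφ(u) · (div(K∇u) - J·∇u - c u)`, where the derivative
`Dφ(u) · h = χ'((u, ξ)) (h, ξ)` is applied to the distribution `h = div(K∇u) - J·∇u - c u`. -/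
def TestFunction.limitGenerator {d : ℕ} {s : ℝ} (K : Fin d → Fin d → ℝ) (J : Fin d → ℝ)
    (c : Torus d → ℝ) (φ : TestFunction d) (u : Hneg d s) : ℝ :=
  deriv φ.χ (Hneg.pair u φ.ξ) * limitDrift K J c u φ.ξ

/-- The set `(0, ε₀] × (0, δ₀]` of the parameters `(ε, δ)`. -/
abbrev Params (ε₀ δ₀ : ℝ) : Type := Ioc (0 : ℝ) ε₀ × Ioc (0 : ℝ) δ₀

/-- The filter on the set of parameters that expresses `(ε, δ) → (0, 0)`. -/
def toZero (ε₀ δ₀ : ℝ) : Filter (Params ε₀ δ₀) :=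
  comap (fun p => ((p.1 : ℝ), (p.2 : ℝ))) (𝓝 (0, 0))

end KineticLimit
end

/-!
The limit equation is obtained by testing the kinetic equation against finitely many functions of
the form `α(v) η(x)` and keeping track of deterministic errors; randomness enters only through the
driving path, and is averaged by a law of large numbers.

*The kinetic part.* In the frame that moves with free transport a mild solution is the primitive of
a Bochner integrable function, and so is the transported test function `α(v) η(x) M(v)`. Integration
by parts for their scalar product (`inner_sub_inner_eq_integral`) yields the energy estimate
`IsMildSolution.norm_le`, uniform in `ε` because the collision operator is dissipative, and the
balance law `IsBoundedSolution.mom_sub_mom` of the moment of `f` against `α(v) η(x)`. The collision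
term of the balance law carries the factor `ε⁻²`; solving for it shows that every moment is close to
its value at the local equilibrium (`exists_relaxation`), and, when `α` is centred, that `ε⁻¹` times
the moment is close to the divergence of the moments of `a α` (`exists_flux`). With the weights
`1`, `a_j`, `a_i a_j` and `b_j` this gives `exists_diffusion_approx`: for each path of the driving
process, `∂_t ρ = div(K∇ρ) - J · ∇ρ - σ(m^δ) ρ` holds weakly up to an error of order `ε`.

*The averaging part.* Mixing and the Markov property make the correlations of a centred Lipschitz
function of the driving process decay like `γmix` (`IsMarkovFrom.abs_correlation_le`), so that its
time averages at speed `δ⁻²` have a variance of order `δ²` (`exists_variance_bound`). On the other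
hand `ρ` moves slowly in `H^{-ς}`, while `(σ(m^δ) - σ̄) ξ` is Lipschitz continuous on the torus and
thus lies in `H^ς`. Freezing `ρ` on each interval of a subdivision of `[0, t]` therefore bounds
`∫ (ρ, (σ(m^δ) - σ̄) ξ) ds` by the modulus of continuity of `ρ` in `H^{-ς}` and by the `L²_x` norms
of the time averages of `σ(m^δ) - σ̄` over the intervals
(`IsLipschitzRate.abs_integral_pairX_le_of_subdivision`).

*The limit.* Let `defect` be the defect of a path in the weak form of the limit equation on `[0, t]`;
it is a continuous function on the path space. Away from an event of small probability, the two
parts bound the defect of the approximations on the open set of paths with a given small modulus of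
continuity. By the portmanteau theorem the limit charges the paths in this set with a large defect by
little only (`measure_le_of_tendstoInDistribution`); such sets exhaust the path space as the scale of
the modulus tends to zero, hence the defect of the limit vanishes almost surely
(`ae_defect_eq_zero`). A path without defect at any time is `C¹` when tested against `ξ`, and the
chain rule gives the equation for `φ(ρ) = χ((ρ, ξ))`.
-/

noncomputable section

namespace KineticLimit

/-! ### Calculus for primitives of integrable functions -/

/-- A function whose increments are dominated by those of an absolutely continuous function is
absolutely continuous. -/
theorem absolutelyContinuousOnInterval_of_dist_le {X : Type*} [PseudoMetricSpace X] {f : ℝ → X}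
    {N : ℝ → ℝ} {a b D : ℝ} (hN : AbsolutelyContinuousOnInterval N a b)
    (h : ∀ s ∈ uIcc a b, ∀ t ∈ uIcc a b, dist (f s) (f t) ≤ D * dist (N s) (N t)) :
    AbsolutelyContinuousOnInterval f a b := by
  have hD := hN.const_mul D
  rw [absolutelyContinuousOnInterval_iff] at hD ⊢
  intro ε hε
  obtain ⟨δ, hδ, H⟩ := hD ε hε
  refine ⟨δ, hδ, fun I hI hI' => lt_of_le_of_lt (Finset.sum_le_sum fun i hi => ?_) (H I hI hI')⟩
  refine (h _ (hI.1 i hi).1 _ (hI.1 i hi).2).trans ?_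
  rw [Real.dist_eq, Real.dist_eq, ← mul_sub, abs_mul]
  exact mul_le_mul_of_nonneg_right (le_abs_self D) (abs_nonneg _)

theorem dist_intervalIntegral_le {X : Type*} [NormedAddCommGroup X] [NormedSpace ℝ X]
    {w : ℝ → X} {N : ℝ → ℝ} {T s t : ℝ} (hw : IntervalIntegrable w volume 0 T)
    (hN : IntervalIntegrable N volume 0 T) (hle : ∀ r, ‖w r‖ ≤ N r)
    (hs : s ∈ uIcc 0 T) (ht : t ∈ uIcc 0 T) :
    dist (∫ r in (0 : ℝ)..s, w r) (∫ r in (0 : ℝ)..t, w r)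
      ≤ dist (∫ r in (0 : ℝ)..s, N r) (∫ r in (0 : ℝ)..t, N r) := by
  have h0 : ∀ {s}, s ∈ uIcc 0 T → uIcc 0 s ⊆ uIcc 0 T := fun hs =>
    uIcc_subset_uIcc left_mem_uIcc hs
  rw [dist_eq_norm, dist_eq_norm, intervalIntegral.integral_interval_sub_left
    (hw.mono_set (h0 hs)) (hw.mono_set (h0 ht)), intervalIntegral.integral_interval_sub_left
    (hN.mono_set (h0 hs)) (hN.mono_set (h0 ht)), Real.norm_eq_abs]
  exact intervalIntegral.norm_integral_le_abs_of_norm_le (ae_of_all _ hle)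
    (hN.mono_set (uIcc_subset_uIcc ht hs))

theorem absolutelyContinuousOnInterval_intervalIntegral {X : Type*} [NormedAddCommGroup X]
    [NormedSpace ℝ X] {w : ℝ → X} {T : ℝ} (hw : IntervalIntegrable w volume 0 T) :
    AbsolutelyContinuousOnInterval (fun t => ∫ s in (0 : ℝ)..t, w s) 0 T :=
  absolutelyContinuousOnInterval_of_dist_le (D := 1)
    (hw.norm.absolutelyContinuousOnInterval_intervalIntegral left_mem_uIcc)
    fun s hs t ht => by
      simpa using dist_intervalIntegral_le hw hw.norm (fun r => le_rfl) hs ht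

section Product

variable {H : Type*} [NormedAddCommGroup H] [InnerProductSpace ℝ H]

theorem intervalIntegrable_inner_of_continuousOn {w Ψ : ℝ → H} {T : ℝ}
    (hw : IntervalIntegrable w volume 0 T) (hΨ : ContinuousOn Ψ (uIcc 0 T)) :
    IntervalIntegrable (fun s => inner ℝ (w s) (Ψ s)) volume 0 T := by
  obtain ⟨D, hD⟩ := isCompact_uIcc.exists_bound_of_continuousOn hΨ
  rw [intervalIntegrable_iff] at hw ⊢
  refine Integrable.mono' (hw.norm.mul_const D) (hw.1.inner ?_) ?_
  · exact (hΨ.mono uIoc_subset_uIcc).aestronglyMeasurable measurableSet_uIoc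
  · filter_upwards [ae_restrict_mem measurableSet_uIoc] with s hs
    exact (norm_inner_le_norm _ _).trans
      (mul_le_mul_of_nonneg_left (hD s (uIoc_subset_uIcc hs)) (norm_nonneg _))

variable [CompleteSpace H]

/-- Integration by parts for the scalar product of two primitives of Bochner integrable
functions. -/
theorem inner_sub_inner_eq_integral {w v F Ψ : ℝ → H} {T : ℝ}
    (hw : IntervalIntegrable w volume 0 T) (hv : IntervalIntegrable v volume 0 T)
    (hF : ∀ t ∈ uIcc 0 T, F t = F 0 + ∫ s in (0 : ℝ)..t, w s)
    (hΨ : ∀ t ∈ uIcc 0 T, Ψ t = Ψ 0 + ∫ s in (0 : ℝ)..t, v s) :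
    inner ℝ (F T) (Ψ T) - inner ℝ (F 0) (Ψ 0)
      = ∫ s in (0 : ℝ)..T, (inner ℝ (w s) (Ψ s) + inner ℝ (F s) (v s)) := by
  set F' : ℝ → H := fun t => F 0 + ∫ s in (0 : ℝ)..t, w s with hF'
  set Ψ' : ℝ → H := fun t => Ψ 0 + ∫ s in (0 : ℝ)..t, v s with hΨ'
  have e0 : (0 : ℝ) ∈ uIcc 0 T := left_mem_uIcc
  have eT : T ∈ uIcc 0 T := right_mem_uIcc
  have acw := absolutelyContinuousOnInterval_intervalIntegral hw
  have acv := absolutelyContinuousOnInterval_intervalIntegral hv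
  have cF' : ContinuousOn F' (uIcc 0 T) := continuousOn_const.add acw.continuousOn
  have cΨ' : ContinuousOn Ψ' (uIcc 0 T) := continuousOn_const.add acv.continuousOn
  obtain ⟨D₁, hD₁⟩ := isCompact_uIcc.exists_bound_of_continuousOn cF'
  obtain ⟨D₂, hD₂⟩ := isCompact_uIcc.exists_bound_of_continuousOn cΨ'
  have hg : IntervalIntegrable (fun s => inner ℝ (w s) (Ψ' s) + inner ℝ (F' s) (v s)) volume 0 T := by
    refine (intervalIntegrable_inner_of_continuousOn hw cΨ').add ?_
    simpa only [real_inner_comm] using intervalIntegrable_inner_of_continuousOn hv cF'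
  have ac1 : AbsolutelyContinuousOnInterval (fun t => inner ℝ (F' t) (Ψ' t)) 0 T := by
    have hN : AbsolutelyContinuousOnInterval
        (fun t => ∫ s in (0 : ℝ)..t, (‖w s‖ + ‖v s‖)) 0 T :=
      (hw.norm.add hv.norm).absolutelyContinuousOnInterval_intervalIntegral left_mem_uIcc
    refine absolutelyContinuousOnInterval_of_dist_le (D := |D₁| + |D₂|) hN ?_
    intro s hs t ht
    have k1 := dist_intervalIntegral_le hw (hw.norm.add hv.norm)
      (fun r => le_add_of_nonneg_right (norm_nonneg (v r))) hs ht
    have k2 := dist_intervalIntegral_le hv (hw.norm.add hv.norm)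
      (fun r => le_add_of_nonneg_left (norm_nonneg (w r))) hs ht
    have e : inner ℝ (F' s) (Ψ' s) - inner ℝ (F' t) (Ψ' t)
        = inner ℝ (F' s - F' t) (Ψ' s) + inner ℝ (F' t) (Ψ' s - Ψ' t) := by
      rw [inner_sub_left, inner_sub_right]; ring
    have d1 : ‖F' s - F' t‖ = dist (∫ r in (0 : ℝ)..s, w r) (∫ r in (0 : ℝ)..t, w r) := by
      rw [dist_eq_norm, hF']; simp
    have d2 : ‖Ψ' s - Ψ' t‖ = dist (∫ r in (0 : ℝ)..s, v r) (∫ r in (0 : ℝ)..t, v r) := by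
      rw [dist_eq_norm, hΨ']; simp
    rw [Real.dist_eq, e]
    refine (abs_add_le _ _).trans ?_
    rw [add_comm |D₁|, add_mul]
    refine add_le_add ((abs_real_inner_le_norm _ _).trans ?_)
      ((abs_real_inner_le_norm _ _).trans ?_)
    · rw [mul_comm]
      exact mul_le_mul ((hD₂ s hs).trans (le_abs_self _)) (d1.le.trans k1) (norm_nonneg _)
        (abs_nonneg _)
    · exact mul_le_mul ((hD₁ t ht).trans (le_abs_self _)) (d2.le.trans k2) (norm_nonneg _)
        (abs_nonneg _)
  have ac2 := ac1.sub (absolutelyContinuousOnInterval_intervalIntegral hg)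
  -- The difference of the two sides is absolutely continuous, with derivative zero almost
  -- everywhere.
  obtain ⟨c, hc⟩ := ac2.const_of_ae_hasDerivAt_zero (by
    filter_upwards [hw.ae_hasDerivAt_integral, hv.ae_hasDerivAt_integral,
      hg.ae_hasDerivAt_integral] with x h1 h2 h3 hx
    have d1 : HasDerivAt F' (w x) x := (h1 hx 0 e0).const_add (F 0)
    have d2 : HasDerivAt Ψ' (v x) x := (h2 hx 0 e0).const_add (Ψ 0)
    have d3 := (d1.inner ℝ d2).sub (h3 hx 0 e0)
    refine d3.congr_deriv ?_
    ring)
  have h1 := (hc T eT).trans (hc 0 e0).symm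
  simp only [Pi.sub_apply, intervalIntegral.integral_same, sub_zero] at h1
  have h2 : F' T = F T := (hF T eT).symm
  have h3 : Ψ' T = Ψ T := (hΨ T eT).symm
  have h4 : F' 0 = F 0 := (hF 0 e0).symm
  have h5 : Ψ' 0 = Ψ 0 := (hΨ 0 e0).symm
  rw [h2, h3, h4, h5] at h1
  rw [← h1, sub_sub_cancel]
  refine intervalIntegral.integral_congr fun s hs => ?_
  simp only [hF', hΨ', ← hF s hs, ← hΨ s hs]

end Product

/-- Gronwall's inequality with an integrable coefficient. -/
theorem le_mul_exp_of_le_add_integral {u κ : ℝ → ℝ} {A T : ℝ} (hT : 0 ≤ T)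
    (hu : ContinuousOn u (Icc 0 T)) (hκ : IntervalIntegrable κ volume 0 T) (hκ0 : ∀ s, 0 ≤ κ s)
    (h : ∀ t ∈ Icc 0 T, u t ≤ A + ∫ s in (0 : ℝ)..t, κ s * u s) :
    u T ≤ A * Real.exp (∫ s in (0 : ℝ)..T, κ s) := by
  rw [← uIcc_of_le hT] at hu h
  have hκu : IntervalIntegrable (fun s => κ s * u s) volume 0 T := hκ.mul_continuousOn hu
  have e0 : (0 : ℝ) ∈ uIcc 0 T := left_mem_uIcc
  set K : ℝ → ℝ := fun t => ∫ s in (0 : ℝ)..t, κ s with hK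
  set Y : ℝ → ℝ := fun t => A + ∫ s in (0 : ℝ)..t, κ s * u s with hY
  have acK : AbsolutelyContinuousOnInterval K 0 T :=
    absolutelyContinuousOnInterval_intervalIntegral hκ
  have K0 : ∀ t ∈ uIcc 0 T, 0 ≤ K t := fun t ht => by
    rw [uIcc_of_le hT] at ht
    exact intervalIntegral.integral_nonneg ht.1 fun s _ => hκ0 s
  have acY : AbsolutelyContinuousOnInterval Y 0 T :=
    absolutelyContinuousOnInterval_of_dist_le (D := 1)
      (absolutelyContinuousOnInterval_intervalIntegral hκu) fun s _ t _ => by simp [hY]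
  have acE : AbsolutelyContinuousOnInterval (fun t => Real.exp (-K t)) 0 T := by
    refine absolutelyContinuousOnInterval_of_dist_le (D := 1) acK fun s hs t ht => ?_
    have hconv : Convex ℝ (Iic (0 : ℝ)) := convex_Iic 0
    have := hconv.norm_image_sub_le_of_norm_deriv_le (f := Real.exp) (C := 1)
      (x := -K t) (y := -K s) (fun x _ => Real.differentiableAt_exp)
      (fun x hx => by simpa [Real.abs_exp] using hx) (by simpa using K0 t ht) (by simpa using K0 s hs)
    rw [dist_eq_norm, dist_comm, dist_eq_norm]
    refine this.trans (le_of_eq ?_)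
    congr 2; ring
  -- `Y exp (-K)` is absolutely continuous, and its derivative is nonpositive as `u ≤ Y`.
  have ac := acY.mul acE
  have hle := ac.integral_deriv_eq_sub
  have hneg : ∫ x in (0 : ℝ)..T, deriv (Y * fun t => Real.exp (-K t)) x ≤ 0 := by
    rw [intervalIntegral.integral_of_le hT]
    refine integral_nonpos_of_ae ?_
    rw [EventuallyLE, ae_restrict_iff' measurableSet_Ioc]
    filter_upwards [hκ.ae_hasDerivAt_integral, hκu.ae_hasDerivAt_integral] with x h1 h2 hx
    have hx' : x ∈ uIcc 0 T := by rw [uIcc_of_le hT]; exact Ioc_subset_Icc_self hx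
    have d1 : HasDerivAt K (κ x) x := h1 hx' 0 e0
    have d2 : HasDerivAt Y (κ x * u x) x := (h2 hx' 0 e0).const_add A
    have d3 := d2.mul (HasDerivAt.exp (f := fun t => -K t) d1.neg)
    rw [d3.deriv]
    have : u x ≤ Y x := h x hx'
    have e : κ x * u x * Real.exp (-K x) + Y x * (Real.exp (-K x) * -κ x)
      = -(κ x * Real.exp (-K x) * (Y x - u x)) := by ring
    simp only [Pi.zero_apply]
    refine e.le.trans (neg_nonpos.2 (mul_nonneg (mul_nonneg (hκ0 x) (Real.exp_pos _).le) ?_))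
    linarith
  rw [hle] at hneg
  simp only [Pi.mul_apply, hY, hK, intervalIntegral.integral_same, add_zero, neg_zero,
    Real.exp_zero, mul_one] at hneg
  have h1 := h T right_mem_uIcc
  have h2 : Real.exp (-∫ s in (0 : ℝ)..T, κ s) * Real.exp (∫ s in (0 : ℝ)..T, κ s) = 1 := by
    rw [← Real.exp_add]; simp
  have h3 : (A + ∫ s in (0 : ℝ)..T, κ s * u s) * Real.exp (-∫ s in (0 : ℝ)..T, κ s) ≤ A := by
    linarith
  calc u T ≤ A + ∫ s in (0 : ℝ)..T, κ s * u s := h1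
    _ = (A + ∫ s in (0 : ℝ)..T, κ s * u s) * Real.exp (-∫ s in (0 : ℝ)..T, κ s)
        * Real.exp (∫ s in (0 : ℝ)..T, κ s) := by rw [mul_assoc, h2, mul_one]
    _ ≤ _ := mul_le_mul_of_nonneg_right h3 (Real.exp_pos _).le

/-! ### Differentiable functions on the torus -/

section TorusCalculus

variable {d : ℕ}

/-- The covering map of the torus by the Euclidean space. -/
def proj (y : EuclideanSpace ℝ (Fin d)) : Torus d := fun i => ((y i : ℝ) : UnitAddCircle)

theorem lift_apply (g : Torus d → ℝ) (y : EuclideanSpace ℝ (Fin d)) : lift g y = g (proj y) := rfl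

theorem proj_add (y z : EuclideanSpace ℝ (Fin d)) : proj (y + z) = proj y + proj z := by
  funext i
  simp [proj]

theorem proj_zero : proj (0 : EuclideanSpace ℝ (Fin d)) = 0 := by
  funext i
  simp [proj]

theorem proj_single (i : Fin d) (h : ℝ) :
    proj (h • EuclideanSpace.single i (1 : ℝ)) = Pi.single i (h : UnitAddCircle) := by
  funext j
  rcases eq_or_ne j i with rfl | hj
  · simp [proj]
  · simp [proj, hj]

theorem isOpenQuotientMap_proj : IsOpenQuotientMap (proj (d := d)) := by
  have h1 : IsOpenQuotientMap (fun (y : Fin d → ℝ) (i : Fin d) => ((y i : ℝ) : UnitAddCircle)) :=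
    IsOpenQuotientMap.piMap fun _ => QuotientAddGroup.isOpenQuotientMap_mk
  exact h1.comp (EuclideanSpace.equiv (Fin d) ℝ).toHomeomorph.isOpenQuotientMap

theorem proj_surjective : Function.Surjective (proj (d := d)) := isOpenQuotientMap_proj.surjective

theorem continuous_proj : Continuous (proj (d := d)) := isOpenQuotientMap_proj.continuous

theorem IsCk.mono {n k : ℕ} {g : Torus d → ℝ} (h : IsCk n g) (hk : k ≤ n) : IsCk k g :=
  ContDiff.of_le h (by exact_mod_cast hk)

theorem IsCk.continuous {n : ℕ} {g : Torus d → ℝ} (h : IsCk n g) : Continuous g :=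
  isOpenQuotientMap_proj.isQuotientMap.continuous_iff.2 (ContDiff.continuous h)

theorem IsCk.differentiable {g : Torus d → ℝ} (h : IsCk 1 g) : Differentiable ℝ (lift g) :=
  ContDiff.differentiable h (by norm_num)

theorem IsCk.hasDerivAt {g : Torus d → ℝ} (h : IsCk 1 g) (i : Fin d)
    (y : EuclideanSpace ℝ (Fin d)) :
    HasDerivAt (fun t : ℝ => g (proj y + Pi.single i (t : UnitAddCircle)))
      (fderiv ℝ (lift g) y (EuclideanSpace.single i 1)) 0 := by
  have h1 : HasDerivAt (fun t : ℝ => y + t • EuclideanSpace.single i (1 : ℝ))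
      (EuclideanSpace.single i (1 : ℝ)) 0 := by
    simpa using ((hasDerivAt_id (0 : ℝ)).smul_const (EuclideanSpace.single i (1 : ℝ))).const_add y
  have h2 : HasFDerivAt (lift g) (fderiv ℝ (lift g) y)
      (y + (0 : ℝ) • EuclideanSpace.single i (1 : ℝ)) := by
    simpa using (h.differentiable y).hasFDerivAt
  refine (h2.comp_hasDerivAt (0 : ℝ) h1).congr_of_eventuallyEq (Eventually.of_forall fun t => ?_)
  simp only [Function.comp_apply, lift_apply, proj_add, proj_single]

theorem IsCk.partialD_proj {g : Torus d → ℝ} (h : IsCk 1 g) (i : Fin d)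
    (y : EuclideanSpace ℝ (Fin d)) :
    partialD i g (proj y) = fderiv ℝ (lift g) y (EuclideanSpace.single i 1) :=
  (h.hasDerivAt i y).deriv

theorem IsCk.hasDerivAt_partialD {g : Torus d → ℝ} (h : IsCk 1 g) (i : Fin d) (x : Torus d) :
    HasDerivAt (fun t : ℝ => g (x + Pi.single i (t : UnitAddCircle))) (partialD i g x) 0 := by
  obtain ⟨y, rfl⟩ := proj_surjective x
  rw [h.partialD_proj]
  exact h.hasDerivAt i y

theorem IsCk.partialD {n : ℕ} {g : Torus d → ℝ} (h : IsCk (n + 1) g) (i : Fin d) :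
    IsCk n (partialD i g) := by
  have h1 : lift (KineticLimit.partialD i g)
      = fun y => fderiv ℝ (lift g) y (EuclideanSpace.single i 1) := by
    funext y
    exact (h.mono (by omega : 1 ≤ n + 1)).partialD_proj i y
  unfold IsCk
  rw [h1]
  exact (ContDiff.fderiv_right (m := n) h (by norm_cast)).clm_apply contDiff_const

theorem IsCk.fderiv_apply {g : Torus d → ℝ} (h : IsCk 1 g) (y w : EuclideanSpace ℝ (Fin d)) :
    fderiv ℝ (lift g) y w = ∑ i, w i * KineticLimit.partialD i g (proj y) := by
  have hw : w = ∑ i, w i • EuclideanSpace.single i (1 : ℝ) := by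
    ext j
    simp [Finset.sum_apply, Pi.single_apply]
  conv_lhs => rw [hw]
  rw [map_sum]
  refine Finset.sum_congr rfl fun i _ => ?_
  rw [map_smul, h.partialD_proj, smul_eq_mul]

theorem exists_bound_of_continuous {g : Torus d → ℝ} (h : Continuous g) :
    ∃ c, 0 ≤ c ∧ ∀ x, |g x| ≤ c :=
  ⟨‖(⟨g, h⟩ : C(Torus d, ℝ))‖, norm_nonneg _, fun x => (⟨g, h⟩ : C(Torus d, ℝ)).norm_coe_le_norm x⟩

theorem exists_forall_abs_shift_sub_le {g : Torus d → ℝ} (h : Continuous g) {e : ℝ} (he : 0 < e) :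
    ∃ δ > 0, ∀ w : EuclideanSpace ℝ (Fin d), ‖w‖ ≤ δ → ∀ x, |g (x + proj w) - g x| ≤ e := by
  obtain ⟨δ, hδ, H⟩ := Metric.uniformContinuous_iff.1
    (CompactSpace.uniformContinuous_of_continuous h) e he
  have h0 : Tendsto (proj (d := d)) (𝓝 0) (𝓝 0) := by
    simpa [proj_zero] using (continuous_proj (d := d)).tendsto 0
  obtain ⟨r, hr, Hr⟩ := Metric.eventually_nhds_iff.1 (h0.eventually (Metric.ball_mem_nhds 0 hδ))
  refine ⟨r / 2, by positivity, fun w hw x => ?_⟩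
  have h1 : proj w ∈ Metric.ball (0 : Torus d) δ := Hr (by rw [dist_zero_right]; linarith)
  refine (H (a := x + proj w) (b := x) ?_).le
  rw [dist_eq_norm, add_sub_cancel_left]
  simpa using h1

/-- The first order expansion of a `C¹` function, uniformly on the torus. -/
theorem IsCk.exists_expansion {g : Torus d → ℝ} (h : IsCk 1 g) {e : ℝ} (he : 0 < e) :
    ∃ δ > 0, ∀ w : EuclideanSpace ℝ (Fin d), ‖w‖ ≤ δ → ∀ x,
      |g (x + proj w) - g x - ∑ i, w i * KineticLimit.partialD i g x| ≤ e * ‖w‖ := by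
  have hc : ∀ i, Continuous (KineticLimit.partialD i g) := fun i =>
    (IsCk.partialD (n := 0) h i).continuous
  have hd : 0 < e / (d + 1) := by positivity
  choose δ hδ H using fun i => exists_forall_abs_shift_sub_le (hc i) hd
  -- The minimum of the `δ i` is not available in dimension zero.
  obtain ⟨r, hr, Hr⟩ : ∃ r > 0, ∀ i, r ≤ δ i := by
    rcases isEmpty_or_nonempty (Fin d) with hE | hE
    · exact ⟨1, one_pos, fun i => hE.elim i⟩
    · obtain ⟨i₀, hi₀⟩ := Finite.exists_min δ
      exact ⟨δ i₀, hδ i₀, hi₀⟩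
  refine ⟨r, hr, fun w hw x => ?_⟩
  obtain ⟨y, rfl⟩ := proj_surjective x
  -- The mean value inequality on the ball of radius `r`, for `lift g` minus its differential at
  -- `y`.
  have key := (convex_closedBall y r).norm_image_sub_le_of_norm_fderiv_le' (f := lift g)
    (φ := fderiv ℝ (lift g) y) (C := e) (x := y) (y := y + w) (fun z _ => h.differentiable z)
    (fun z hz => ?_) (Metric.mem_closedBall_self hr.le) (by simpa using hw)
  · rw [add_sub_cancel_left, h.fderiv_apply] at key
    simpa only [lift_apply, proj_add, Real.norm_eq_abs] using key
  · refine ContinuousLinearMap.opNorm_le_bound _ he.le fun v => ?_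
    have hz' : ‖z - y‖ ≤ r := by simpa [dist_eq_norm] using hz
    rw [sub_apply, h.fderiv_apply, h.fderiv_apply, ← Finset.sum_sub_distrib]
    calc ‖∑ i, (v i * KineticLimit.partialD i g (proj z) - v i * KineticLimit.partialD i g (proj y))‖
        ≤ ∑ _i : Fin d, ‖v‖ * (e / (d + 1)) := by
          refine norm_sum_le_of_le _ fun i _ => ?_
          rw [← mul_sub, norm_mul]
          refine mul_le_mul (PiLp.norm_apply_le v i) ?_ (norm_nonneg _) (norm_nonneg _)
          have := H i (z - y) (hz'.trans (Hr i)) (proj y)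
          rwa [← proj_add, add_sub_cancel] at this
      _ = d * (e / (d + 1)) * ‖v‖ := by simp; ring
      _ ≤ e * ‖v‖ := by
          refine mul_le_mul_of_nonneg_right ?_ (norm_nonneg _)
          rw [mul_div_assoc', div_le_iff₀ (by positivity)]
          nlinarith

/-- `g` is Lipschitz continuous in each coordinate of the torus, with constant `L`. -/
def CoordLipschitz (L : ℝ) (g : Torus d → ℝ) : Prop :=
  ∀ x i (h : ℝ), |g (x + Pi.single i (h : UnitAddCircle)) - g x| ≤ L * |h|

theorem coordLipschitz_of_fderiv {g : Torus d → ℝ} {L : ℝ} (h : IsCk 1 g)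
    (hL : ∀ y, ‖fderiv ℝ (lift g) y‖ ≤ L) : CoordLipschitz L g := by
  intro x i t
  obtain ⟨y, rfl⟩ := proj_surjective x
  have key := convex_univ.norm_image_sub_le_of_norm_fderiv_le (f := lift g) (C := L) (x := y)
    (y := y + t • EuclideanSpace.single i (1 : ℝ)) (fun z _ => h.differentiable z)
    (fun z _ => hL z) (mem_univ _) (mem_univ _)
  simpa [lift_apply, proj_add, proj_single, norm_smul] using key

theorem IsCk.exists_coordLipschitz {g : Torus d → ℝ} (h : IsCk 1 g) :
    ∃ L, 0 ≤ L ∧ CoordLipschitz L g := by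
  choose c hc0 hc using fun i => exists_bound_of_continuous (IsCk.partialD (n := 0) h i).continuous
  have h0 : 0 ≤ ∑ i, c i := Finset.sum_nonneg fun i _ => hc0 i
  refine ⟨∑ i, c i, h0, coordLipschitz_of_fderiv h fun y => ?_⟩
  refine ContinuousLinearMap.opNorm_le_bound _ h0 fun v => ?_
  rw [h.fderiv_apply, Finset.sum_mul]
  refine norm_sum_le_of_le _ fun i _ => ?_
  rw [norm_mul, mul_comm]
  exact mul_le_mul (hc i _) (PiLp.norm_apply_le v i) (norm_nonneg _) (hc0 i)

theorem CoordLipschitz.mono {g : Torus d → ℝ} {L L' : ℝ} (h : CoordLipschitz L g) (hL : L ≤ L') :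
    CoordLipschitz L' g := fun x i t =>
  (h x i t).trans (mul_le_mul_of_nonneg_right hL (abs_nonneg _))

theorem CoordLipschitz.add {g g' : Torus d → ℝ} {L L' : ℝ} (h : CoordLipschitz L g)
    (h' : CoordLipschitz L' g') : CoordLipschitz (L + L') fun x => g x + g' x := fun x i t => by
  rw [add_sub_add_comm, add_mul]
  exact (abs_add_le _ _).trans (add_le_add (h x i t) (h' x i t))

theorem CoordLipschitz.sub {g g' : Torus d → ℝ} {L L' : ℝ} (h : CoordLipschitz L g)
    (h' : CoordLipschitz L' g') : CoordLipschitz (L + L') fun x => g x - g' x := fun x i t => by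
  rw [sub_sub_sub_comm, add_mul]
  exact (abs_sub _ _).trans (add_le_add (h x i t) (h' x i t))

theorem CoordLipschitz.mul {g g' : Torus d → ℝ} {L L' B B' : ℝ} (h : CoordLipschitz L g)
    (h' : CoordLipschitz L' g') (hB : ∀ x, |g x| ≤ B) (hB' : ∀ x, |g' x| ≤ B') :
    CoordLipschitz (L * B' + B * L') fun x => g x * g' x := fun x i t => by
  have e : g (x + Pi.single i (t : UnitAddCircle)) * g' (x + Pi.single i (t : UnitAddCircle))
      - g x * g' x = (g (x + Pi.single i (t : UnitAddCircle)) - g x)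
        * g' (x + Pi.single i (t : UnitAddCircle))
      + g x * (g' (x + Pi.single i (t : UnitAddCircle)) - g' x) := by ring
  have hB0 : 0 ≤ B := (abs_nonneg _).trans (hB x)
  rw [e]
  refine (abs_add_le _ _).trans ?_
  rw [abs_mul, abs_mul]
  calc _ ≤ L * |t| * B' + B * (L' * |t|) := by
        refine add_le_add (mul_le_mul (h x i t) (hB' _) (abs_nonneg _) ?_)
          (mul_le_mul (hB x) (h' x i t) (abs_nonneg _) hB0)
        exact (abs_nonneg _).trans (h x i t)
    _ = _ := by ring

theorem partialD_sum_mul (i : Fin d) (c : Fin d → ℝ) {g : Fin d → Torus d → ℝ}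
    (h : ∀ j, IsCk 1 (g j)) (x : Torus d) :
    partialD i (fun y => ∑ j, c j * g j y) x = ∑ j, c j * partialD i (g j) x :=
  (HasDerivAt.fun_sum fun j _ => ((h j).hasDerivAt_partialD i x).const_mul (c j)).deriv

end TorusCalculus

/-! ### The transport group -/

namespace VelocityModel

theorem flow_eq {d : ℕ} {V : Type*} (c : V → EuclideanSpace ℝ (Fin d)) (t : ℝ) (p : Torus d × V) :
    flow c t p = (p.1 + proj (t • c p.2), p.2) := rfl

theorem flow_flow {d : ℕ} {V : Type*} (c : V → EuclideanSpace ℝ (Fin d)) (s t : ℝ) (p : Torus d × V) :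
    flow c s (flow c t p) = flow c (s + t) p := by
  simp only [flow_eq, add_smul, proj_add]
  rw [add_assoc, add_comm (proj (t • c p.2))]

variable {d : ℕ} {V : Type*} [MeasurableSpace V] {μ : Measure V} (C : VelocityModel d μ)

theorem mulX_coe (g : C(Torus d, ℝ)) (f : C.L2M) :
    C.mulX g f =ᵐ[C.weight] fun p => g p.1 * f p :=
  MemLp.coeFn_toLp _

theorem norm_mulX_le (g : C(Torus d, ℝ)) (f : C.L2M) : ‖C.mulX g f‖ ≤ ‖g‖ * ‖f‖ := by
  refine Lp.norm_le_mul_norm_of_ae_le_mul ?_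
  filter_upwards [C.mulX_coe g f] with p hp
  rw [hp, norm_mul]
  exact mul_le_mul_of_nonneg_right (g.norm_coe_le_norm p.1) (norm_nonneg _)

section Transport

variable [SigmaFinite μ]

/-- The operator `exp (-t A^ε)` as a linear isometry. -/
def transportLI (ε t : ℝ) : C.L2M →ₗᵢ[ℝ] C.L2M :=
  Lp.compMeasurePreservingₗᵢ ℝ (flow (C.speed ε) (-t))
    (C.measurePreserving_flow (C.measurable_speed ε) (-t))

theorem transportLI_apply (ε t : ℝ) (f : C.L2M) : C.transportLI ε t f = C.transport ε t f := rfl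

theorem transport_coe (ε t : ℝ) (f : C.L2M) :
    C.transport ε t f =ᵐ[C.weight] fun p => f (flow (C.speed ε) (-t) p) :=
  Lp.coeFn_compMeasurePreserving f _

theorem transport_transport (ε s t : ℝ) (f : C.L2M) :
    C.transport ε s (C.transport ε t f) = C.transport ε (s + t) f := by
  ext1
  -- The representative of `C.transport ε t f` is known almost everywhere only, hence the pull-back
  -- of a null set by the flow.
  have h := (C.measurePreserving_flow (C.measurable_speed ε) (-s)).quasiMeasurePreserving.ae
    (C.transport_coe ε t f)
  filter_upwards [C.transport_coe ε s (C.transport ε t f), C.transport_coe ε (s + t) f, h]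
    with p h1 h2 h3
  rw [h1, h2, h3, flow_flow]
  congr 2
  ring

theorem transport_zero (ε : ℝ) (f : C.L2M) : C.transport ε 0 f = f := by
  ext1
  filter_upwards [C.transport_coe ε 0 f] with p h1
  rw [h1]
  simp [flow_eq, proj_zero]

theorem transport_neg_transport (ε t : ℝ) (f : C.L2M) :
    C.transport ε (-t) (C.transport ε t f) = f := by
  rw [transport_transport, neg_add_cancel, transport_zero]

theorem inner_transport_transport (ε t : ℝ) (f g : C.L2M) :
    inner ℝ (C.transport ε t f) (C.transport ε t g) = inner ℝ f g :=
  (C.transportLI ε t).inner_map_map f g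

theorem norm_transport (ε t : ℝ) (f : C.L2M) : ‖C.transport ε t f‖ = ‖f‖ :=
  (C.transportLI ε t).norm_map f

/-! ### Dissipation -/

theorem norm_density_le (f : C.L2M) : ‖C.density f‖ ≤ ‖f‖ := by
  have h := C.density.le_of_opNorm_le (LinearMap.mkContinuous_norm_le _ zero_le_one _) f
  rwa [one_mul] at h

theorem memLp_M : MemLp (fun p : Torus d × V => C.M p.2) 2 C.weight ∧
    eLpNorm (fun p : Torus d × V => C.M p.2) 2 C.weight ≤ 1 := by
  have h : eLpNorm (fun p : Torus d × V => C.M p.2) 2 C.weight ≤ 1 := by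
    refine (ENNReal.pow_le_pow_left_iff two_ne_zero).1 ?_
    rw [eLpNorm_sq, one_pow]
    have : ∀ p : Torus d × V, ‖C.M p.2‖ₑ ^ 2 = 1 * ENNReal.ofReal (C.M p.2) ^ 2 := fun p => by
      rw [Real.enorm_eq_ofReal (C.M_pos p.2).le, one_mul]
    simp_rw [this]
    rw [weight, lintegral_prod_mul (f := fun _ => (1 : ℝ≥0∞)) aemeasurable_const
      (C.measurable_M.ennreal_ofReal.pow_const 2).aemeasurable, C.lintegral_M_sq]
    simp
  exact ⟨⟨(C.measurable_M.comp measurable_snd).aestronglyMeasurable,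
    h.trans_lt ENNReal.one_lt_top⟩, h⟩

theorem equilibrium_coe (r : L2x d) :
    C.equilibrium r =ᵐ[C.weight] fun p => r p.1 * C.M p.2 :=
  MemLp.coeFn_toLp _

theorem norm_equilibrium_le (r : L2x d) : ‖C.equilibrium r‖ ≤ ‖r‖ := by
  unfold equilibrium
  rw [Lp.norm_toLp, Lp.norm_def]
  refine ENNReal.toReal_mono (Lp.eLpNorm_ne_top r) ?_
  refine (ENNReal.pow_le_pow_left_iff two_ne_zero).1 (le_of_eq ?_)
  rw [eLpNorm_sq, eLpNorm_sq]
  have : ∀ p : Torus d × V, ‖r p.1 * C.M p.2‖ₑ ^ 2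
      = ‖r p.1‖ₑ ^ 2 * ENNReal.ofReal (C.M p.2) ^ 2 := fun p => by
    rw [enorm_mul, mul_pow, Real.enorm_eq_ofReal (C.M_pos p.2).le]
  simp_rw [this]
  rw [weight, lintegral_prod_mul ((Lp.aestronglyMeasurable r).enorm.pow_const 2)
    (C.measurable_M.ennreal_ofReal.pow_const 2).aemeasurable, C.lintegral_M_sq, mul_one]

/-- The collision operator is dissipative. -/
theorem inner_bgk_nonpos (f : C.L2M) : inner ℝ f (C.bgk f) ≤ 0 := by
  unfold bgk
  rw [inner_sub_right, real_inner_self_eq_norm_sq, sub_nonpos]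
  refine (real_inner_le_norm _ _).trans ?_
  rw [sq]
  exact mul_le_mul_of_nonneg_left
    ((C.norm_equilibrium_le _).trans (C.norm_density_le f)) (norm_nonneg _)

/-! ### Moments against bounded functions -/

/-- `Φ` is an admissible (measurable and bounded) function of position and velocity. -/
def IsBdd {α : Type*} [MeasurableSpace α] (Φ : α → ℝ) : Prop :=
  Measurable Φ ∧ ∃ c, ∀ p, |Φ p| ≤ c

theorem memLp_test {Φ : Torus d × V → ℝ} (h : IsBdd Φ) :
    MemLp (fun p => Φ p * C.M p.2) 2 C.weight := by
  obtain ⟨h1, c, hc⟩ := h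
  refine C.memLp_M.1.of_le_mul (c := c)
    (h1.mul (C.measurable_M.comp measurable_snd)).aestronglyMeasurable (ae_of_all _ fun p => ?_)
  rw [norm_mul]
  exact mul_le_mul_of_nonneg_right (hc p) (norm_nonneg _)

open Classical in
/-- The element `Φ M` of `L²(M⁻¹)`, for `Φ` measurable and bounded (and `0` otherwise). The scalar
product with it is integration against `Φ` for `dx dμ`. -/
def testVec (Φ : Torus d × V → ℝ) : C.L2M :=
  if h : IsBdd Φ then (C.memLp_test h).toLp else 0

theorem testVec_coe {Φ : Torus d × V → ℝ} (h : IsBdd Φ) :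
    C.testVec Φ =ᵐ[C.weight] fun p => Φ p * C.M p.2 := by
  unfold testVec
  rw [dif_pos h]
  exact MemLp.coeFn_toLp _

theorem testVec_eq_of_coe {Φ : Torus d × V → ℝ} (h : IsBdd Φ) {g : C.L2M}
    (hg : g =ᵐ[C.weight] fun p => Φ p * C.M p.2) : C.testVec Φ = g := by
  ext1
  exact (C.testVec_coe h).trans hg.symm

theorem norm_testVec_le {Φ : Torus d × V → ℝ} (h : IsBdd Φ) {B : ℝ} (hB0 : 0 ≤ B)
    (hB : ∀ p, |Φ p| ≤ B) : ‖C.testVec Φ‖ ≤ B := by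
  unfold testVec
  rw [dif_pos h, Lp.norm_toLp]
  refine ENNReal.toReal_le_of_le_ofReal hB0 ?_
  refine (eLpNorm_le_mul_eLpNorm_of_ae_le_mul (g := fun p : Torus d × V => C.M p.2) (c := B)
    (ae_of_all _ fun p => ?_) 2).trans (mul_le_of_le_one_right' C.memLp_M.2)
  rw [norm_mul]
  exact mul_le_mul_of_nonneg_right (hB p) (norm_nonneg _)

theorem testVec_comp_flow {Φ : Torus d × V → ℝ} (h : IsBdd Φ) (ε t : ℝ) :
    IsBdd (fun p => Φ (flow (C.speed ε) t p)) ∧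
    C.testVec (fun p => Φ (flow (C.speed ε) t p)) = C.transport ε (-t) (C.testVec Φ) := by
  have hb : IsBdd (fun p => Φ (flow (C.speed ε) t p)) :=
    ⟨h.1.comp (C.measurePreserving_flow (C.measurable_speed ε) t).measurable,
      h.2.imp fun c hc p => hc _⟩
  refine ⟨hb, C.testVec_eq_of_coe hb ?_⟩
  have h1 := (C.measurePreserving_flow (C.measurable_speed ε) t).quasiMeasurePreserving.ae
    (C.testVec_coe h)
  filter_upwards [C.transport_coe ε (-t) (C.testVec Φ), h1] with p hp hp'
  rw [hp, neg_neg, hp']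
  rfl

end Transport

end VelocityModel

namespace VelocityModel

theorem IsBdd.mul {α : Type*} [MeasurableSpace α] {Φ Φ' : α → ℝ} (h : IsBdd Φ) (h' : IsBdd Φ') :
    IsBdd fun p => Φ p * Φ' p := by
  obtain ⟨h1, c, hc⟩ := h
  obtain ⟨h1', c', hc'⟩ := h'
  refine ⟨h1.mul h1', c * c', fun p => ?_⟩
  rw [abs_mul]
  exact mul_le_mul (hc p) (hc' p) (abs_nonneg _) ((abs_nonneg _).trans (hc p))

theorem IsBdd.add {α : Type*} [MeasurableSpace α] {Φ Φ' : α → ℝ} (h : IsBdd Φ) (h' : IsBdd Φ') :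
    IsBdd fun p => Φ p + Φ' p := by
  obtain ⟨h1, c, hc⟩ := h
  obtain ⟨h1', c', hc'⟩ := h'
  exact ⟨h1.add h1', c + c', fun p => (abs_add_le _ _).trans (add_le_add (hc p) (hc' p))⟩

theorem isBdd_const {α : Type*} [MeasurableSpace α] (c : ℝ) : IsBdd fun _ : α => c :=
  ⟨measurable_const, |c|, fun _ => le_rfl⟩

theorem IsBdd.const_mul {α : Type*} [MeasurableSpace α] {Φ : α → ℝ} (h : IsBdd Φ) (c : ℝ) :
    IsBdd fun p => c * Φ p :=
  (isBdd_const c).mul h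

theorem IsBdd.sum {α ι : Type*} [MeasurableSpace α] {Φ : ι → α → ℝ} (h : ∀ i, IsBdd (Φ i))
    (S : Finset ι) : IsBdd fun p => ∑ i ∈ S, Φ i p := by
  classical
  induction S using Finset.induction_on with
  | empty => simpa using isBdd_const 0
  | insert i S hi ih =>
    simp only [Finset.sum_insert hi]
    exact (h i).add ih

theorem isBdd_of_continuous {d : ℕ} {η : Torus d → ℝ} (h : Continuous η) : IsBdd η :=
  ⟨h.measurable, (exists_bound_of_continuous h).imp fun _ hc => hc.2⟩

/-- The function `(x, v) ↦ α(v) η(x)`. -/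
def tensor {d : ℕ} {V : Type*} (α : V → ℝ) (η : Torus d → ℝ) : Torus d × V → ℝ :=
  fun p => α p.2 * η p.1

variable {d : ℕ} {V : Type*} [MeasurableSpace V] {μ : Measure V} (C : VelocityModel d μ)

theorem isBdd_tensor {α : V → ℝ} {η : Torus d → ℝ} (hα : IsBdd α) (hη : Continuous η) :
    IsBdd (tensor α η) := by
  obtain ⟨h1, c, hc⟩ := isBdd_of_continuous hη
  exact IsBdd.mul ⟨hα.1.comp measurable_snd, hα.2.imp fun c hc p => hc _⟩
    ⟨h1.comp measurable_fst, c, fun p => hc _⟩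

theorem isBdd_a (i : Fin d) : IsBdd fun v => C.a v i := by
  obtain ⟨c, hc⟩ := C.bounded_a
  have := C.measurable_a
  exact ⟨by fun_prop, c, fun v => (PiLp.norm_apply_le (C.a v) i).trans (hc v)⟩

theorem isBdd_b (i : Fin d) : IsBdd fun v => C.b v i := by
  obtain ⟨c, hc⟩ := C.bounded_b
  have := C.measurable_b
  exact ⟨by fun_prop, c, fun v => (PiLp.norm_apply_le (C.b v) i).trans (hc v)⟩

theorem speed_apply (ε : ℝ) (v : V) (i : Fin d) :
    C.speed ε v i = ε⁻¹ * C.a v i + C.b v i := rfl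

theorem isBdd_speed (ε : ℝ) (i : Fin d) : IsBdd fun v => C.speed ε v i :=
  ((C.isBdd_a i).const_mul ε⁻¹).add (C.isBdd_b i)

theorem exists_norm_speed_le (ε : ℝ) : ∃ c, 0 < c ∧ ∀ v, ‖C.speed ε v‖ ≤ c := by
  obtain ⟨c, hc⟩ := C.bounded_a
  obtain ⟨c', hc'⟩ := C.bounded_b
  refine ⟨|ε⁻¹| * |c| + |c'| + 1, by positivity, fun v => ?_⟩
  refine (norm_add_le _ _).trans ?_
  rw [norm_smul]
  have h1 : ‖ε⁻¹‖ * ‖C.a v‖ ≤ |ε⁻¹| * |c| :=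
    mul_le_mul_of_nonneg_left ((hc v).trans (le_abs_self c)) (norm_nonneg _)
  have h2 := (hc' v).trans (le_abs_self c')
  linarith

variable [SigmaFinite μ]

theorem testVec_add {Φ Φ' : Torus d × V → ℝ} (h : IsBdd Φ) (h' : IsBdd Φ') :
    C.testVec (fun p => Φ p + Φ' p) = C.testVec Φ + C.testVec Φ' := by
  refine C.testVec_eq_of_coe (h.add h') ?_
  filter_upwards [C.testVec_coe h, C.testVec_coe h', Lp.coeFn_add (C.testVec Φ) (C.testVec Φ')]
    with p h1 h2 h3
  rw [h3, Pi.add_apply, h1, h2, add_mul]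

theorem testVec_const_mul {Φ : Torus d × V → ℝ} (h : IsBdd Φ) (c : ℝ) :
    C.testVec (fun p => c * Φ p) = c • C.testVec Φ := by
  refine C.testVec_eq_of_coe (h.const_mul c) ?_
  filter_upwards [C.testVec_coe h, Lp.coeFn_smul c (C.testVec Φ)] with p h1 h3
  rw [h3, Pi.smul_apply, h1, smul_eq_mul, mul_assoc]

theorem testVec_sum {ι : Type*} {Φ : ι → Torus d × V → ℝ} (h : ∀ i, IsBdd (Φ i))
    (S : Finset ι) : C.testVec (fun p => ∑ i ∈ S, Φ i p) = ∑ i ∈ S, C.testVec (Φ i) := by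
  classical
  induction S using Finset.induction_on with
  | empty => simpa using C.testVec_const_mul (isBdd_const (α := Torus d × V) 0) 0
  | insert i S hi ih =>
    simp only [Finset.sum_insert hi]
    rw [C.testVec_add (h i) (IsBdd.sum h S), ih]

/-! ### Transport of test functions -/

theorem tendsto_transport_testVec {α : V → ℝ} {η : Torus d → ℝ} (hα : IsBdd α)
    (hη : Continuous η) (ε : ℝ) :
    Tendsto (fun s => C.transport ε (-s) (C.testVec (tensor α η))) (𝓝 0)
      (𝓝 (C.testVec (tensor α η))) := by
  obtain ⟨c, hc0, hc⟩ := C.exists_norm_speed_le ε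
  obtain ⟨A, hA⟩ := hα.2
  have hb := isBdd_tensor hα hη
  rw [Metric.tendsto_nhds]
  intro e he
  have hA1 : 0 < |A| + 1 := by positivity
  obtain ⟨δ, hδ, H⟩ := exists_forall_abs_shift_sub_le hη (div_pos (half_pos he) hA1)
  filter_upwards [Metric.ball_mem_nhds 0 (div_pos hδ hc0)] with s hs
  have hs' : |s| < δ / c := by simpa using hs
  obtain ⟨hb', e1⟩ := C.testVec_comp_flow hb ε s
  have e2 : C.transport ε (-s) (C.testVec (tensor α η)) - C.testVec (tensor α η)
      = C.testVec fun p => tensor α η (flow (C.speed ε) s p) + (-1) * tensor α η p := by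
    rw [C.testVec_add hb' (hb.const_mul (-1)), C.testVec_const_mul hb, e1, neg_one_smul,
      sub_eq_add_neg]
  rw [dist_eq_norm, e2]
  refine lt_of_le_of_lt (C.norm_testVec_le (hb'.add (hb.const_mul (-1))) (half_pos he).le ?_)
    (half_lt_self he)
  intro p
  have e3 : tensor α η (flow (C.speed ε) s p) + (-1) * tensor α η p
      = α p.2 * (η (p.1 + proj (s • C.speed ε p.2)) - η p.1) := by
    simp only [tensor, flow_eq]; ring
  rw [e3, abs_mul]
  have h1 : ‖s • C.speed ε p.2‖ ≤ δ := by
    rw [norm_smul]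
    rw [lt_div_iff₀ hc0] at hs'
    exact (mul_le_mul_of_nonneg_left (hc p.2) (norm_nonneg _)).trans hs'.le
  calc |α p.2| * |η (p.1 + proj (s • C.speed ε p.2)) - η p.1|
      ≤ (|A| + 1) * (e / 2 / (|A| + 1)) := by
        refine mul_le_mul ?_ (H _ h1 _) (abs_nonneg _) hA1.le
        linarith [hA p.2, le_abs_self A]
    _ = e / 2 := by field_simp

theorem continuous_transport_testVec {α : V → ℝ} {η : Torus d → ℝ} (hα : IsBdd α)
    (hη : Continuous η) (ε : ℝ) :
    Continuous fun s => C.transport ε (-s) (C.testVec (tensor α η)) := by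
  refine continuous_iff_continuousAt.2 fun s => ?_
  have h1 : Tendsto (fun r => r - s) (𝓝 s) (𝓝 0) := by
    simpa using (continuous_id.sub continuous_const).tendsto (x := s) (f := fun r : ℝ => r - s)
  have h2 := ((C.transportLI ε (-s)).continuous.tendsto _).comp
    ((C.tendsto_transport_testVec hα hη ε).comp h1)
  refine h2.congr fun r => ?_
  simp only [Function.comp_apply, transportLI_apply, transport_transport]
  congr 1
  ring

/-- The vector `c · ∇_x Ψ` for `Ψ = α(v) η(x)` and the velocity field `c = ε⁻¹ a + b`. -/
def gradVec (ε : ℝ) (α : V → ℝ) (η : Torus d → ℝ) : C.L2M :=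
  ∑ i, C.testVec (tensor (fun v => C.speed ε v i * α v) (partialD i η))

theorem hasDerivAt_transport_testVec_zero {α : V → ℝ} {η : Torus d → ℝ} (hα : IsBdd α)
    (hη : IsCk 1 η) (ε : ℝ) :
    HasDerivAt (fun s => C.transport ε (-s) (C.testVec (tensor α η))) (C.gradVec ε α η) 0 := by
  obtain ⟨c, hc0, hc⟩ := C.exists_norm_speed_le ε
  obtain ⟨A, hA⟩ := hα.2
  have hb := isBdd_tensor hα hη.continuous
  have hbi : ∀ i, IsBdd (tensor (fun v => C.speed ε v i * α v) (partialD i η)) := fun i =>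
    isBdd_tensor ((C.isBdd_speed ε i).mul hα) (IsCk.partialD (n := 0) hη i).continuous
  rw [hasDerivAt_iff_isLittleO_nhds_zero, Asymptotics.isLittleO_iff]
  intro e he
  have hA1 : 0 < |A| + 1 := by positivity
  obtain ⟨δ, hδ, H⟩ := hη.exists_expansion (div_pos he (mul_pos hA1 hc0))
  filter_upwards [Metric.ball_mem_nhds 0 (div_pos hδ hc0)] with s hs
  have hs' : |s| < δ / c := by simpa using hs
  obtain ⟨hb', e1⟩ := C.testVec_comp_flow hb ε s
  have hS := (IsBdd.sum hbi Finset.univ).const_mul (-s)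
  have e2 : C.transport ε (-(0 + s)) (C.testVec (tensor α η))
      - C.transport ε (-0) (C.testVec (tensor α η)) - s • C.gradVec ε α η
      = C.testVec fun p => (tensor α η (flow (C.speed ε) s p) + (-1) * tensor α η p)
        + (-s) * ∑ i, tensor (fun v => C.speed ε v i * α v) (partialD i η) p := by
    rw [C.testVec_add (hb'.add (hb.const_mul (-1))) hS,
      C.testVec_add hb' (hb.const_mul (-1)), C.testVec_const_mul hb, e1, neg_one_smul,
      C.testVec_const_mul (IsBdd.sum hbi Finset.univ), C.testVec_sum hbi, neg_zero, transport_zero,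
      zero_add, neg_smul, ← sub_eq_add_neg, ← sub_eq_add_neg, gradVec]
  rw [e2]
  refine C.norm_testVec_le ((hb'.add (hb.const_mul (-1))).add hS) (by positivity) ?_
  intro p
  set w := s • C.speed ε p.2 with hw
  have e3 : (tensor α η (flow (C.speed ε) s p) + (-1) * tensor α η p)
        + (-s) * ∑ i, tensor (fun v => C.speed ε v i * α v) (partialD i η) p
      = α p.2 * (η (p.1 + proj w) - η p.1 - ∑ i, w i * partialD i η p.1) := by
    simp only [tensor, flow_eq, hw, PiLp.smul_apply, smul_eq_mul, mul_sub, Finset.mul_sum]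
    rw [sub_eq_add_neg (_ - _), sub_eq_add_neg, ← Finset.sum_neg_distrib]
    congr 1
    · ring
    · exact Finset.sum_congr rfl fun i _ => by ring
  rw [e3, abs_mul]
  have h2 : ‖w‖ ≤ |s| * c := by
    rw [hw, norm_smul]
    exact mul_le_mul_of_nonneg_left (hc p.2) (norm_nonneg _)
  have h1 : ‖w‖ ≤ δ := by
    rw [lt_div_iff₀ hc0] at hs'
    exact h2.trans hs'.le
  calc |α p.2| * |η (p.1 + proj w) - η p.1 - ∑ i, w i * partialD i η p.1|
      ≤ (|A| + 1) * (e / ((|A| + 1) * c) * (|s| * c)) := by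
        refine mul_le_mul ?_ ((H _ h1 _).trans ?_) (abs_nonneg _) hA1.le
        · linarith [hA p.2, le_abs_self A]
        · exact mul_le_mul_of_nonneg_left h2 (by positivity)
    _ = e * ‖s‖ := by rw [Real.norm_eq_abs]; field_simp

theorem transport_testVec_eq_integral {α : V → ℝ} {η : Torus d → ℝ} (hα : IsBdd α)
    (hη : IsCk 1 η) (ε t : ℝ) :
    IntervalIntegrable (fun s => C.transport ε (-s) (C.gradVec ε α η)) volume 0 t ∧
    C.transport ε (-t) (C.testVec (tensor α η))
      = C.testVec (tensor α η) + ∫ s in (0 : ℝ)..t, C.transport ε (-s) (C.gradVec ε α η) := by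
  have hd : ∀ s, HasDerivAt (fun s => C.transport ε (-s) (C.testVec (tensor α η)))
      (C.transport ε (-s) (C.gradVec ε α η)) s := by
    intro s
    have h0 : HasDerivAt (fun s => C.transport ε (-s) (C.testVec (tensor α η)))
        (C.gradVec ε α η) (s - s) := by
      rw [sub_self]; exact C.hasDerivAt_transport_testVec_zero hα hη ε
    have h1 := h0.comp_sub_const s s
    have h2 := (C.transportLI ε (-s)).toContinuousLinearMap.hasFDerivAt.comp_hasDerivAt s h1
    refine h2.congr_of_eventuallyEq (Eventually.of_forall fun r => ?_)
    change C.transport ε (-r) _ = C.transport ε (-s) (C.transport ε (-(r - s)) _)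
    rw [transport_transport]
    congr 1
    ring
  have hcont : Continuous fun s => C.transport ε (-s) (C.gradVec ε α η) := by
    have : (fun s => C.transport ε (-s) (C.gradVec ε α η)) = fun s => ∑ i, C.transport ε (-s)
        (C.testVec (tensor (fun v => C.speed ε v i * α v) (partialD i η))) := by
      funext s
      exact map_sum (C.transportLI ε (-s)) _ _
    rw [this]
    exact continuous_finsetSum _ fun i _ => C.continuous_transport_testVec
      ((C.isBdd_speed ε i).mul hα) (IsCk.partialD (n := 0) hη i).continuous ε
  have hi := hcont.intervalIntegrable (μ := volume) 0 t
  refine ⟨hi, ?_⟩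
  rw [intervalIntegral.integral_eq_sub_of_hasDerivAt (fun s _ => hd s) hi, neg_zero,
    transport_zero, add_sub_cancel]

/-! ### Mild solutions -/

/-- The right hand side `ε⁻² L f - r f` of the transport equation along the path `f`. -/
def source (ε : ℝ) (r : ℝ → C(Torus d, ℝ)) (f : ℝ → C.L2M) (s : ℝ) : C.L2M :=
  (ε ^ 2)⁻¹ • C.bgk (f s) - C.mulX (r s) (f s)

variable {C}

/-- A mild solution, in the frame moving with the free transport, is the primitive of an
integrable function. -/
theorem IsMildSolution.transport_neg_eq {T : ℝ} {hT : 0 ≤ T} {ε : ℝ} {r : ℝ → C(Torus d, ℝ)}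
    {f₀ : C.L2M} {f : C(Icc (0 : ℝ) T, C.L2M)} (h : C.IsMildSolution hT ε r f₀ f) :
    IntervalIntegrable (fun s => C.transport ε (-s) (C.source ε r (IccExtend hT f) s)) volume 0 T ∧
    ∀ t ∈ Icc 0 T, C.transport ε (-t) (IccExtend hT f t)
      = f₀ + ∫ s in (0 : ℝ)..t, C.transport ε (-s) (C.source ε r (IccExtend hT f) s) := by
  have key : ∀ t : Icc (0 : ℝ) T,
      (fun s => C.transport ε (-s) (C.source ε r (IccExtend hT f) s))
      = fun s => (C.transportLI ε (-(t : ℝ))).toContinuousLinearMap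
        (C.transport ε (t - s) (C.source ε r (IccExtend hT f) s)) := by
    intro t
    funext s
    change _ = C.transport ε (-(t : ℝ)) _
    rw [transport_transport]
    congr 1
    ring
  refine ⟨?_, fun t ht => ?_⟩
  · obtain ⟨h1, -⟩ := h ⟨T, hT, le_rfl⟩
    rw [key ⟨T, hT, le_rfl⟩, intervalIntegrable_iff]
    exact (C.transportLI ε (-T)).toContinuousLinearMap.integrable_comp
      (intervalIntegrable_iff.1 h1)
  · obtain ⟨h1, h2⟩ := h ⟨t, ht⟩
    rw [key ⟨t, ht⟩]
    have h3 := (C.transportLI ε (-t)).toContinuousLinearMap.intervalIntegral_comp_comm h1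
    refine Eq.trans ?_ (congrArg (f₀ + ·) h3.symm)
    rw [IccExtend_of_mem hT f ht, h2]
    change C.transportLI ε (-t) _ = f₀ + C.transportLI ε (-t) _
    rw [map_add]
    congr 1
    exact C.transport_neg_transport ε t f₀

theorem IsMildSolution.apply_zero {T : ℝ} {hT : 0 ≤ T} {ε : ℝ} {r : ℝ → C(Torus d, ℝ)}
    {f₀ : C.L2M} {f : C(Icc (0 : ℝ) T, C.L2M)} (h : C.IsMildSolution hT ε r f₀ f) :
    IccExtend hT f 0 = f₀ := by
  have := h.transport_neg_eq.2 0 ⟨le_rfl, hT⟩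
  rwa [neg_zero, transport_zero, intervalIntegral.integral_same, add_zero] at this

/-- The form of `IsMildSolution.transport_neg_eq` on a subinterval `[0, t]`, as required by
`inner_sub_inner_eq_integral`. -/
theorem IsMildSolution.transport_neg_eq' {T : ℝ} {hT : 0 ≤ T} {ε : ℝ} {r : ℝ → C(Torus d, ℝ)}
    {f₀ : C.L2M} {f : C(Icc (0 : ℝ) T, C.L2M)} (h : C.IsMildSolution hT ε r f₀ f) {t : ℝ}
    (ht : t ∈ Icc 0 T) :
    IntervalIntegrable (fun s => C.transport ε (-s) (C.source ε r (IccExtend hT f) s)) volume 0 t ∧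
    ∀ t' ∈ uIcc 0 t, C.transport ε (-t') (IccExtend hT f t')
      = C.transport ε (-0) (IccExtend hT f 0)
        + ∫ s in (0 : ℝ)..t', C.transport ε (-s) (C.source ε r (IccExtend hT f) s) := by
  refine ⟨h.transport_neg_eq.1.mono_set (by
    rw [uIcc_of_le hT, uIcc_of_le ht.1]; exact Icc_subset_Icc_right ht.2), fun t' ht' => ?_⟩
  rw [neg_zero, transport_zero, h.apply_zero]
  rw [uIcc_of_le ht.1] at ht'
  exact h.transport_neg_eq.2 t' ⟨ht'.1, ht'.2.trans ht.2⟩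

/-- The a priori bound in `L²(M⁻¹)`, which is uniform in `ε` by dissipativity of the collision
operator. -/
theorem IsMildSolution.norm_le {T : ℝ} {hT : 0 ≤ T} {ε : ℝ} {r : ℝ → C(Torus d, ℝ)}
    {f₀ : C.L2M} {f : C(Icc (0 : ℝ) T, C.L2M)} (h : C.IsMildSolution hT ε r f₀ f)
    {κ : ℝ → ℝ} (hκ : IntervalIntegrable κ volume 0 T) (hr : ∀ s, ‖r s‖ ≤ κ s) {t : ℝ}
    (ht : t ∈ Icc 0 T) :
    ‖IccExtend hT f t‖ ≤ ‖f₀‖ * Real.exp (∫ s in (0 : ℝ)..T, κ s) := by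
  set u := IccExtend hT f with hu
  have hκ0 : ∀ s, 0 ≤ κ s := fun s => (norm_nonneg _).trans (hr s)
  have hcont : Continuous u := f.continuous.Icc_extend'
  have hsubset : ∀ {t}, t ∈ Icc 0 T → IntervalIntegrable κ volume 0 t := fun {t} ht =>
    hκ.mono_set (by rw [uIcc_of_le hT, uIcc_of_le ht.1]; exact Icc_subset_Icc_right ht.2)
  -- The energy estimate: the square of the norm is not affected by free transport.
  have hen : ∀ t ∈ Icc 0 T, ‖u t‖ ^ 2 ≤ ‖f₀‖ ^ 2 + ∫ s in (0 : ℝ)..t, 2 * κ s * ‖u s‖ ^ 2 := by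
    intro t ht
    obtain ⟨h1, h2⟩ := h.transport_neg_eq' ht
    have h3 := inner_sub_inner_eq_integral h1 h1 h2 h2
    simp only [inner_transport_transport, real_inner_self_eq_norm_sq, norm_transport, ← hu] at h3
    have h4 : ∀ s, inner ℝ (C.source ε r u s) (u s) + inner ℝ (u s) (C.source ε r u s)
        ≤ 2 * κ s * ‖u s‖ ^ 2 := by
      intro s
      rw [real_inner_comm (u s) (C.source ε r u s)]
      have h5 : inner ℝ (u s) (C.source ε r u s) ≤ κ s * ‖u s‖ ^ 2 := by
        unfold source
        rw [inner_sub_right, real_inner_smul_right]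
        have h6 : (ε ^ 2)⁻¹ * inner ℝ (u s) (C.bgk (u s)) ≤ 0 :=
          mul_nonpos_of_nonneg_of_nonpos (by positivity) (C.inner_bgk_nonpos _)
        have h7 : -inner ℝ (u s) (C.mulX (r s) (u s)) ≤ κ s * ‖u s‖ ^ 2 := by
          refine (neg_le_abs _).trans ((abs_real_inner_le_norm _ _).trans ?_)
          have h8 := (C.norm_mulX_le (r s) (u s)).trans
            (mul_le_mul_of_nonneg_right (hr s) (norm_nonneg _))
          calc _ ≤ ‖u s‖ * (κ s * ‖u s‖) := mul_le_mul_of_nonneg_left h8 (norm_nonneg _)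
            _ = _ := by ring
        linarith
      linarith
    have e0 : u 0 = f₀ := h.apply_zero
    rw [e0] at h3
    rw [← sub_le_iff_le_add', h3]
    refine intervalIntegral.integral_mono_on ht.1 ?_ ?_ fun s _ => h4 s
    · have hc' : ContinuousOn (fun s => C.transport ε (-s) (u s)) (uIcc 0 t) := by
        refine ContinuousOn.congr (f := fun t' => C.transport ε (-0) (u 0)
          + ∫ s in (0 : ℝ)..t', C.transport ε (-s) (C.source ε r u s)) ?_ h2
        exact continuousOn_const.add
          (absolutelyContinuousOnInterval_intervalIntegral h1).continuousOn
      have h9 := intervalIntegrable_inner_of_continuousOn h1 hc'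
      simp only [inner_transport_transport] at h9
      refine h9.add ?_
      simpa only [real_inner_comm] using h9
    · exact ((hsubset ht).const_mul 2).mul_continuousOn (hcont.norm.pow 2).continuousOn
  have hg := le_mul_exp_of_le_add_integral (u := fun s => ‖u s‖ ^ 2) (κ := fun s => 2 * κ s)
    (A := ‖f₀‖ ^ 2) ht.1 (hcont.norm.pow 2).continuousOn ((hsubset ht).const_mul 2)
    (fun s => by have := hκ0 s; positivity) (fun s hs => hen s ⟨hs.1, hs.2.trans ht.2⟩)
  rw [intervalIntegral.integral_const_mul, two_mul, Real.exp_add, ← sq, ← mul_pow] at hg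
  refine (abs_le_of_sq_le_sq' hg (by positivity)).2.trans ?_
  refine mul_le_mul_of_nonneg_left (Real.exp_le_exp.2 ?_) (norm_nonneg _)
  exact intervalIntegral.integral_mono_interval le_rfl ht.1 ht.2 (ae_of_all _ hκ0) hκ

/-- The weak formulation of the equation, for the test function `α(v) η(x)`. -/
theorem IsMildSolution.weak {T : ℝ} {hT : 0 ≤ T} {ε : ℝ} {r : ℝ → C(Torus d, ℝ)}
    {f₀ : C.L2M} {f : C(Icc (0 : ℝ) T, C.L2M)} (h : C.IsMildSolution hT ε r f₀ f)
    {α : V → ℝ} {η : Torus d → ℝ} (hα : IsBdd α) (hη : IsCk 1 η) {t : ℝ} (ht : t ∈ Icc 0 T) :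
    IntervalIntegrable (fun s => inner ℝ (C.source ε r (IccExtend hT f) s)
      (C.testVec (tensor α η))) volume 0 t ∧
    inner ℝ (IccExtend hT f t) (C.testVec (tensor α η))
      - inner ℝ (IccExtend hT f 0) (C.testVec (tensor α η))
      = ∫ s in (0 : ℝ)..t, (inner ℝ (C.source ε r (IccExtend hT f) s) (C.testVec (tensor α η))
        + inner ℝ (IccExtend hT f s) (C.gradVec ε α η)) := by
  obtain ⟨h1, h2⟩ := h.transport_neg_eq' ht
  have h3 := fun t => C.transport_testVec_eq_integral hα hη ε t
  constructor
  · have h4 := intervalIntegrable_inner_of_continuousOn h1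
      (C.continuous_transport_testVec hα hη.continuous ε).continuousOn
    simpa only [inner_transport_transport] using h4
  · have h4 := inner_sub_inner_eq_integral h1 (h3 t).1 h2
      (Ψ := fun s => C.transport ε (-s) (C.testVec (tensor α η))) (fun t' _ => by
        rw [(h3 t').2, neg_zero, transport_zero])
    simpa only [inner_transport_transport] using h4

end VelocityModel

/-- The `L²` scalar product of `r` with a function `η` on the torus. -/
def pairX {d : ℕ} (r : L2x d) (η : Torus d → ℝ) : ℝ := ∫ x, r x * η x ∂(dx d)

section pairX

variable {d : ℕ}

theorem integrable_mul_of_continuous (r : L2x d) {η : Torus d → ℝ} (hη : Continuous η) :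
    Integrable (fun x => r x * η x) (dx d) := by
  obtain ⟨c, hc0, hc⟩ := exists_bound_of_continuous hη
  exact ((Lp.memLp r).integrable (by norm_num)).mul_bdd (c := c)
    hη.measurable.aestronglyMeasurable (ae_of_all _ hc)

theorem pairX_add (r : L2x d) {η η' : Torus d → ℝ} (h : Continuous η) (h' : Continuous η') :
    pairX r (fun x => η x + η' x) = pairX r η + pairX r η' := by
  unfold pairX
  simp only [mul_add]
  exact integral_add (integrable_mul_of_continuous r h) (integrable_mul_of_continuous r h')

theorem pairX_sub (r : L2x d) {η η' : Torus d → ℝ} (h : Continuous η) (h' : Continuous η') :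
    pairX r (fun x => η x - η' x) = pairX r η - pairX r η' := by
  unfold pairX
  simp only [mul_sub]
  exact integral_sub (integrable_mul_of_continuous r h) (integrable_mul_of_continuous r h')

theorem pairX_const_mul (r : L2x d) (c : ℝ) (η : Torus d → ℝ) :
    pairX r (fun x => c * η x) = c * pairX r η := by
  unfold pairX
  rw [← integral_const_mul]
  exact integral_congr_ae (ae_of_all _ fun x => by ring)

theorem pairX_sum (r : L2x d) {ι : Type*} (S : Finset ι) {η : ι → Torus d → ℝ}
    (h : ∀ i, Continuous (η i)) :
    pairX r (fun x => ∑ i ∈ S, η i x) = ∑ i ∈ S, pairX r (η i) := by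
  unfold pairX
  simp only [Finset.mul_sum]
  exact integral_finsetSum _ fun i _ => integrable_mul_of_continuous r (h i)

end pairX

namespace VelocityModel

variable {d : ℕ} {V : Type*} [MeasurableSpace V] {μ : Measure V} (C : VelocityModel d μ)

theorem integral_invM_mul_M (g : V → ℝ) : ∫ v, g v * C.M v ∂C.invM = ∫ v, g v ∂μ := by
  conv_rhs => rw [← C.withDensity_M]
  rw [integral_withDensity_eq_integral_toReal_smul C.measurable_M.ennreal_ofReal
    (ae_of_all _ fun _ => ENNReal.ofReal_lt_top)]
  refine integral_congr_ae (ae_of_all _ fun v => ?_)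
  simp only [ENNReal.toReal_ofReal (C.M_pos v).le, smul_eq_mul]
  ring

/-- The function `div(K∇ξ) + J · ∇ξ`. -/
def driftTest (ξ : Torus d → ℝ) (x : Torus d) : ℝ :=
  ∑ j, ∑ i, C.K i j * partialD i (partialD j ξ) x + ∑ i, C.J i * partialD i ξ x

variable {C} in
theorem pairX_driftTest (ρ : L2x d) {ξ : Torus d → ℝ} (hξ : IsCk 3 ξ) :
    pairX ρ (C.driftTest ξ) = ∑ j, ∑ i, C.K i j * pairX ρ (partialD i (partialD j ξ))
      + ∑ i, C.J i * pairX ρ (partialD i ξ) := by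
  have h1 : ∀ i, Continuous (partialD i ξ) := fun i => (IsCk.partialD (n := 2) hξ i).continuous
  have h2 : ∀ i j, Continuous (partialD i (partialD j ξ)) := fun i j =>
    (IsCk.partialD (n := 1) (IsCk.partialD (n := 2) hξ j) i).continuous
  unfold driftTest
  rw [pairX_add ρ (by fun_prop) (by fun_prop), pairX_sum ρ _ (by fun_prop),
    pairX_sum ρ _ (by fun_prop)]
  simp only [pairX_const_mul]
  congr 1
  refine Finset.sum_congr rfl fun j _ => ?_
  rw [pairX_sum ρ _ (by fun_prop)]
  simp only [pairX_const_mul]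

theorem integral_a_mul_M (j : Fin d) : ∫ v, C.a v j * C.M v ∂μ = 0 := by
  obtain ⟨c, hc⟩ := C.bounded_a
  have hi : Integrable (fun v => C.M v • C.a v) μ :=
    C.integrable_M.smul_bdd (C := c) C.measurable_a.aestronglyMeasurable (ae_of_all _ hc)
  have h := (EuclideanSpace.proj (𝕜 := ℝ) j : EuclideanSpace ℝ (Fin d) →L[ℝ] ℝ).integral_comp_comm hi
  rw [C.centred_a, map_zero] at h
  rw [← h]
  refine integral_congr_ae (ae_of_all _ fun v => ?_)
  simp [mul_comm]

variable [SigmaFinite μ]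

/-- The moment `∫∫ f(x, v) α(v) η(x) dx dμ(v)`. -/
def mom (f : C.L2M) (α : V → ℝ) (η : Torus d → ℝ) : ℝ := inner ℝ f (C.testVec (tensor α η))

variable {C}

theorem mom_eq_integral (f : C.L2M) {α : V → ℝ} {η : Torus d → ℝ} (hα : IsBdd α)
    (hη : Continuous η) :
    C.mom f α η = ∫ p, f p * (α p.2 * η p.1) * C.M p.2 ∂C.weight := by
  unfold mom
  rw [L2.inner_def]
  refine integral_congr_ae ?_
  filter_upwards [C.testVec_coe (isBdd_tensor hα hη)] with p hp
  rw [hp]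
  simp only [tensor, RCLike.inner_apply, conj_trivial]
  ring

theorem integrable_mom (f : C.L2M) {α : V → ℝ} {η : Torus d → ℝ} (hα : IsBdd α)
    (hη : Continuous η) :
    Integrable (fun p => f p * (α p.2 * η p.1) * C.M p.2) C.weight := by
  refine (L2.integrable_inner (𝕜 := ℝ) f (C.testVec (tensor α η))).congr ?_
  filter_upwards [C.testVec_coe (isBdd_tensor hα hη)] with p hp
  rw [hp]
  simp only [tensor, RCLike.inner_apply, conj_trivial]
  ring

theorem mom_one (f : C.L2M) {η : Torus d → ℝ} (hη : Continuous η) :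
    C.mom f (fun _ => 1) η = pairX (C.density f) η := by
  rw [mom_eq_integral f (isBdd_const 1) hη]
  refine (integral_prod (μ := dx d) (ν := C.invM) _
    (integrable_mom f (isBdd_const 1) hη)).trans (integral_congr_ae ?_)
  have h : C.density f =ᵐ[dx d] densityFun (μ := μ) f :=
    MemLp.coeFn_toLp (C.memLp_densityFun f)
  filter_upwards [h] with x hx
  rw [hx, C.integral_invM_mul_M (fun v => f (x, v) * (1 * η x)), densityFun, ← integral_mul_const]
  simp

theorem mom_equilibrium (r : L2x d) {α : V → ℝ} {η : Torus d → ℝ} (hα : IsBdd α)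
    (hη : Continuous η) :
    C.mom (C.equilibrium r) α η = (∫ v, α v * C.M v ∂μ) * pairX r η := by
  rw [mom_eq_integral _ hα hη]
  have h : ∫ p, C.equilibrium r p * (α p.2 * η p.1) * C.M p.2 ∂C.weight
      = ∫ p, (r p.1 * η p.1) * (α p.2 * C.M p.2 * C.M p.2) ∂C.weight := by
    refine integral_congr_ae ?_
    filter_upwards [C.equilibrium_coe r] with p hp
    rw [hp]
    ring
  have h' := integral_prod_mul (μ := dx d) (ν := C.invM) (fun x => r x * η x)
    (fun v => α v * C.M v * C.M v)
  rw [C.integral_invM_mul_M, mul_comm] at h'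
  exact h.trans h'

theorem mom_bgk (f : C.L2M) {α : V → ℝ} {η : Torus d → ℝ} (hα : IsBdd α)
    (hη : Continuous η) :
    C.mom (C.bgk f) α η = (∫ v, α v * C.M v ∂μ) * C.mom f (fun _ => 1) η - C.mom f α η := by
  rw [mom_one f hη, ← mom_equilibrium _ hα hη]
  exact inner_sub_left _ _ _

theorem mom_mulX (g : C(Torus d, ℝ)) (f : C.L2M) {α : V → ℝ} {η : Torus d → ℝ} (hα : IsBdd α)
    (hη : Continuous η) :
    C.mom (C.mulX g f) α η = C.mom f α (fun x => g x * η x) := by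
  rw [mom_eq_integral _ hα hη, mom_eq_integral _ hα (η := fun x => g x * η x) (g.continuous.mul hη)]
  refine integral_congr_ae ?_
  filter_upwards [C.mulX_coe g f] with p hp
  rw [hp]
  ring

theorem inner_gradVec (f : C.L2M) {α : V → ℝ} {η : Torus d → ℝ} (hα : IsBdd α)
    (hη : IsCk 1 η) (ε : ℝ) :
    inner ℝ f (C.gradVec ε α η) = ∑ i, (ε⁻¹ * C.mom f (fun v => C.a v i * α v) (partialD i η)
      + C.mom f (fun v => C.b v i * α v) (partialD i η)) := by
  unfold gradVec mom
  rw [inner_sum]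
  refine Finset.sum_congr rfl fun i _ => ?_
  have hc : Continuous (partialD i η) := (IsCk.partialD (n := 0) hη i).continuous
  have h1 := isBdd_tensor ((C.isBdd_a i).mul hα) hc
  have h2 := isBdd_tensor ((C.isBdd_b i).mul hα) hc
  rw [← real_inner_smul_right, ← inner_add_right, ← C.testVec_const_mul h1,
    ← C.testVec_add (h1.const_mul _) h2]
  congr 2
  funext p
  simp only [tensor, speed_apply]
  ring

theorem exists_abs_mom_le (α : V → ℝ) (η : Torus d → ℝ) :
    ∃ B, 0 ≤ B ∧ (∀ f : C.L2M, |C.mom f α η| ≤ B * ‖f‖) := by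
  refine ⟨‖C.testVec (tensor α η)‖, norm_nonneg _, fun f => ?_⟩
  rw [mul_comm]
  exact abs_real_inner_le_norm _ _

variable (C) in
/-- A mild solution `f` on `[0, T]` with rate `r`, with a bound `R` for its norm and a bound `k`
for the total size of the rate. -/
structure IsBoundedSolution {T : ℝ} (hT : 0 ≤ T) (ε R k : ℝ) (r : ℝ → C(Torus d, ℝ))
    (f : C(Icc (0 : ℝ) T, C.L2M)) : Prop where
  pos : 0 < ε
  mild : ∃ f₀, C.IsMildSolution hT ε r f₀ f
  integrable_rate : IntervalIntegrable (fun s => ‖r s‖) volume 0 T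
  integral_rate : ∫ s in (0 : ℝ)..T, ‖r s‖ ≤ k
  norm_le : ∀ t, ‖IccExtend hT f t‖ ≤ R

section Estimates

theorem intervalIntegrable_fun_sum {ι : Type*} (S : Finset ι) {g : ι → ℝ → ℝ} {a b : ℝ}
    (h : ∀ i ∈ S, IntervalIntegrable (g i) volume a b) :
    IntervalIntegrable (fun s => ∑ i ∈ S, g i s) volume a b := by
  have := IntervalIntegrable.sum S h
  rwa [Finset.sum_fn] at this

variable {T : ℝ} {hT : 0 ≤ T} {ε R k : ℝ} {r : ℝ → C(Torus d, ℝ)} {f : C(Icc (0 : ℝ) T, C.L2M)}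

theorem IsBoundedSolution.R_nonneg (h : C.IsBoundedSolution hT ε R k r f) : 0 ≤ R :=
  (norm_nonneg _).trans (h.norm_le 0)

theorem IsBoundedSolution.k_nonneg (h : C.IsBoundedSolution hT ε R k r f) : 0 ≤ k :=
  (intervalIntegral.integral_nonneg hT fun _ _ => norm_nonneg _).trans h.integral_rate

theorem continuous_mom (f : C(Icc (0 : ℝ) T, C.L2M)) (α : V → ℝ) (η : Torus d → ℝ) :
    Continuous fun s => C.mom (IccExtend hT f s) α η :=
  f.continuous.Icc_extend'.inner continuous_const

/-- The balance law of a moment. -/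
theorem IsBoundedSolution.mom_sub_mom (h : C.IsBoundedSolution hT ε R k r f) {α : V → ℝ}
    {η : Torus d → ℝ} (hα : IsBdd α) (hη : IsCk 1 η) {t : ℝ} (ht : t ∈ Icc 0 T) :
    IntervalIntegrable (fun s => C.mom (C.mulX (r s) (IccExtend hT f s)) α η) volume 0 t ∧
    C.mom (IccExtend hT f t) α η - C.mom (IccExtend hT f 0) α η
      = ∑ i, (ε⁻¹ * ∫ s in (0 : ℝ)..t,
            C.mom (IccExtend hT f s) (fun v => C.a v i * α v) (partialD i η))
        + ∑ i, (∫ s in (0 : ℝ)..t,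
            C.mom (IccExtend hT f s) (fun v => C.b v i * α v) (partialD i η))
        + (ε ^ 2)⁻¹ * ((∫ v, α v * C.M v ∂μ)
              * (∫ s in (0 : ℝ)..t, C.mom (IccExtend hT f s) (fun _ => 1) η)
            - ∫ s in (0 : ℝ)..t, C.mom (IccExtend hT f s) α η)
        - ∫ s in (0 : ℝ)..t, C.mom (C.mulX (r s) (IccExtend hT f s)) α η := by
  obtain ⟨f₀, hm⟩ := h.mild
  obtain ⟨h1, h2⟩ := hm.weak hα hη ht
  set u := IccExtend hT f with hu
  have hc : ∀ α η, IntervalIntegrable (fun s => C.mom (u s) α η) volume 0 t := fun α η =>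
    (continuous_mom f α η).intervalIntegrable _ _
  have e1 : ∀ s, inner ℝ (C.source ε r u s) (C.testVec (tensor α η))
      = (ε ^ 2)⁻¹ * ((∫ v, α v * C.M v ∂μ) * C.mom (u s) (fun _ => 1) η - C.mom (u s) α η)
        - C.mom (C.mulX (r s) (u s)) α η := by
    intro s
    rw [← mom_bgk _ hα hη.continuous]
    unfold source mom
    rw [inner_sub_left, real_inner_smul_left]
  have hA := (((hc (fun _ => 1) η).const_mul (∫ v, α v * C.M v ∂μ)).sub (hc α η)).const_mul
    (ε ^ 2)⁻¹
  have hg : IntervalIntegrable (fun s => C.mom (C.mulX (r s) (u s)) α η) volume 0 t := by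
    refine (hA.sub h1).congr fun s _ => ?_
    simp only [e1]
    ring
  refine ⟨hg, ?_⟩
  have hgrad : IntervalIntegrable (fun s => inner ℝ (u s) (C.gradVec ε α η)) volume 0 t :=
    (f.continuous.Icc_extend'.inner continuous_const).intervalIntegrable _ _
  change inner ℝ (u t) (C.testVec (tensor α η)) - inner ℝ (u 0) (C.testVec (tensor α η)) = _
  rw [h2, intervalIntegral.integral_add h1 hgrad]
  simp only [e1, inner_gradVec _ hα hη]
  rw [intervalIntegral.integral_sub hA hg, intervalIntegral.integral_const_mul,
    intervalIntegral.integral_sub ((hc (fun _ => 1) η).const_mul _) (hc α η),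
    intervalIntegral.integral_const_mul,
    intervalIntegral.integral_finsetSum fun i _ => ((hc _ _).const_mul _).add (hc _ _)]
  rw [Finset.sum_congr rfl fun i _ => intervalIntegral.integral_add ((hc _ _).const_mul _) (hc _ _),
    Finset.sum_add_distrib]
  simp only [intervalIntegral.integral_const_mul]
  ring

/-- Moments, and the terms of their balance laws, are bounded in terms of `R` and `k`. -/
theorem exists_moment_bounds (hT : 0 ≤ T) (α : V → ℝ) (η : Torus d → ℝ) :
    ∃ D, 0 ≤ D ∧ ∀ {ε R k r} {f : C(Icc (0 : ℝ) T, C.L2M)},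
      C.IsBoundedSolution hT ε R k r f → ∀ t ∈ Icc 0 T,
      |C.mom (IccExtend hT f t) α η - C.mom (IccExtend hT f 0) α η| ≤ D * (R * (1 + k)) ∧
      |∫ s in (0 : ℝ)..t, C.mom (IccExtend hT f s) α η| ≤ D * (R * (1 + k)) ∧
      |∫ s in (0 : ℝ)..t, C.mom (C.mulX (r s) (IccExtend hT f s)) α η| ≤ D * (R * (1 + k)) := by
  obtain ⟨B, hB0, hB⟩ := exists_abs_mom_le (C := C) α η
  refine ⟨B * (2 + T), by positivity, fun {ε R k r f} h t ht => ?_⟩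
  have hR := h.R_nonneg
  have hk := h.k_nonneg
  have hm : ∀ s, |C.mom (IccExtend hT f s) α η| ≤ B * R := fun s =>
    (hB _).trans (mul_le_mul_of_nonneg_left (h.norm_le s) hB0)
  have hBR : 0 ≤ B * R := by positivity
  have hBRk : 0 ≤ B * R * k := by positivity
  have e : B * (2 + T) * (R * (1 + k)) = 2 * (B * R) + 2 * (B * R * k) + T * (B * R)
    + T * (B * R * k) := by ring
  have hTB := mul_nonneg hT hBR
  have hTBk := mul_nonneg hT hBRk
  rw [e]
  refine ⟨?_, ?_, ?_⟩
  · refine (abs_sub _ _).trans ?_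
    linarith [hm t, hm 0]
  · have h1 := intervalIntegral.norm_integral_le_of_norm_le_const (a := 0) (b := t)
      (f := fun s => C.mom (IccExtend hT f s) α η) fun s _ => hm s
    rw [sub_zero, abs_of_nonneg ht.1, Real.norm_eq_abs] at h1
    have h2 : B * R * t ≤ T * (B * R) := by
      rw [mul_comm]; exact mul_le_mul_of_nonneg_right ht.2 hBR
    linarith
  · have hi : IntervalIntegrable (fun s => B * R * ‖r s‖) volume 0 T :=
      h.integrable_rate.const_mul _
    have h1 := intervalIntegral.norm_integral_le_of_norm_le (a := 0) (b := t) (μ := volume)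
      (f := fun s => C.mom (C.mulX (r s) (IccExtend hT f s)) α η) (g := fun s => B * R * ‖r s‖)
      ht.1 (ae_of_all _ fun s _ => ?_)
      (hi.mono_set (by rw [uIcc_of_le hT, uIcc_of_le ht.1]; exact Icc_subset_Icc_right ht.2))
    · have h2 : ∫ s in (0 : ℝ)..t, B * R * ‖r s‖ ≤ ∫ s in (0 : ℝ)..T, B * R * ‖r s‖ :=
        intervalIntegral.integral_mono_interval le_rfl ht.1 ht.2
          (ae_of_all _ fun s => by positivity) hi
      rw [intervalIntegral.integral_const_mul] at h2 h1
      rw [intervalIntegral.integral_const_mul] at h2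
      have h3 := mul_le_mul_of_nonneg_left h.integral_rate hBR
      rw [Real.norm_eq_abs] at h1
      linarith
    · refine (hB _).trans ?_
      calc _ ≤ B * (‖r s‖ * R) := mul_le_mul_of_nonneg_left ((C.norm_mulX_le _ _).trans
            (mul_le_mul_of_nonneg_left (h.norm_le s) (norm_nonneg _))) hB0
        _ = _ := by ring

/-- A moment relaxes to its value at the local equilibrium. -/
theorem exists_relaxation (hT : 0 ≤ T) {α : V → ℝ} {η : Torus d → ℝ} (hα : IsBdd α)
    (hη : IsCk 1 η) :
    ∃ D, 0 ≤ D ∧ ∀ {ε R k r} {f : C(Icc (0 : ℝ) T, C.L2M)},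
      C.IsBoundedSolution hT ε R k r f → ∀ t ∈ Icc 0 T,
      |(∫ s in (0 : ℝ)..t, C.mom (IccExtend hT f s) α η) - (∫ v, α v * C.M v ∂μ)
        * ∫ s in (0 : ℝ)..t, C.mom (IccExtend hT f s) (fun _ => 1) η|
      ≤ (ε + ε ^ 2) * D * (R * (1 + k)) := by
  obtain ⟨D, hD0, hD⟩ := exists_moment_bounds (C := C) hT α η
  choose Da hDa0 hDa using fun i =>
    exists_moment_bounds (C := C) hT (fun v => C.a v i * α v) (partialD i η)
  choose Db hDb0 hDb using fun i =>
    exists_moment_bounds (C := C) hT (fun v => C.b v i * α v) (partialD i η)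
  have hSa : 0 ≤ ∑ i, Da i := Finset.sum_nonneg fun i _ => hDa0 i
  have hSb : 0 ≤ ∑ i, Db i := Finset.sum_nonneg fun i _ => hDb0 i
  refine ⟨2 * D + ∑ i, Da i + ∑ i, Db i, by positivity, fun {ε R k r f} h t ht => ?_⟩
  obtain ⟨-, hW⟩ := h.mom_sub_mom hα hη ht
  obtain ⟨b1, -, b3⟩ := hD h t ht
  have ba : |∑ i, ∫ s in (0 : ℝ)..t,
      C.mom (IccExtend hT f s) (fun v => C.a v i * α v) (partialD i η)|
      ≤ (∑ i, Da i) * (R * (1 + k)) := by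
    rw [Finset.sum_mul]
    exact (Finset.abs_sum_le_sum_abs _ _).trans
      (Finset.sum_le_sum fun i _ => (hDa i h t ht).2.1)
  have bb : |∑ i, ∫ s in (0 : ℝ)..t,
      C.mom (IccExtend hT f s) (fun v => C.b v i * α v) (partialD i η)|
      ≤ (∑ i, Db i) * (R * (1 + k)) := by
    rw [Finset.sum_mul]
    exact (Finset.abs_sum_le_sum_abs _ _).trans
      (Finset.sum_le_sum fun i _ => (hDb i h t ht).2.1)
  rw [← Finset.mul_sum] at hW
  have hε := h.pos
  have hQ : 0 ≤ R * (1 + k) := mul_nonneg h.R_nonneg (by linarith [h.k_nonneg])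
  generalize (∑ i, ∫ s in (0 : ℝ)..t,
      C.mom (IccExtend hT f s) (fun v => C.a v i * α v) (partialD i η)) = Sa at *
  generalize (∑ i, ∫ s in (0 : ℝ)..t,
      C.mom (IccExtend hT f s) (fun v => C.b v i * α v) (partialD i η)) = Sb at *
  generalize (∫ s in (0 : ℝ)..t, C.mom (C.mulX (r s) (IccExtend hT f s)) α η) = G at *
  generalize C.mom (IccExtend hT f t) α η - C.mom (IccExtend hT f 0) α η = Δ at *
  generalize (∫ v, α v * C.M v ∂μ) * ∫ s in (0 : ℝ)..t, C.mom (IccExtend hT f s) (fun _ => 1) η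
    = Y at *
  generalize (∫ s in (0 : ℝ)..t, C.mom (IccExtend hT f s) α η) = X at *
  -- The collision term of the balance law, multiplied by `ε²`.
  have e : X - Y = ε * Sa + ε ^ 2 * Sb - ε ^ 2 * Δ - ε ^ 2 * G := by
    rw [hW]
    field_simp
    ring
  rw [e]
  generalize R * (1 + k) = Q at *
  have f1 : |ε * Sa| ≤ ε * ((∑ i, Da i) * Q) := by
    rw [abs_mul, abs_of_pos hε]; gcongr
  have f2 : |ε ^ 2 * Sb| ≤ ε ^ 2 * ((∑ i, Db i) * Q) := by
    rw [abs_mul, abs_of_pos (by positivity)]; gcongr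
  have f3 : |ε ^ 2 * Δ| ≤ ε ^ 2 * (D * Q) := by
    rw [abs_mul, abs_of_pos (by positivity)]; gcongr
  have f4 : |ε ^ 2 * G| ≤ ε ^ 2 * (D * Q) := by
    rw [abs_mul, abs_of_pos (by positivity)]; gcongr
  have g1 : 0 ≤ ε ^ 2 * ((∑ i, Da i) * Q) := by positivity
  have g2 : 0 ≤ ε * ((∑ i, Db i) * Q) := by positivity
  have g3 : 0 ≤ ε * (D * Q) := by positivity
  have := abs_sub (ε * Sa + ε ^ 2 * Sb - ε ^ 2 * Δ) (ε ^ 2 * G)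
  have := abs_sub (ε * Sa + ε ^ 2 * Sb) (ε ^ 2 * Δ)
  have := abs_add_le (ε * Sa) (ε ^ 2 * Sb)
  nlinarith

/-- For a centred velocity weight the moment is of order `ε`, and `ε⁻¹` times it is given to
leading order by the flux of second order. -/
theorem exists_flux (hT : 0 ≤ T) {α : V → ℝ} {η : Torus d → ℝ} (hα : IsBdd α)
    (hη : IsCk 1 η) (h0 : ∫ v, α v * C.M v ∂μ = 0) :
    ∃ D, 0 ≤ D ∧ ∀ {ε R k r} {f : C(Icc (0 : ℝ) T, C.L2M)},
      C.IsBoundedSolution hT ε R k r f → ∀ t ∈ Icc 0 T,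
      |ε⁻¹ * (∫ s in (0 : ℝ)..t, C.mom (IccExtend hT f s) α η)
        - ∑ i, ∫ s in (0 : ℝ)..t,
          C.mom (IccExtend hT f s) (fun v => C.a v i * α v) (partialD i η)|
      ≤ (ε + ε ^ 2) * D * (R * (1 + k)) := by
  obtain ⟨D, hD0, hD⟩ := exists_moment_bounds (C := C) hT α η
  choose Db hDb0 hDb using fun i =>
    exists_moment_bounds (C := C) hT (fun v => C.b v i * α v) (partialD i η)
  have hSb : 0 ≤ ∑ i, Db i := Finset.sum_nonneg fun i _ => hDb0 i
  refine ⟨2 * D + ∑ i, Db i, by positivity, fun {ε R k r f} h t ht => ?_⟩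
  obtain ⟨-, hW⟩ := h.mom_sub_mom hα hη ht
  obtain ⟨b1, -, b3⟩ := hD h t ht
  have bb : |∑ i, ∫ s in (0 : ℝ)..t,
      C.mom (IccExtend hT f s) (fun v => C.b v i * α v) (partialD i η)|
      ≤ (∑ i, Db i) * (R * (1 + k)) := by
    rw [Finset.sum_mul]
    exact (Finset.abs_sum_le_sum_abs _ _).trans
      (Finset.sum_le_sum fun i _ => (hDb i h t ht).2.1)
  rw [← Finset.mul_sum, h0, zero_mul, zero_sub] at hW
  have hε := h.pos
  have hQ : 0 ≤ R * (1 + k) := mul_nonneg h.R_nonneg (by linarith [h.k_nonneg])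
  generalize (∑ i, ∫ s in (0 : ℝ)..t,
      C.mom (IccExtend hT f s) (fun v => C.a v i * α v) (partialD i η)) = Sa at *
  generalize (∑ i, ∫ s in (0 : ℝ)..t,
      C.mom (IccExtend hT f s) (fun v => C.b v i * α v) (partialD i η)) = Sb at *
  generalize (∫ s in (0 : ℝ)..t, C.mom (C.mulX (r s) (IccExtend hT f s)) α η) = G at *
  generalize C.mom (IccExtend hT f t) α η - C.mom (IccExtend hT f 0) α η = Δ at *
  generalize (∫ s in (0 : ℝ)..t, C.mom (IccExtend hT f s) α η) = X at *
  -- For a centred weight the collision term of the balance law reduces to `-ε⁻² X`; it is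
  -- multiplied by `ε`.
  have e : ε⁻¹ * X - Sa = ε * Sb - ε * Δ - ε * G := by
    rw [hW]
    field_simp
    ring
  rw [e]
  generalize R * (1 + k) = Q at *
  have f2 : |ε * Sb| ≤ ε * ((∑ i, Db i) * Q) := by
    rw [abs_mul, abs_of_pos hε]; gcongr
  have f3 : |ε * Δ| ≤ ε * (D * Q) := by
    rw [abs_mul, abs_of_pos hε]; gcongr
  have f4 : |ε * G| ≤ ε * (D * Q) := by
    rw [abs_mul, abs_of_pos hε]; gcongr
  have g2 : 0 ≤ ε ^ 2 * ((∑ i, Db i) * Q) := by positivity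
  have g3 : 0 ≤ ε ^ 2 * (D * Q) := by positivity
  have := abs_sub (ε * Sb - ε * Δ) (ε * G)
  have := abs_sub (ε * Sb) (ε * Δ)
  nlinarith

/-- The diffusive limit for a given path of the rate: the density satisfies the weak form of
`∂_t ρ = div(K∇ρ) - J · ∇ρ - r ρ` up to an error of order `ε`. -/
theorem exists_diffusion_approx (hT : 0 ≤ T) {ξ : Torus d → ℝ} (hξ : IsCk 3 ξ) :
    ∃ D, 0 ≤ D ∧ ∀ {ε R k r} {f : C(Icc (0 : ℝ) T, C.L2M)},
      C.IsBoundedSolution hT ε R k r f → ∀ t ∈ Icc 0 T,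
      IntervalIntegrable (fun s => pairX (C.density (IccExtend hT f s)) fun x => r s x * ξ x)
        volume 0 t ∧
      |pairX (C.density (IccExtend hT f t)) ξ - pairX (C.density (IccExtend hT f 0)) ξ
        - (∫ s in (0 : ℝ)..t, pairX (C.density (IccExtend hT f s)) (C.driftTest ξ))
        + ∫ s in (0 : ℝ)..t, pairX (C.density (IccExtend hT f s)) fun x => r s x * ξ x|
      ≤ (ε + ε ^ 2) * D * (R * (1 + k)) := by
  have hξ1 : ∀ j, IsCk 2 (partialD j ξ) := fun j => IsCk.partialD (n := 2) hξ j
  have hξ2 : ∀ i j, IsCk 1 (partialD i (partialD j ξ)) := fun i j =>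
    IsCk.partialD (n := 1) (hξ1 j) i
  choose D1 hD10 hD1 using fun j => exists_flux (C := C) hT (C.isBdd_a j)
    ((hξ1 j).mono one_le_two) (C.integral_a_mul_M j)
  choose D2 hD20 hD2 using fun j i => exists_relaxation (C := C) hT
    ((C.isBdd_a i).mul (C.isBdd_a j)) (hξ2 i j)
  choose D3 hD30 hD3 using fun j => exists_relaxation (C := C) hT (C.isBdd_b j)
    ((hξ1 j).mono one_le_two)
  refine ⟨∑ j, D1 j + ∑ j, ∑ i, D2 j i + ∑ j, D3 j, ?_, fun {ε R k r f} h t ht => ?_⟩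
  · have := Finset.sum_nonneg fun j (_ : j ∈ Finset.univ) => hD10 j
    have := Finset.sum_nonneg fun j (_ : j ∈ Finset.univ) => hD30 j
    have := Finset.sum_nonneg fun j (_ : j ∈ Finset.univ) =>
      Finset.sum_nonneg fun i (_ : i ∈ Finset.univ) => hD20 j i
    positivity
  obtain ⟨hg, hW⟩ := h.mom_sub_mom (isBdd_const 1) (hξ.mono (by norm_num)) ht
  simp only [mul_one, one_mul, C.integral_M, sub_self, mul_zero, add_zero] at hW
  have eg : ∀ s, C.mom (C.mulX (r s) (IccExtend hT f s)) (fun _ => 1) ξ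
      = pairX (C.density (IccExtend hT f s)) fun x => r s x * ξ x := fun s => by
    rw [mom_mulX _ _ (isBdd_const 1) hξ.continuous,
      mom_one _ (η := fun x => r s x * ξ x) ((r s).continuous.mul hξ.continuous)]
  simp only [eg, mom_one _ hξ.continuous] at hg hW
  refine ⟨hg, ?_⟩
  have hc : ∀ η, Continuous η →
      IntervalIntegrable (fun s => pairX (C.density (IccExtend hT f s)) η) volume 0 t := by
    intro η hη
    have := (continuous_mom (C := C) (hT := hT) f (fun _ => 1) η).intervalIntegrable
      (μ := volume) 0 t
    simpa only [mom_one _ hη] using this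
  have ed : ∫ s in (0 : ℝ)..t, pairX (C.density (IccExtend hT f s)) (C.driftTest ξ)
      = ∑ j, ∑ i, C.K i j * (∫ s in (0 : ℝ)..t,
          pairX (C.density (IccExtend hT f s)) (partialD i (partialD j ξ)))
        + ∑ j, C.J j * ∫ s in (0 : ℝ)..t,
          pairX (C.density (IccExtend hT f s)) (partialD j ξ) := by
    have i2 := fun i j => (hc _ (hξ2 i j).continuous).const_mul (C.K i j)
    have i1 := fun j => (hc _ (hξ1 j).continuous).const_mul (C.J j)
    simp only [pairX_driftTest _ hξ]
    rw [intervalIntegral.integral_add, intervalIntegral.integral_finsetSum,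
      intervalIntegral.integral_finsetSum]
    · congr 1
      · refine Finset.sum_congr rfl fun j _ => ?_
        rw [intervalIntegral.integral_finsetSum fun i _ => i2 i j]
        simp only [intervalIntegral.integral_const_mul]
      · simp only [intervalIntegral.integral_const_mul]
    · exact fun j _ => i1 j
    · exact fun j _ => intervalIntegrable_fun_sum _ fun i _ => i2 i j
    · exact intervalIntegrable_fun_sum _ fun j _ => intervalIntegrable_fun_sum _ fun i _ => i2 i j
    · exact intervalIntegrable_fun_sum _ fun j _ => i1 j
  have hD1' := fun j => hD1 j h t ht
  have hD2' := fun j i => hD2 j i h t ht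
  have hD3' := fun j => hD3 j h t ht
  simp only [mom_one _ (hξ2 _ _).continuous, mom_one _ (hξ1 _).continuous] at hD2' hD3'
  change ∀ j i, |_ - C.K i j * _| ≤ _ at hD2'
  change ∀ j, |_ - C.J j * _| ≤ _ at hD3'
  rw [hW, ed]
  set X : Fin d → ℝ := fun j =>
    ε⁻¹ * ∫ s in (0 : ℝ)..t, C.mom (IccExtend hT f s) (fun v => C.a v j) (partialD j ξ)
  set Y : Fin d → Fin d → ℝ := fun j i => ∫ s in (0 : ℝ)..t, C.mom (IccExtend hT f s)
    (fun v => C.a v i * C.a v j) (partialD i (partialD j ξ))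
  set Z : Fin d → ℝ := fun j =>
    ∫ s in (0 : ℝ)..t, C.mom (IccExtend hT f s) (fun v => C.b v j) (partialD j ξ)
  set k2 : Fin d → Fin d → ℝ := fun j i => C.K i j * (∫ s in (0 : ℝ)..t,
          pairX (C.density (IccExtend hT f s)) (partialD i (partialD j ξ)))
  set k1 : Fin d → ℝ := fun j => C.J j * (∫ s in (0 : ℝ)..t,
          pairX (C.density (IccExtend hT f s)) (partialD j ξ))
  generalize (∫ s in (0 : ℝ)..t, pairX (C.density (IccExtend hT f s)) fun x => r s x * ξ x) = G
  have e : ∑ j, X j + ∑ j, Z j - G - (∑ j, ∑ i, k2 j i + ∑ j, k1 j) + G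
      = ∑ j, (X j - ∑ i, Y j i) + ∑ j, ∑ i, (Y j i - k2 j i) + ∑ j, (Z j - k1 j) := by
    simp only [Finset.sum_sub_distrib]
    ring
  rw [e]
  refine (abs_add_three _ _ _).trans ?_
  rw [mul_add, mul_add, add_mul, add_mul]
  simp only [Finset.mul_sum, Finset.sum_mul]
  refine add_le_add (add_le_add ?_ ?_) ?_
  · exact (Finset.abs_sum_le_sum_abs _ _).trans (Finset.sum_le_sum fun j _ => hD1' j)
  · exact (Finset.abs_sum_le_sum_abs _ _).trans (Finset.sum_le_sum fun j _ =>
      (Finset.abs_sum_le_sum_abs _ _).trans (Finset.sum_le_sum fun i _ => hD2' j i))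
  · exact (Finset.abs_sum_le_sum_abs _ _).trans (Finset.sum_le_sum fun j _ => hD3' j)

end Estimates

end VelocityModel

/-! ### Duality between Sobolev spaces -/

section Sobolev

variable {d : ℕ}

/-- The complex Fourier coefficients of a real function on the torus. -/
def fcoeff (ψ : Torus d → ℝ) (k : Fin d → ℤ) : ℂ :=
  UnitAddTorus.mFourierCoeff (fun x => (ψ x : ℂ)) k

theorem fcoeff_eq_integral (ψ : Torus d → ℝ) (k : Fin d → ℤ) :
    fcoeff ψ k = ∫ x, UnitAddTorus.mFourier (-k) x * (ψ x : ℂ) ∂(dx d) := rfl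

theorem mFourier_apply_add (k : Fin d → ℤ) (x y : Torus d) :
    UnitAddTorus.mFourier k (x + y) = UnitAddTorus.mFourier k x * UnitAddTorus.mFourier k y := by
  simp only [UnitAddTorus.mFourier, ContinuousMap.coe_mk, ← Finset.prod_mul_distrib]
  refine Finset.prod_congr rfl fun i _ => ?_
  simp [fourier_apply, smul_add, AddCircle.toCircle_add]

theorem mFourier_apply_single (k : Fin d → ℤ) (i : Fin d) (h : ℝ) :
    UnitAddTorus.mFourier k (Pi.single i (h : UnitAddCircle))
      = Complex.exp (2 * Real.pi * Complex.I * k i * h) := by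
  simp only [UnitAddTorus.mFourier, ContinuousMap.coe_mk]
  rw [Finset.prod_eq_single i]
  · rw [Pi.single_eq_same, fourier_coe_apply]
    simp
  · intro j _ hj
    rw [Pi.single_eq_of_ne hj, fourier_eval_zero]
  · simp

theorem fcoeff_shift (ψ : Torus d → ℝ) (k : Fin d → ℤ) (a : Torus d) :
    fcoeff (fun x => ψ (x + a)) k = UnitAddTorus.mFourier k a * fcoeff ψ k := by
  rw [fcoeff_eq_integral, fcoeff_eq_integral,
    ← integral_add_right_eq_self (fun x => UnitAddTorus.mFourier (-k) x * (ψ x : ℂ)) a,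
    ← integral_const_mul]
  refine integral_congr_ae (ae_of_all _ fun x => ?_)
  have h : UnitAddTorus.mFourier k a * UnitAddTorus.mFourier (-k) a = 1 := by
    rw [← UnitAddTorus.mFourier_add, add_neg_cancel, UnitAddTorus.mFourier_zero]
    rfl
  simp only [mFourier_apply_add]
  linear_combination -(UnitAddTorus.mFourier (-k) x * (ψ (x + a) : ℂ)) * h

theorem memLp_of_continuous {ψ : Torus d → ℝ} (hψ : Continuous ψ) : MemLp ψ 2 (dx d) := by
  obtain ⟨c, -, hc⟩ := exists_bound_of_continuous hψ
  exact MemLp.of_bound hψ.measurable.aestronglyMeasurable c (ae_of_all _ hc)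

theorem fourierX_toLp {ψ : Torus d → ℝ} (hψ : MemLp ψ 2 (dx d)) (k : Fin d → ℤ) :
    fourierX hψ.toLp k = fcoeff ψ k := by
  refine integral_congr_ae ?_
  have h : ∀ᵐ x ∂(dx d), (hψ.toLp ψ : L2x d) x = ψ x := hψ.coeFn_toLp
  exact h.mono fun x hx => congrArg (fun z : ℝ => UnitAddTorus.mFourier (-k) x • (z : ℂ)) hx

theorem norm_complexify (r : L2x d) : ‖complexify r‖ = ‖r‖ := by
  have h : ∀ᵐ x ∂(dx d), complexify r x = (r x : ℂ) := Complex.ofRealCLM.coeFn_compLp r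
  refine le_antisymm (Lp.norm_le_norm_of_ae_le ?_) (Lp.norm_le_norm_of_ae_le ?_) <;>
  · filter_upwards [h] with x hx
    rw [hx, Complex.norm_real]

/-- Bessel's inequality. -/
theorem sum_norm_fcoeff_sq_le {ψ : Torus d → ℝ} (hψ : Continuous ψ) {B : ℝ}
    (hB : ∀ x, |ψ x| ≤ B) (S : Finset (Fin d → ℤ)) : ∑ k ∈ S, ‖fcoeff ψ k‖ ^ 2 ≤ B ^ 2 := by
  have hm := memLp_of_continuous hψ
  have hB0 : 0 ≤ B := (abs_nonneg _).trans (hB 0)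
  have h1 := lp.sum_rpow_le_norm_rpow (p := 2) (by norm_num) (parseval d (complexify hm.toLp)) S
  rw [(parseval d).norm_map, norm_complexify] at h1
  have h2 : ‖hm.toLp‖ ≤ B := by
    have := Lp.norm_le_of_ae_bound (f := hm.toLp) hB0 (by
      filter_upwards [hm.coeFn_toLp] with x hx
      rw [hx]; exact hB x)
    have hu : (measureUnivNNReal (dx d) : ℝ) = 1 := by simp [measureUnivNNReal]
    rwa [hu, Real.one_rpow, one_mul] at this
  simp only [← fourierX_eq, fourierX_toLp, ENNReal.toReal_ofNat, Real.rpow_two] at h1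
  exact h1.trans (by gcongr)

/-- The Fourier series of the derivatives of a Lipschitz function is square summable: Bessel's
inequality for the difference quotients `(ψ(x + h e_i) - ψ(x)) / h`, in the limit `h → 0`. -/
theorem sum_deriv_fcoeff_sq_le {ψ : Torus d → ℝ} (hψ : Continuous ψ) {L : ℝ}
    (hL : CoordLipschitz L ψ) (i : Fin d) (S : Finset (Fin d → ℤ)) :
    ∑ k ∈ S, (k i : ℝ) ^ 2 * ‖fcoeff ψ k‖ ^ 2 ≤ L ^ 2 := by
  set e : (Fin d → ℤ) → ℝ → ℂ := fun k h => Complex.exp (2 * Real.pi * Complex.I * k i * h)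
  have he0 : ∀ k, e k 0 = 1 := fun k => by simp [e]
  have hd : ∀ k, HasDerivAt (e k) (2 * Real.pi * Complex.I * k i) 0 := fun k => by
    have h1 : HasDerivAt (fun h : ℝ => 2 * Real.pi * Complex.I * k i * (h : ℂ))
        (2 * Real.pi * Complex.I * k i * 1) 0 :=
      (Complex.ofRealCLM.hasDerivAt (x := (0 : ℝ))).const_mul (2 * Real.pi * Complex.I * k i)
    simpa using h1.cexp
  have hlim : Tendsto (fun h : ℝ => ∑ k ∈ S, ‖h⁻¹ • (e k (0 + h) - e k 0)‖ ^ 2 * ‖fcoeff ψ k‖ ^ 2)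
      (𝓝[≠] 0) (𝓝 (∑ k ∈ S, ‖(2 * Real.pi * Complex.I * k i : ℂ)‖ ^ 2 * ‖fcoeff ψ k‖ ^ 2)) :=
    tendsto_finsetSum _ fun k _ => (((hd k).tendsto_slope_zero).norm.pow 2).mul_const _
  have hle : ∑ k ∈ S, ‖(2 * Real.pi * Complex.I * k i : ℂ)‖ ^ 2 * ‖fcoeff ψ k‖ ^ 2 ≤ L ^ 2 := by
    refine le_of_tendsto hlim ?_
    filter_upwards [self_mem_nhdsWithin] with h hh
    have hh' : 0 < |h| := abs_pos.2 hh
    set a : Torus d := Pi.single i (h : UnitAddCircle)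
    have hc : Continuous fun x => ψ (x + a) - ψ x := by fun_prop
    have h1 := sum_norm_fcoeff_sq_le hc (fun x => hL x i h) S
    have h2 : ∀ k, fcoeff (fun x => ψ (x + a) - ψ x) k = (e k h - 1) * fcoeff ψ k := fun k => by
      have i1 : ∀ {g : Torus d → ℝ}, Continuous g →
          Integrable (fun x => UnitAddTorus.mFourier (-k) x * (g x : ℂ)) (dx d) := fun hg =>
        Continuous.integrable_of_hasCompactSupport (by fun_prop) (HasCompactSupport.of_compactSpace _)
      have h3 : e k h = UnitAddTorus.mFourier k a := (mFourier_apply_single k i h).symm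
      rw [sub_mul, one_mul, h3, ← fcoeff_shift, fcoeff_eq_integral,
        fcoeff_eq_integral, fcoeff_eq_integral, ← integral_sub (i1 (by fun_prop)) (i1 hψ)]
      simp only [Complex.ofReal_sub, mul_sub]
    simp only [h2, norm_mul, mul_pow] at h1
    have h3 : ∀ k, ‖h⁻¹ • (e k (0 + h) - e k 0)‖ ^ 2 * ‖fcoeff ψ k‖ ^ 2
        = (|h| ^ 2)⁻¹ * (‖e k h - 1‖ ^ 2 * ‖fcoeff ψ k‖ ^ 2) := fun k => by
      rw [zero_add, he0, norm_smul, mul_pow, norm_inv, inv_pow, Real.norm_eq_abs, mul_assoc]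
    simp only [h3, ← Finset.mul_sum]
    rw [inv_mul_le_iff₀ (by positivity), mul_comm]
    exact h1
  refine le_trans (Finset.sum_le_sum fun k _ => ?_) hle
  refine mul_le_mul_of_nonneg_right ?_ (by positivity)
  have : ‖(2 * Real.pi * Complex.I * k i : ℂ)‖ = 2 * Real.pi * |(k i : ℝ)| := by
    simp [abs_of_pos Real.pi_pos]
  rw [this, mul_pow, sq_abs]
  have hpi : 1 ≤ 2 * Real.pi := by linarith [Real.pi_gt_three]
  nlinarith [sq_nonneg (k i : ℝ), one_le_pow₀ (n := 2) hpi]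

/-- A Lipschitz function belongs to `H^s`, for `s ≤ 1`. -/
theorem memlp_weighted_of_coordLipschitz {ψ : Torus d → ℝ} (hψ : Continuous ψ) {B L s : ℝ}
    (hB : ∀ x, |ψ x| ≤ B) (hL : CoordLipschitz L ψ) (hs : s ≤ 1) :
    ∃ w : lp (fun _ : Fin d → ℤ => ℂ) 2,
      (∀ k, w k = ((bracket k ^ s : ℝ) : ℂ) * fcoeff ψ k) ∧ ‖w‖ ^ 2 ≤ B ^ 2 + d * L ^ 2 := by
  -- As `s ≤ 1`, the weight `⟨k⟩^{2s}` is at most `⟨k⟩² = 1 + ∑ k_i²`.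
  have hS : ∀ S : Finset (Fin d → ℤ),
      ∑ k ∈ S, ‖((bracket k ^ s : ℝ) : ℂ) * fcoeff ψ k‖ ^ 2 ≤ B ^ 2 + d * L ^ 2 := by
    intro S
    have h1 : ∀ k : Fin d → ℤ, ‖((bracket k ^ s : ℝ) : ℂ) * fcoeff ψ k‖ ^ 2
        ≤ ‖fcoeff ψ k‖ ^ 2 + ∑ i, (k i : ℝ) ^ 2 * ‖fcoeff ψ k‖ ^ 2 := by
      intro k
      have hb := one_le_bracket k
      have h2 : bracket k ^ s ≤ bracket k := by
        simpa using Real.rpow_le_rpow_of_exponent_le hb hs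
      have h3 : 0 ≤ bracket k ^ s := Real.rpow_nonneg (zero_le_one.trans hb) _
      have h4 : bracket k ^ 2 = 1 + ∑ i, (k i : ℝ) ^ 2 :=
        Real.sq_sqrt (by positivity)
      rw [norm_mul, mul_pow, Complex.norm_real, Real.norm_of_nonneg h3, ← Finset.sum_mul]
      have h5 : (bracket k ^ s) ^ 2 ≤ 1 + ∑ i, (k i : ℝ) ^ 2 := by
        rw [← h4]; gcongr
      nlinarith [mul_le_mul_of_nonneg_right h5 (sq_nonneg ‖fcoeff ψ k‖)]
    calc _ ≤ ∑ k ∈ S, (‖fcoeff ψ k‖ ^ 2 + ∑ i, (k i : ℝ) ^ 2 * ‖fcoeff ψ k‖ ^ 2) :=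
          Finset.sum_le_sum fun k _ => h1 k
      _ = ∑ k ∈ S, ‖fcoeff ψ k‖ ^ 2 + ∑ i, ∑ k ∈ S, (k i : ℝ) ^ 2 * ‖fcoeff ψ k‖ ^ 2 := by
          rw [Finset.sum_add_distrib, Finset.sum_comm]
      _ ≤ B ^ 2 + ∑ _i : Fin d, L ^ 2 := add_le_add (sum_norm_fcoeff_sq_le hψ hB S)
          (Finset.sum_le_sum fun i _ => sum_deriv_fcoeff_sq_le hψ hL i S)
      _ = _ := by simp
  have hm : Memℓp (fun k => ((bracket k ^ s : ℝ) : ℂ) * fcoeff ψ k) 2 := by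
    refine memℓp_gen ?_
    simp only [ENNReal.toReal_ofNat, Real.rpow_two]
    exact summable_of_sum_le (fun k => by positivity) hS
  refine ⟨⟨_, hm⟩, fun k => rfl, ?_⟩
  have h0 : 0 ≤ B ^ 2 + d * L ^ 2 := by positivity
  have := lp.norm_le_of_forall_sum_le (p := 2) (by norm_num) (Real.sqrt_nonneg (B ^ 2 + d * L ^ 2))
    (f := ⟨_, hm⟩) (fun S => by
      simp only [ENNReal.toReal_ofNat, Real.rpow_two]
      rw [Real.sq_sqrt h0]
      exact hS S)
  calc _ ≤ √(B ^ 2 + d * L ^ 2) ^ 2 := by gcongr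
    _ = _ := Real.sq_sqrt h0

namespace Hneg

theorem pair_eq_inner {s : ℝ} {ψ : Torus d → ℝ} {w : lp (fun _ : Fin d → ℤ => ℂ) 2}
    (hw : ∀ k, w k = ((bracket k ^ s : ℝ) : ℂ) * fcoeff ψ k) (u : Hneg d s) :
    pair u ψ = (inner ℂ w u.1).re := by
  rw [lp.inner_eq_tsum]
  unfold pair
  congr 2
  funext k
  rw [hw, RCLike.inner_apply, map_mul, Complex.conj_ofReal, coeff, fcoeff]
  ring

/-- The pairing with a Lipschitz function is defined by an element of `H^s`, hence it is continuous
on `H^{-s}`, with an explicit constant. -/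
theorem exists_pair_bounds {s : ℝ} {ψ : Torus d → ℝ} (hψ : Continuous ψ) {B L : ℝ}
    (hB : ∀ x, |ψ x| ≤ B) (hL : CoordLipschitz L ψ) (hs : s ≤ 1) :
    Continuous (fun u : Hneg d s => pair u ψ) ∧
    ∀ u u' : Hneg d s, |pair u ψ - pair u' ψ| ≤ √(B ^ 2 + d * L ^ 2) * ‖u - u'‖ := by
  obtain ⟨w, hw, hn⟩ := memlp_weighted_of_coordLipschitz hψ hB hL hs
  simp only [pair_eq_inner hw]
  refine ⟨Complex.continuous_re.comp (continuous_const.inner continuous_subtype_val),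
    fun u u' => ?_⟩
  rw [← Complex.sub_re, ← inner_sub_right]
  refine (Complex.abs_re_le_norm _).trans ((norm_inner_le_norm _ _).trans ?_)
  exact mul_le_mul_of_nonneg_right (Real.le_sqrt_of_sq_le hn) (norm_nonneg _)

/-- The duality pairing extends the `L²` scalar product. -/
theorem pair_ofL2 {s : ℝ} (hs : 0 ≤ s) (r : L2x d) {η : Torus d → ℝ} (hη : Continuous η) :
    pair (ofL2 hs r) η = pairX r η := by
  have hm := memLp_of_continuous hη
  have h1 : ∀ k, coeff (ofL2 hs r) k = fourierX r k := fun k => by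
    change ((bracket k ^ s : ℝ) : ℂ) * (((bracket k ^ (-s) : ℝ) : ℂ) * fourierX r k) = _
    have h0 : bracket k ^ s * bracket k ^ (-s) = 1 := by
      rw [← Real.rpow_add (zero_lt_one.trans_le (one_le_bracket k)), add_neg_cancel,
        Real.rpow_zero]
    rw [← mul_assoc, ← Complex.ofReal_mul, h0, Complex.ofReal_one, one_mul]
  have h2 : pair (ofL2 hs r) η
      = (inner ℂ (parseval d (complexify hm.toLp)) (parseval d (complexify r))).re := by
    rw [lp.inner_eq_tsum]
    unfold pair
    congr 2
    funext k
    rw [h1, RCLike.inner_apply, ← fourierX_eq, ← fourierX_eq, fourierX_toLp, fcoeff]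
  have c1 : ∀ᵐ x ∂(dx d), complexify r x = (r x : ℂ) := Complex.ofRealCLM.coeFn_compLp r
  have c2 : ∀ᵐ x ∂(dx d), complexify (hm.toLp η) x = ((hm.toLp η : L2x d) x : ℂ) :=
    Complex.ofRealCLM.coeFn_compLp (hm.toLp η)
  rw [h2, LinearIsometryEquiv.inner_map_map, L2.inner_def]
  have h3 : ∫ x, inner ℂ (complexify hm.toLp x) (complexify r x) ∂(dx d)
      = ((pairX r η : ℝ) : ℂ) := by
    unfold pairX
    rw [← integral_complex_ofReal]
    refine integral_congr_ae ?_
    filter_upwards [c1, c2, hm.coeFn_toLp] with x h1 h2 h3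
    rw [h1, h2, h3, RCLike.inner_apply, Complex.conj_ofReal, Complex.ofReal_mul]
  rw [h3, Complex.ofReal_re]

end Hneg

end Sobolev

/-! ### Decay of correlations of the driving process -/

section Mixing

theorem continuous_of_abs_sub_le {E : Type*} [NormedAddCommGroup E] {g : E → ℝ} {c : ℝ}
    (hg : ∀ x y, |g x - g y| ≤ c * ‖x - y‖) : Continuous g := by
  refine (LipschitzWith.of_dist_le' (K := c) fun x y => ?_).continuous
  rw [Real.dist_eq, dist_eq_norm]
  exact hg x y

theorem IsMarkovFrom.map_eq {E : Type*} [MeasurableSpace E]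
    {P : ℝ≥0 → Kernel E E} {Ω : Type*} [MeasurableSpace Ω] {κ : Measure Ω}
    [IsProbabilityMeasure κ] {ℓ : E} {X : ℝ≥0 → Ω → E} (h : IsMarkovFrom P ℓ κ X) (t : ℝ≥0) :
    κ.map (X t) = P t ℓ := by
  ext A hA
  have h1 := h.markov 0 t univ MeasurableSet.univ A hA
  rw [Measure.map_apply (h.measurable t) hA]
  rw [univ_inter, zero_add, Measure.restrict_univ] at h1
  have h2 : ∀ᵐ ω ∂κ, P t (X 0 ω) A = P t ℓ A := h.initial.mono fun ω hω => by rw [hω]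
  rw [h1, lintegral_congr_ae h2]
  simp

/-- The second moments of the driving process are bounded uniformly in time. -/
theorem HasUniformMoments.exists_second_moment {E : Type*} [NormedAddCommGroup E] {Ω : Type*}
    [MeasurableSpace Ω] {Pr : Measure Ω} [IsProbabilityMeasure Pr] {m : ℝ≥0 → Ω → E}
    (h : HasUniformMoments Pr m) :
    ∃ S : ℝ≥0, ∀ s, ∫⁻ ω, ‖m s ω‖ₑ ^ 2 ∂Pr ≤ S := by
  obtain ⟨γ, hγ, hfin⟩ := h
  refine ⟨(1 + ⨆ i : ℕ, ∫⁻ ω, (⨆ t ∈ Icc (i : ℝ≥0) (i + 1), ‖m t ω‖ₑ ^ γ) ∂Pr).toNNReal,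
    fun s => ?_⟩
  rw [ENNReal.coe_toNNReal (ENNReal.add_ne_top.2 ⟨ENNReal.one_ne_top, hfin.ne⟩)]
  have h1 : ∀ z : ℝ≥0∞, z ^ 2 ≤ 1 + z ^ γ := by
    intro z
    rcases le_total z 1 with hz | hz
    · exact (pow_le_one' hz 2).trans le_self_add
    · rw [← ENNReal.rpow_two]
      exact (ENNReal.rpow_le_rpow_of_exponent_le hz hγ.le).trans le_add_self
  calc ∫⁻ ω, ‖m s ω‖ₑ ^ 2 ∂Pr ≤ ∫⁻ ω, (1 + ‖m s ω‖ₑ ^ γ) ∂Pr := lintegral_mono fun ω => h1 _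
    _ = 1 + ∫⁻ ω, ‖m s ω‖ₑ ^ γ ∂Pr := by
        rw [lintegral_add_left measurable_const]; simp
    _ ≤ _ := by
        gcongr
        refine le_trans (lintegral_mono fun ω => ?_) (le_iSup (fun i : ℕ =>
          ∫⁻ ω, (⨆ t ∈ Icc (i : ℝ≥0) (i + 1), ‖m t ω‖ₑ ^ γ) ∂Pr) ⌊s⌋₊)
        exact le_iSup₂_of_le (f := fun t (_ : t ∈ Icc (⌊s⌋₊ : ℝ≥0) (⌊s⌋₊ + 1)) => ‖m t ω‖ₑ ^ γ) s
          ⟨Nat.floor_le (zero_le), (Nat.lt_floor_add_one s).le⟩ le_rfl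

variable {E : Type*} [NormedAddCommGroup E] [MeasurableSpace E]
  {P : ℝ≥0 → Kernel E E} {ν : Measure E}

/-- The joint law of the process at two times. -/
theorem IsMarkovFrom.map_prod_eq (hP : IsErgodicMarkovSemigroup P ν) {Ω : Type*}
    [MeasurableSpace Ω] {κ : Measure Ω} [IsProbabilityMeasure κ] {ℓ : E} {X : ℝ≥0 → Ω → E}
    (h : IsMarkovFrom P ℓ κ X) (s t : ℝ≥0) :
    κ.map (fun ω => (X s ω, X (s + t) ω)) = (κ.map (X s)) ⊗ₘ P t := by
  have := hP.isMarkovKernel t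
  have hm : Measurable fun ω => (X s ω, X (s + t) ω) := (h.measurable s).prodMk (h.measurable _)
  have := Measure.isProbabilityMeasure_map (μ := κ) hm.aemeasurable
  have := Measure.isProbabilityMeasure_map (μ := κ) (h.measurable s).aemeasurable
  refine Measure.ext_prod fun {A B} hA hB => ?_
  rw [Measure.map_apply hm (hA.prod hB), Measure.compProd_apply_prod hA hB,
    setLIntegral_map hA (Kernel.measurable_coe _ hB) (h.measurable s)]
  refine h.markov s t (X s ⁻¹' A) ?_ B hB
  have hle : MeasurableSpace.comap (X s) inferInstance ≤ past X s :=
    le_iSup₂_of_le (f := fun r (_ : r ∈ Iic s) => MeasurableSpace.comap (X r) inferInstance)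
      s (mem_Iic.2 le_rfl) le_rfl
  exact hle _ ⟨A, hA, rfl⟩

variable [BorelSpace E]

/-- The transition probabilities have a first moment. -/
theorem lintegral_transition_lt_top (hP : IsErgodicMarkovSemigroup P ν) (hmix : IsMixing P)
    (t : ℝ≥0) (ℓ : E) : ∫⁻ y, ‖y‖ₑ ∂(P t ℓ) < ∞ := by
  have := hP.isProbabilityMeasure
  obtain ⟨γ, hγ0, hγ, hc⟩ := hmix
  have h1 : ∫⁻ x, ∫⁻ y, ‖y‖ₑ ∂(P t x) ∂ν < ∞ := by
    rw [← Measure.lintegral_bind (Kernel.aemeasurable _) measurable_enorm.aemeasurable,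
      (hP.invariant t).def]
    have h2 := hP.integrable.2
    simpa [HasFiniteIntegral] using h2
  -- By invariance `P t x` has a first moment for `ν`-almost every `x`; the coupling with the process
  -- started at such an `x` carries this over to `ℓ`.
  obtain ⟨x, hx⟩ := (ae_lt_top (measurable_enorm.lintegral_kernel) h1.ne).exists
  obtain ⟨π, hπ, m1, m2, hd⟩ := hc ℓ x
  rw [← m1.map_eq t, lintegral_map measurable_enorm (m1.measurable t)]
  rw [← m2.map_eq t, lintegral_map measurable_enorm (m2.measurable t)] at hx
  calc ∫⁻ w, ‖w.1 t‖ₑ ∂π ≤ ∫⁻ w, (‖w.2 t‖ₑ + ‖w.1 t - w.2 t‖ₑ) ∂π := by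
        refine lintegral_mono fun w => ?_
        calc ‖w.1 t‖ₑ = ‖w.2 t + (w.1 t - w.2 t)‖ₑ := by rw [add_sub_cancel]
          _ ≤ _ := enorm_add_le _ _
    _ = ∫⁻ w, ‖w.2 t‖ₑ ∂π + ∫⁻ w, ‖w.1 t - w.2 t‖ₑ ∂π :=
        lintegral_add_left (m2.measurable t).enorm _
    _ < ∞ := ENNReal.add_lt_top.2 ⟨hx, (hd t).trans_lt ENNReal.ofReal_lt_top⟩

variable {g : E → ℝ} {c : ℝ}

theorem integrable_of_abs_sub_le (hg : ∀ x y, |g x - g y| ≤ c * ‖x - y‖) {κ : Measure E}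
    [IsFiniteMeasure κ] (hκ : Integrable (fun y => ‖y‖) κ) : Integrable g κ := by
  refine Integrable.mono' ((hκ.const_mul c).add (integrable_const |g 0|))
    (continuous_of_abs_sub_le hg).measurable.aestronglyMeasurable (ae_of_all _ fun y => ?_)
  have h1 := hg y 0
  rw [sub_zero] at h1
  have h2 := abs_sub_abs_le_abs_sub (g y) (g 0)
  simp only [Real.norm_eq_abs, Pi.add_apply]
  linarith

theorem integrable_norm_transition (hP : IsErgodicMarkovSemigroup P ν) (hmix : IsMixing P)
    (t : ℝ≥0) (ℓ : E) : Integrable (fun y => ‖y‖) (P t ℓ) :=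
  ⟨measurable_norm.aestronglyMeasurable, by
    simpa [HasFiniteIntegral] using lintegral_transition_lt_top hP hmix t ℓ⟩

/-- The semigroup contracts the oscillation of Lipschitz functions at the rate of mixing, and hence
brings them close to their mean for the invariant distribution. -/
theorem exists_decay (hP : IsErgodicMarkovSemigroup P ν) (hmix : IsMixing P) :
    ∃ γ : ℝ → ℝ, (∀ t, 0 ≤ γ t) ∧ IntegrableOn γ (Ici 0) ∧
      ∀ (g : E → ℝ) (c : ℝ), 0 ≤ c → (∀ x y, |g x - g y| ≤ c * ‖x - y‖) → ∫ y, g y ∂ν = 0 →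
      ∀ (t : ℝ≥0) (x : E), |∫ y, g y ∂(P t x)| ≤ c * γ t * (‖x‖ + ∫ y, ‖y‖ ∂ν) := by
  have := hP.isProbabilityMeasure
  have hmix' := hmix
  obtain ⟨γ, hγ0, hγ, hc⟩ := hmix
  refine ⟨γ, hγ0, hγ, fun g c hc0 hg hmean t x => ?_⟩
  have := hP.isMarkovKernel t
  have hcont := continuous_of_abs_sub_le hg
  have hi : ∀ x, Integrable g (P t x) := fun x =>
    integrable_of_abs_sub_le hg (integrable_norm_transition hP hmix' t x)
  -- The coupling bounds the oscillation of `P t g`, whose mean for `ν` vanishes by invariance.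
  have hosc : ∀ x x', |∫ y, g y ∂(P t x) - ∫ y, g y ∂(P t x')| ≤ c * γ t * ‖x - x'‖ := by
    intro x x'
    obtain ⟨π, hπ, m1, m2, hd⟩ := hc x x'
    have i1 := hi x
    have i2 := hi x'
    rw [← m1.map_eq t] at i1 ⊢
    rw [← m2.map_eq t] at i2 ⊢
    have j1 := (integrable_map_measure i1.1 (m1.measurable t).aemeasurable).1 i1
    have j2 := (integrable_map_measure i2.1 (m2.measurable t).aemeasurable).1 i2
    rw [integral_map (m1.measurable t).aemeasurable i1.1,
      integral_map (m2.measurable t).aemeasurable i2.1]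
    have j3 := integral_sub j1 j2
    simp only [Function.comp_apply] at j3
    rw [← j3, ← Real.norm_eq_abs]
    have h0 : 0 ≤ c * γ t * ‖x - x'‖ := by have := hγ0 t; positivity
    have : ‖∫ w, (g (w.1 t) - g (w.2 t)) ∂π‖ₑ ≤ ENNReal.ofReal (c * γ t * ‖x - x'‖) := by
      refine (enorm_integral_le_lintegral_enorm _).trans ?_
      calc ∫⁻ w, ‖g (w.1 t) - g (w.2 t)‖ₑ ∂π
          ≤ ∫⁻ w, ENNReal.ofReal c * ‖w.1 t - w.2 t‖ₑ ∂π := by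
            refine lintegral_mono fun w => ?_
            rw [← ofReal_norm, ← ofReal_norm, ← ENNReal.ofReal_mul hc0]
            exact ENNReal.ofReal_le_ofReal (hg _ _)
        _ = ENNReal.ofReal c * ∫⁻ w, ‖w.1 t - w.2 t‖ₑ ∂π :=
            lintegral_const_mul' _ _ ENNReal.ofReal_ne_top
        _ ≤ ENNReal.ofReal c * ENNReal.ofReal (γ t * ‖x - x'‖) := by gcongr; exact hd t
        _ = _ := by rw [← ENNReal.ofReal_mul hc0, mul_assoc]
    rw [← ofReal_norm] at this
    exact (ENNReal.ofReal_le_ofReal_iff h0).1 this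
  have hmean' : ∫ x', ∫ y, g y ∂(P t x') ∂ν = 0 := by
    have h1 : (P t ∘ₖ Kernel.const Unit ν) () = ν := by
      rw [← Measure.comp_eq_comp_const_apply, (hP.invariant t).def]
    have h2 := Kernel.integral_comp (κ := Kernel.const Unit ν) (η := P t) (a := ()) (f := g)
      (by rw [h1]; exact integrable_of_abs_sub_le hg hP.integrable)
    rw [h1, hmean] at h2
    exact h2.symm
  have hPi : Integrable (fun x' => ∫ y, g y ∂(P t x')) ν :=
    integrable_of_abs_sub_le hosc hP.integrable
  have e : ∫ y, g y ∂(P t x) = ∫ x', (∫ y, g y ∂(P t x) - ∫ y, g y ∂(P t x')) ∂ν := by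
    rw [integral_sub (integrable_const _) hPi, hmean', integral_const]
    simp
  have hγc : 0 ≤ c * γ t := mul_nonneg hc0 (hγ0 t)
  rw [e, ← Real.norm_eq_abs]
  calc _ ≤ ∫ x', c * γ t * (‖x‖ + ‖x'‖) ∂ν := by
        refine norm_integral_le_of_norm_le
          (((integrable_const ‖x‖).add hP.integrable).const_mul _) (ae_of_all _ fun x' => ?_)
        exact (hosc x x').trans (mul_le_mul_of_nonneg_left (norm_sub_le _ _) hγc)
    _ = _ := by
        rw [integral_const_mul, integral_add (integrable_const _) hP.integrable, integral_const]
        simp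

theorem abs_le_of_integral_eq_zero (hP : IsErgodicMarkovSemigroup P ν) (hc0 : 0 ≤ c)
    (hg : ∀ x y, |g x - g y| ≤ c * ‖x - y‖) (hmean : ∫ y, g y ∂ν = 0) (x : E) :
    |g x| ≤ c * (‖x‖ + ∫ y, ‖y‖ ∂ν) := by
  have := hP.isProbabilityMeasure
  have e : g x = ∫ x', (g x - g x') ∂ν := by
    rw [integral_sub (integrable_const _) (integrable_of_abs_sub_le hg hP.integrable), hmean,
      integral_const]
    simp
  rw [e, ← Real.norm_eq_abs]
  calc _ ≤ ∫ x', c * (‖x‖ + ‖x'‖) ∂ν := by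
        refine norm_integral_le_of_norm_le
          (((integrable_const ‖x‖).add hP.integrable).const_mul _) (ae_of_all _ fun x' => ?_)
        exact (hg x x').trans (mul_le_mul_of_nonneg_left (norm_sub_le _ _) hc0)
    _ = _ := by
        rw [integral_const_mul, integral_add (integrable_const _) hP.integrable, integral_const]
        simp

variable {Ω : Type*} [MeasurableSpace Ω] {Pr : Measure Ω} [IsProbabilityMeasure Pr] {ℓ₀ : E}
  {m : ℝ≥0 → Ω → E}

/-- The second moments of `‖m(s)‖ + ∫ ‖·‖ dν`. -/
theorem exists_second_moment_add (hmeas : ∀ s, Measurable (m s)) (h : HasUniformMoments Pr m)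
    (q : ℝ) : ∃ S : ℝ, 0 ≤ S ∧ ∀ s, Integrable (fun ω => (‖m s ω‖ + q) ^ 2) Pr ∧
      ∫ ω, (‖m s ω‖ + q) ^ 2 ∂Pr ≤ S := by
  obtain ⟨S, hS⟩ := h.exists_second_moment
  have hi : ∀ s, Integrable (fun ω => ‖m s ω‖ ^ 2) Pr := fun s =>
    ⟨((hmeas s).norm.pow_const 2).aestronglyMeasurable, by
      simpa [HasFiniteIntegral, enorm_pow] using (hS s).trans_lt ENNReal.coe_lt_top⟩
  have hle : ∀ s, ∫ ω, ‖m s ω‖ ^ 2 ∂Pr ≤ S := fun s => by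
    rw [integral_eq_lintegral_of_nonneg_ae (ae_of_all _ fun ω => by positivity) (hi s).1]
    refine ENNReal.toReal_le_coe_of_le_coe (le_trans (le_of_eq ?_) (hS s))
    refine lintegral_congr fun ω => ?_
    rw [ENNReal.ofReal_pow (norm_nonneg _), ofReal_norm]
  have hi2 : ∀ s, Integrable (fun ω => 2 * ‖m s ω‖ ^ 2 + 2 * q ^ 2) Pr := fun s =>
    ((hi s).const_mul 2).add (integrable_const _)
  have hb : ∀ s ω, (‖m s ω‖ + q) ^ 2 ≤ 2 * ‖m s ω‖ ^ 2 + 2 * q ^ 2 := fun s ω => by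
    nlinarith [sq_nonneg (‖m s ω‖ - q)]
  have hi3 : ∀ s, Integrable (fun ω => (‖m s ω‖ + q) ^ 2) Pr := fun s =>
    (hi2 s).mono' (((hmeas s).norm.add_const q).pow_const 2).aestronglyMeasurable
      (ae_of_all _ fun ω => by
        rw [Real.norm_of_nonneg (sq_nonneg _)]; exact hb s ω)
  refine ⟨2 * S + 2 * q ^ 2, by positivity, fun s => ⟨hi3 s, ?_⟩⟩
  refine (integral_mono (hi3 s) (hi2 s) (hb s)).trans ?_
  rw [integral_add ((hi s).const_mul 2) (integrable_const _), integral_const_mul, integral_const]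
  simp only [probReal_univ, one_smul]
  linarith [hle s]

/-- The correlation of a centred Lipschitz function of the driving process decays at the rate of
mixing. -/
theorem IsMarkovFrom.abs_correlation_le (hP : IsErgodicMarkovSemigroup P ν)
    (hm : IsMarkovFrom P ℓ₀ Pr m) (hc0 : 0 ≤ c) (hg : ∀ x y, |g x - g y| ≤ c * ‖x - y‖)
    (hmean : ∫ y, g y ∂ν = 0) {G S : ℝ} (hG : 0 ≤ G) {s t : ℝ≥0}
    (hdecay : ∀ x, |∫ y, g y ∂(P t x)| ≤ c * G * (‖x‖ + ∫ y, ‖y‖ ∂ν))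
    (hS : ∀ s, Integrable (fun ω => (‖m s ω‖ + ∫ y, ‖y‖ ∂ν) ^ 2) Pr ∧
      ∫ ω, (‖m s ω‖ + ∫ y, ‖y‖ ∂ν) ^ 2 ∂Pr ≤ S) :
    |∫ ω, g (m s ω) * g (m (s + t) ω) ∂Pr| ≤ c ^ 2 * S * G := by
  have := hP.isMarkovKernel t
  have hcont := continuous_of_abs_sub_le hg
  set q := ∫ y, ‖y‖ ∂ν with hq
  have hbd := abs_le_of_integral_eq_zero hP hc0 hg hmean
  have hprod := hm.map_prod_eq hP s t
  have hpm : Measurable fun ω => (m s ω, m (s + t) ω) :=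
    (hm.measurable s).prodMk (hm.measurable _)
  have hgm : Measurable fun z : E × E => g z.1 * g z.2 :=
    (hcont.measurable.comp measurable_fst).mul (hcont.measurable.comp measurable_snd)
  have hpr := Measure.isProbabilityMeasure_map (μ := Pr) (hm.measurable s).aemeasurable
  have hint : Integrable (fun ω => g (m s ω) * g (m (s + t) ω)) Pr := by
    have hdom := (((hS s).1.add (hS (s + t)).1).const_mul (c ^ 2))
    refine hdom.mono' (hgm.comp hpm).aestronglyMeasurable (ae_of_all _ fun ω => ?_)
    rw [norm_mul, Real.norm_eq_abs, Real.norm_eq_abs]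
    have b1 := hbd (m s ω)
    have b2 := hbd (m (s + t) ω)
    have q0 : 0 ≤ q := integral_nonneg fun _ => norm_nonneg _
    have p1 : 0 ≤ ‖m s ω‖ + q := by positivity
    have p2 : 0 ≤ ‖m (s + t) ω‖ + q := by positivity
    calc _ ≤ (c * (‖m s ω‖ + q)) * (c * (‖m (s + t) ω‖ + q)) :=
          mul_le_mul b1 b2 (abs_nonneg _) (by positivity)
      _ = c ^ 2 * ((‖m s ω‖ + q) * (‖m (s + t) ω‖ + q)) := by ring
      _ ≤ c ^ 2 * ((‖m s ω‖ + q) ^ 2 + (‖m (s + t) ω‖ + q) ^ 2) := by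
          refine mul_le_mul_of_nonneg_left ?_ (sq_nonneg c)
          nlinarith [sq_nonneg (‖m s ω‖ + q - (‖m (s + t) ω‖ + q)),
            sq_nonneg (‖m s ω‖ + q + (‖m (s + t) ω‖ + q))]
  have hint' : Integrable (fun z : E × E => g z.1 * g z.2) ((Pr.map (m s)) ⊗ₘ P t) := by
    rw [← hprod]
    exact (integrable_map_measure hgm.aestronglyMeasurable hpm.aemeasurable).2 hint
  -- Conditioning on the past up to time `s` replaces `g (m (s + t))` by `(P t g) (m s)`.
  have e1 : ∫ ω, g (m s ω) * g (m (s + t) ω) ∂Pr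
      = ∫ ω, g (m s ω) * ∫ y, g y ∂(P t (m s ω)) ∂Pr := by
    have h1 := integral_map (μ := Pr) hpm.aemeasurable (f := fun z : E × E => g z.1 * g z.2)
      hgm.aestronglyMeasurable
    rw [hprod, Measure.integral_compProd hint'] at h1
    simp only [integral_const_mul] at h1
    rw [← h1, integral_map (hm.measurable s).aemeasurable]
    exact (hcont.measurable.mul
      (hcont.measurable.stronglyMeasurable.integral_kernel.measurable)).aestronglyMeasurable
  rw [e1, ← Real.norm_eq_abs]
  calc _ ≤ ∫ ω, c ^ 2 * G * (‖m s ω‖ + q) ^ 2 ∂Pr := by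
        refine norm_integral_le_of_norm_le ((hS s).1.const_mul _) (ae_of_all _ fun ω => ?_)
        have q0 : 0 ≤ q := integral_nonneg fun _ => norm_nonneg _
        rw [norm_mul]
        calc _ ≤ (c * (‖m s ω‖ + q)) * (c * G * (‖m s ω‖ + q)) :=
              mul_le_mul (hbd _) (hdecay _) (abs_nonneg _) (by positivity)
          _ = _ := by ring
    _ = c ^ 2 * G * ∫ ω, (‖m s ω‖ + q) ^ 2 ∂Pr := integral_const_mul _ _
    _ ≤ c ^ 2 * G * S := mul_le_mul_of_nonneg_left (hS s).2 (by positivity)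
    _ = _ := by ring

end Mixing

/-! ### Time averages of the driving process -/

section TimeAverage

variable {Ω : Type*} [MeasurableSpace Ω] {Pr : Measure Ω} [IsProbabilityMeasure Pr]

/-- The variance of a time average of a process, in terms of a bound for the correlations. -/
theorem lintegral_sq_integral_le {X : ℝ → Ω → ℝ} (hX : Measurable fun z : ℝ × Ω => X z.1 z.2)
    {S a b : ℝ} (hab : a ≤ b) (hS : ∀ u, Integrable (fun ω => X u ω ^ 2) Pr ∧
      ∫ ω, X u ω ^ 2 ∂Pr ≤ S) {h : ℝ → ℝ} (hh : Integrable h) (hh0 : ∀ u, 0 ≤ h u)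
    (hcor : ∀ u ∈ Ioc a b, ∀ v ∈ Ioc a b, |∫ ω, X u ω * X v ω ∂Pr| ≤ h (u - v) + h (v - u)) :
    ∫⁻ ω, ENNReal.ofReal ((∫ u in a..b, X u ω) ^ 2) ∂Pr
      ≤ ENNReal.ofReal ((b - a) * (2 * ∫ w, h w)) := by
  set lam : Measure ℝ := volume.restrict (Ioc a b) with hlam
  -- The square is written as a double integral in time, and the expectation is taken first.
  have e1 : ∀ ω, (∫ u in a..b, X u ω) ^ 2
      = ∫ z, X z.1 ω * X z.2 ω ∂(lam.prod lam) := fun ω => by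
    rw [intervalIntegral.integral_of_le hab, sq]
    exact (integral_prod_mul (fun u => X u ω) (fun u => X u ω)).symm
  have hXX : Measurable fun z : Ω × (ℝ × ℝ) => X z.2.1 z.1 * X z.2.2 z.1 :=
    (hX.comp (g := fun z : ℝ × Ω => X z.1 z.2) (f := fun z : Ω × (ℝ × ℝ) => (z.2.1, z.1))
      (by fun_prop)).mul
    (hX.comp (g := fun z : ℝ × Ω => X z.1 z.2) (f := fun z : Ω × (ℝ × ℝ) => (z.2.2, z.1))
      (by fun_prop))
  have hXu : ∀ u, Measurable (X u) := fun u => hX.comp (measurable_const.prodMk measurable_id)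
  have hdom : ∀ u v, Integrable (fun ω => X u ω ^ 2 + X v ω ^ 2) Pr := fun u v =>
    (hS u).1.add (hS v).1
  have hle : ∀ u v ω, ‖X u ω * X v ω‖ ≤ X u ω ^ 2 + X v ω ^ 2 := fun u v ω => by
    rw [norm_mul, Real.norm_eq_abs, Real.norm_eq_abs, ← sq_abs (X u ω), ← sq_abs (X v ω)]
    nlinarith [sq_nonneg (|X u ω| - |X v ω|), sq_nonneg (|X u ω| + |X v ω|)]
  have hiuv : ∀ u v, Integrable (fun ω => X u ω * X v ω) Pr := fun u v =>
    (hdom u v).mono' ((hXu u).mul (hXu v)).aestronglyMeasurable (ae_of_all _ (hle u v))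
  have hint : Integrable (fun z : Ω × (ℝ × ℝ) => X z.2.1 z.1 * X z.2.2 z.1)
      (Pr.prod (lam.prod lam)) := by
    rw [integrable_prod_iff' hXX.aestronglyMeasurable]
    refine ⟨ae_of_all _ fun z => hiuv z.1 z.2, ?_⟩
    refine Integrable.mono' (integrable_const (S + S)) ?_ (ae_of_all _ fun z => ?_)
    · exact (hXX.norm.stronglyMeasurable.integral_prod_left (μ := Pr)).aestronglyMeasurable
    · rw [Real.norm_of_nonneg (integral_nonneg fun _ => norm_nonneg _)]
      refine (integral_mono (hiuv z.1 z.2).norm (hdom z.1 z.2) (hle z.1 z.2)).trans ?_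
      rw [integral_add (hS z.1).1 (hS z.2).1]
      exact add_le_add (hS z.1).2 (hS z.2).2
  simp only [e1]
  rw [← ofReal_integral_eq_lintegral_ofReal hint.integral_prod_left
    (ae_of_all _ fun ω => by simp only [Pi.zero_apply, ← e1]; positivity)]
  refine ENNReal.ofReal_le_ofReal ?_
  rw [integral_integral_swap (f := fun ω (z : ℝ × ℝ) => X z.1 ω * X z.2 ω) hint,
    integral_prod (fun z : ℝ × ℝ => ∫ ω, X z.1 ω * X z.2 ω ∂Pr) hint.swap.integral_prod_left]
  refine (le_abs_self _).trans ?_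
  have hvol : lam.real univ = b - a := by
    simp [hlam, Measure.real, hab]
  have h2 : ∀ᵐ u ∂lam, ‖∫ v, ∫ ω, X u ω * X v ω ∂Pr ∂lam‖ ≤ 2 * ∫ w, h w := by
    filter_upwards [ae_restrict_mem measurableSet_Ioc] with u hu
    have i1 : Integrable (fun v => h (u - v)) := hh.comp_sub_left u
    have i2 : Integrable (fun v => h (v - u)) := hh.comp_sub_right u
    calc _ ≤ ∫ v, (h (u - v) + h (v - u)) ∂lam := by
          refine norm_integral_le_of_norm_le (i1.add i2).restrict ?_
          filter_upwards [ae_restrict_mem measurableSet_Ioc] with v hv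
          exact hcor u hu v hv
      _ ≤ ∫ v, (h (u - v) + h (v - u)) :=
          setIntegral_le_integral (i1.add i2) (ae_of_all _ fun v => add_nonneg (hh0 _) (hh0 _))
      _ = _ := by
          rw [integral_add i1 i2, integral_sub_left_eq_self (fun v => h v),
            integral_sub_right_eq_self (fun v => h v)]
          ring
  have h3 := norm_integral_le_of_norm_le_const h2
  rw [hvol] at h3
  rw [mul_comm]
  exact h3

variable {E : Type*} [NormedAddCommGroup E] [MeasurableSpace E] [BorelSpace E]
  {P : ℝ≥0 → Kernel E E} {ν : Measure E} {ℓ₀ : E} {m : ℝ≥0 → Ω → E}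

/-- The law of large numbers for the accelerated driving process, in mean square. -/
theorem exists_variance_bound (hP : IsErgodicMarkovSemigroup P ν) (hmix : IsMixing P)
    (hm : IsMarkovFrom P ℓ₀ Pr m) (hm_meas : Measurable fun p : ℝ≥0 × Ω => m p.1 p.2)
    (hm_mom : HasUniformMoments Pr m) {c : ℝ} (hc0 : 0 ≤ c) :
    ∃ D, 0 ≤ D ∧ ∀ g : E → ℝ, (∀ x y, |g x - g y| ≤ c * ‖x - y‖) → ∫ y, g y ∂ν = 0 →
      ∀ δ > 0, ∀ a b : ℝ, 0 ≤ a → a ≤ b →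
      ∫⁻ ω, ENNReal.ofReal ((∫ u in a..b, g (m (u / δ ^ 2).toNNReal ω)) ^ 2) ∂Pr
        ≤ ENNReal.ofReal (D * δ ^ 2 * (b - a)) := by
  obtain ⟨γ, hγ0, hγ, hdecay⟩ := exists_decay hP hmix
  obtain ⟨S, hS0, hS⟩ := exists_second_moment_add hm.measurable hm_mom (∫ y, ‖y‖ ∂ν)
  set h₀ : ℝ → ℝ := fun w => c ^ 2 * S * (Ici (0 : ℝ)).indicator γ w with hh₀
  have hh0 : ∀ w, 0 ≤ h₀ w := fun w =>
    mul_nonneg (by positivity) (indicator_nonneg (fun w _ => hγ0 w) w)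
  have hhi : Integrable h₀ := (hγ.integrable_indicator measurableSet_Ici).const_mul _
  refine ⟨2 * ∫ w, h₀ w, mul_nonneg zero_le_two (integral_nonneg hh0),
    fun g hg hmean δ hδ a b ha hab => ?_⟩
  have hδ2 : 0 < δ ^ 2 := by positivity
  have hcont := continuous_of_abs_sub_le hg
  have hbd := abs_le_of_integral_eq_zero hP hc0 hg hmean
  have hX : Measurable fun z : ℝ × Ω => g (m (z.1 / δ ^ 2).toNNReal z.2) :=
    hcont.measurable.comp (hm_meas.comp (f := fun z : ℝ × Ω => ((z.1 / δ ^ 2).toNNReal, z.2))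
      (by fun_prop))
  have hle : ∀ s ω, g (m s ω) ^ 2 ≤ c ^ 2 * (‖m s ω‖ + ∫ y, ‖y‖ ∂ν) ^ 2 := fun s ω => by
    rw [← sq_abs, ← mul_pow]
    exact pow_le_pow_left₀ (abs_nonneg _) (hbd _) 2
  have hi : ∀ s, Integrable (fun ω => g (m s ω) ^ 2) Pr := fun s =>
    ((hS s).1.const_mul (c ^ 2)).mono'
      ((hcont.measurable.comp (hm.measurable s)).pow_const 2).aestronglyMeasurable
      (ae_of_all _ fun ω => by rw [Real.norm_of_nonneg (sq_nonneg _)]; exact hle s ω)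
  have key : ∀ s t : ℝ≥0, |∫ ω, g (m s ω) * g (m (s + t) ω) ∂Pr| ≤ h₀ t := fun s t => by
    have := hm.abs_correlation_le hP hc0 hg hmean (hγ0 t) (s := s) (t := t)
      (fun x => hdecay g c hc0 hg hmean t x) hS
    change _ ≤ c ^ 2 * S * (Ici (0 : ℝ)).indicator γ (t : ℝ)
    rwa [indicator_of_mem (show (t : ℝ) ∈ Ici (0 : ℝ) from t.2)]
  have hcor1 : ∀ u v : ℝ, 0 ≤ u → u ≤ v →
      |∫ ω, g (m (u / δ ^ 2).toNNReal ω) * g (m (v / δ ^ 2).toNNReal ω) ∂Pr|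
        ≤ h₀ ((v - u) / δ ^ 2) := by
    intro u v hu huv
    have h1 := key (u / δ ^ 2).toNNReal ((v - u) / δ ^ 2).toNNReal
    have hvu : 0 ≤ (v - u) / δ ^ 2 := div_nonneg (by linarith) hδ2.le
    rw [← Real.toNNReal_add (by positivity) hvu, Real.coe_toNNReal _ hvu] at h1
    have e : u / δ ^ 2 + (v - u) / δ ^ 2 = v / δ ^ 2 := by ring
    rwa [e] at h1
  have := lintegral_sq_integral_le (Pr := Pr) hX hab (S := c ^ 2 * S)
    (fun u => ⟨hi _, (integral_mono (hi _) ((hS _).1.const_mul (c ^ 2)) (hle _)).trans (by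
      rw [integral_const_mul]
      exact mul_le_mul_of_nonneg_left (hS _).2 (sq_nonneg c))⟩)
    (h := fun w => h₀ (w / δ ^ 2)) (hhi.comp_div hδ2.ne') (fun w => hh0 _) (fun u hu v hv => by
      rcases le_total u v with huv | huv
      · exact (hcor1 u v (ha.trans hu.1.le) huv).trans (le_add_of_nonneg_left (hh0 _))
      · have := hcor1 v u (ha.trans hv.1.le) huv
        simp only [mul_comm (g (m (v / δ ^ 2).toNNReal _))] at this
        exact this.trans (le_add_of_nonneg_right (hh0 _)))
  refine this.trans (le_of_eq ?_)
  rw [Measure.integral_comp_div, abs_of_pos hδ2, smul_eq_mul]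
  congr 1
  ring

/-- The accelerated driving process is locally integrable in time, with a bound in mean that does
not depend on the acceleration. -/
theorem exists_lintegral_norm_le (hm_meas : Measurable fun p : ℝ≥0 × Ω => m p.1 p.2)
    (hm_mom : HasUniformMoments Pr m) :
    ∃ D : ℝ≥0, ∀ δ T : ℝ,
      ∫⁻ ω, (∫⁻ u in Ioc (0 : ℝ) T, ‖m (u / δ ^ 2).toNNReal ω‖ₑ) ∂Pr ≤ D * ENNReal.ofReal T := by
  obtain ⟨S, hS⟩ := hm_mom.exists_second_moment
  refine ⟨1 + S, fun δ T => ?_⟩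
  have hX : Measurable fun z : Ω × ℝ => ‖m (z.2 / δ ^ 2).toNNReal z.1‖ₑ :=
    (hm_meas.comp (f := fun z : Ω × ℝ => ((z.2 / δ ^ 2).toNNReal, z.1)) (by fun_prop)).enorm
  rw [lintegral_lintegral_swap hX.aemeasurable]
  have h1 : ∀ s, ∫⁻ ω, ‖m s ω‖ₑ ∂Pr ≤ 1 + S := fun s => by
    have h2 : ∀ z : ℝ≥0∞, z ≤ 1 + z ^ 2 := fun z => by
      rcases le_total z 1 with hz | hz
      · exact hz.trans le_self_add
      · exact (le_self_pow₀ hz two_ne_zero).trans le_add_self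
    calc _ ≤ ∫⁻ ω, (1 + ‖m s ω‖ₑ ^ 2) ∂Pr := lintegral_mono fun ω => h2 _
      _ = 1 + ∫⁻ ω, ‖m s ω‖ₑ ^ 2 ∂Pr := by
          rw [lintegral_add_left measurable_const]; simp
      _ ≤ _ := by gcongr; exact hS s
  calc _ ≤ ∫⁻ _ in Ioc 0 T, ((1 + S : ℝ≥0) : ℝ≥0∞) := lintegral_mono fun u => by
        push_cast; exact h1 _
    _ = _ := by simp

end TimeAverage

/-! ### Lipschitz rates and their averages -/

section Rates

variable {d : ℕ} {E : Type*} [NormedAddCommGroup E] {σ : E → C(Torus d, ℝ)} {c b : ℝ}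

/-- The properties of the rate that are used in the proof: `σ` is Lipschitz continuous into the
continuous functions with constant `c`, and `σ(ℓ)` is bounded, and Lipschitz continuous on the
torus, with a constant of linear growth in `ℓ`. -/
structure IsLipschitzRate (σ : E → C(Torus d, ℝ)) (c b : ℝ) : Prop where
  c_nonneg : 0 ≤ c
  b_nonneg : 0 ≤ b
  abs_sub_le : ∀ ℓ ℓ' x, |σ ℓ x - σ ℓ' x| ≤ c * ‖ℓ - ℓ'‖
  norm_le : ∀ ℓ, ‖σ ℓ‖ ≤ c * ‖ℓ‖ + b
  coordLipschitz : ∀ ℓ, CoordLipschitz (c * ‖ℓ‖ + b) (σ ℓ)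

theorem LipschitzIntoCk.exists_isLipschitzRate {n : ℕ} (h : LipschitzIntoCk n σ) (hn : 1 ≤ n) :
    ∃ c b, IsLipschitzRate σ c b := by
  obtain ⟨hk, c, hc⟩ := h
  have hc' : ∀ ℓ ℓ' : E, c * ‖ℓ - ℓ'‖ ≤ |c| * ‖ℓ - ℓ'‖ := fun ℓ ℓ' =>
    mul_le_mul_of_nonneg_right (le_abs_self c) (norm_nonneg _)
  have h0 : ∀ ℓ ℓ' x, |σ ℓ x - σ ℓ' x| ≤ |c| * ‖ℓ - ℓ'‖ := fun ℓ ℓ' x => by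
    obtain ⟨y, rfl⟩ := proj_surjective x
    have h1 := hc ℓ ℓ' 0 (Nat.zero_le n) y
    rw [norm_iteratedFDeriv_zero] at h1
    exact h1.trans (hc' _ _)
  have h1 : ∀ ℓ ℓ', CoordLipschitz (|c| * ‖ℓ - ℓ'‖) fun x => σ ℓ x - σ ℓ' x := fun ℓ ℓ' => by
    refine coordLipschitz_of_fderiv ?_ fun y => ?_
    · exact ContDiff.sub ((hk ℓ).mono hn) ((hk ℓ').mono hn)
    · have h1 := hc ℓ ℓ' 1 hn y
      rw [norm_iteratedFDeriv_one] at h1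
      exact h1.trans (hc' _ _)
  obtain ⟨L, hL0, hL⟩ := ((hk 0).mono hn).exists_coordLipschitz
  refine ⟨|c|, ‖σ 0‖ + L, abs_nonneg c, by positivity, h0, fun ℓ => ?_, fun ℓ => ?_⟩
  · refine (ContinuousMap.norm_le _ (by positivity)).2 fun x => ?_
    have h2 := h0 ℓ 0 x
    have h3 := (σ 0).norm_coe_le_norm x
    have h4 := abs_sub_abs_le_abs_sub (σ ℓ x) (σ 0 x)
    rw [Real.norm_eq_abs] at h3 ⊢
    rw [sub_zero] at h2
    linarith
  · have h2 := (h1 ℓ 0).add hL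
    simp only [sub_add_cancel, sub_zero] at h2
    exact h2.mono (by linarith [norm_nonneg (σ 0)])

namespace IsLipschitzRate

theorem abs_le (h : IsLipschitzRate σ c b) (ℓ : E) (x : Torus d) : |σ ℓ x| ≤ c * ‖ℓ‖ + b :=
  ((σ ℓ).norm_coe_le_norm x).trans (h.norm_le ℓ)

theorem growth_nonneg (h : IsLipschitzRate σ c b) (ℓ : E) : 0 ≤ c * ‖ℓ‖ + b :=
  add_nonneg (mul_nonneg h.c_nonneg (norm_nonneg _)) h.b_nonneg

theorem mono (h : IsLipschitzRate σ c b) {b' : ℝ} (hb : b ≤ b') : IsLipschitzRate σ c b' :=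
  ⟨h.c_nonneg, h.b_nonneg.trans hb, h.abs_sub_le, fun ℓ => (h.norm_le ℓ).trans (by linarith),
    fun ℓ => (h.coordLipschitz ℓ).mono (by linarith)⟩

theorem continuous (h : IsLipschitzRate σ c b) : Continuous σ := by
  refine (LipschitzWith.of_dist_le' (K := c) fun ℓ ℓ' => ?_).continuous
  rw [dist_eq_norm, dist_eq_norm]
  exact (ContinuousMap.norm_le _ (mul_nonneg h.c_nonneg (norm_nonneg _))).2 (h.abs_sub_le ℓ ℓ')

/-- The space `E` need not be separable: the joint measurability rests on the continuity of
`σ(ℓ)` on the torus. -/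
theorem measurable_uncurry (h : IsLipschitzRate σ c b) [MeasurableSpace E] [BorelSpace E]
    {α : Type*} [MeasurableSpace α] {y : α → E} (hy : Measurable y) :
    Measurable fun z : Torus d × α => σ (y z.2) z.1 :=
  measurable_uncurry_of_continuous_of_measurable (u := fun x a => σ (y a) x)
    (fun a => (σ (y a)).continuous)
    fun x => (continuous_of_abs_sub_le fun ℓ ℓ' => h.abs_sub_le ℓ ℓ' x).measurable.comp hy

variable [MeasurableSpace E] {ν : Measure E} [IsProbabilityMeasure ν]

theorem integrable_growth (c b : ℝ) (hν : Integrable (fun ℓ => ‖ℓ‖) ν) :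
    Integrable (fun ℓ => c * ‖ℓ‖ + b) ν := (hν.const_mul c).add (integrable_const b)

theorem integral_growth (hν : Integrable (fun ℓ => ‖ℓ‖) ν) :
    ∫ ℓ, (c * ‖ℓ‖ + b) ∂ν = c * (∫ ℓ, ‖ℓ‖ ∂ν) + b := by
  rw [integral_add (hν.const_mul c) (integrable_const b), integral_const_mul]
  simp

theorem abs_meanRate_le (h : IsLipschitzRate σ c b) (hν : Integrable (fun ℓ => ‖ℓ‖) ν)
    (x : Torus d) : |meanRate σ ν x| ≤ c * (∫ ℓ, ‖ℓ‖ ∂ν) + b := by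
  rw [← integral_growth hν]
  refine (Real.norm_eq_abs _).symm.le.trans ?_
  exact norm_integral_le_of_norm_le (integrable_growth c b hν)
    (ae_of_all _ fun ℓ => h.abs_le ℓ x)

variable [BorelSpace E]

theorem integrable_apply (h : IsLipschitzRate σ c b) (hν : Integrable (fun ℓ => ‖ℓ‖) ν)
    (x : Torus d) : Integrable (fun ℓ => σ ℓ x) ν :=
  integrable_of_abs_sub_le (fun ℓ ℓ' => h.abs_sub_le ℓ ℓ' x) hν

theorem continuous_meanRate (h : IsLipschitzRate σ c b) (hν : Integrable (fun ℓ => ‖ℓ‖) ν) :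
    Continuous (meanRate σ ν) :=
  continuous_of_dominated (fun x => (h.integrable_apply hν x).1)
    (fun x => ae_of_all _ fun ℓ => h.abs_le ℓ x) (integrable_growth c b hν)
    (ae_of_all _ fun ℓ => (σ ℓ).continuous)

theorem coordLipschitz_meanRate (h : IsLipschitzRate σ c b) (hν : Integrable (fun ℓ => ‖ℓ‖) ν) :
    CoordLipschitz (c * (∫ ℓ, ‖ℓ‖ ∂ν) + b) (meanRate σ ν) := fun x i t => by
  unfold meanRate
  rw [← integral_sub (h.integrable_apply hν _) (h.integrable_apply hν _), ← integral_growth hν,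
    ← integral_mul_const]
  refine (Real.norm_eq_abs _).symm.le.trans ?_
  exact norm_integral_le_of_norm_le ((integrable_growth c b hν).mul_const _)
    (ae_of_all _ fun ℓ => h.coordLipschitz ℓ x i t)

/-- The fluctuation `σ - σ̄` of the rate is a centred Lipschitz rate. -/
theorem exists_fluctuation (h : IsLipschitzRate σ c b) (hν : Integrable (fun ℓ => ‖ℓ‖) ν) :
    ∃ (g : E → C(Torus d, ℝ)) (b' : ℝ), b ≤ b' ∧ IsLipschitzRate g c b' ∧
      (∀ ℓ x, g ℓ x = σ ℓ x - meanRate σ ν x) ∧ ∀ x, ∫ ℓ, g ℓ x ∂ν = 0 := by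
  set q := ∫ ℓ, ‖ℓ‖ ∂ν with hq
  have hq0 : 0 ≤ q := integral_nonneg fun _ => norm_nonneg _
  have hcq : 0 ≤ c * q + b := add_nonneg (mul_nonneg h.c_nonneg hq0) h.b_nonneg
  refine ⟨fun ℓ => σ ℓ - ⟨meanRate σ ν, h.continuous_meanRate hν⟩, b + (c * q + b), by linarith,
    ⟨h.c_nonneg, add_nonneg h.b_nonneg hcq, fun ℓ ℓ' x => ?_, fun ℓ => ?_, fun ℓ => ?_⟩,
    fun _ _ => rfl, fun x => ?_⟩
  · simpa using h.abs_sub_le ℓ ℓ' x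
  · rw [← add_assoc]
    refine (norm_sub_le _ _).trans (add_le_add (h.norm_le ℓ) ?_)
    exact (ContinuousMap.norm_le _ hcq).2 (h.abs_meanRate_le hν)
  · rw [← add_assoc]
    exact (h.coordLipschitz ℓ).sub (h.coordLipschitz_meanRate hν)
  · have : ∫ ℓ, (σ ℓ x - meanRate σ ν x) ∂ν = 0 := by
      rw [integral_sub (h.integrable_apply hν x) (integrable_const _), integral_const]
      simp [meanRate]
    exact this

end IsLipschitzRate

end Rates

/-! ### Averaging a fluctuating rate against a slow density -/

section Averaging

variable {d : ℕ}

/-- The Cauchy--Schwarz inequality, for a factor `Z` which is small in `L²` and a bounded `ξ`. -/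
theorem abs_pairX_mul_le (r : L2x d) {Z ξ : Torus d → ℝ} (hZ : AEStronglyMeasurable Z (dx d))
    (hξ : Continuous ξ) {B q : ℝ} (hB : ∀ x, |ξ x| ≤ B) (hq0 : 0 ≤ q)
    (hq : ∫⁻ x, ENNReal.ofReal (Z x ^ 2) ∂(dx d) ≤ ENNReal.ofReal (q ^ 2)) :
    |pairX r fun x => Z x * ξ x| ≤ ‖r‖ * B * q := by
  have hB0 : 0 ≤ B := (abs_nonneg _).trans (hB 0)
  have hsq : eLpNorm (fun x => Z x * ξ x) 2 (dx d) ^ 2 ≤ ENNReal.ofReal (B * q) ^ 2 := by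
    rw [VelocityModel.eLpNorm_sq, mul_comm B, ENNReal.ofReal_mul hq0, mul_pow,
      ← ENNReal.ofReal_pow hq0]
    refine le_trans ?_ (mul_le_mul_left hq _)
    rw [← lintegral_mul_const' _ _ (by finiteness)]
    refine lintegral_mono fun x => ?_
    rw [enorm_mul, mul_pow, ← ofReal_norm, ← ofReal_norm, ← ENNReal.ofReal_pow (norm_nonneg _),
      Real.norm_eq_abs, sq_abs]
    gcongr
    exact hB x
  have hle : eLpNorm (fun x => Z x * ξ x) 2 (dx d) ≤ ENNReal.ofReal (B * q) :=
    (ENNReal.pow_le_pow_left_iff two_ne_zero).1 hsq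
  have hm : MemLp (fun x => Z x * ξ x) 2 (dx d) :=
    ⟨hZ.mul hξ.measurable.aestronglyMeasurable, hle.trans_lt ENNReal.ofReal_lt_top⟩
  have e : pairX r (fun x => Z x * ξ x) = inner ℝ hm.toLp r := by
    rw [L2.inner_def]
    refine integral_congr_ae ?_
    filter_upwards [hm.coeFn_toLp] with x hx
    rw [hx]
    simp
  rw [e, mul_assoc, mul_comm ‖r‖]
  refine (abs_real_inner_le_norm _ _).trans (mul_le_mul_of_nonneg_right ?_ (norm_nonneg _))
  rw [Lp.norm_toLp]
  exact ENNReal.toReal_le_of_le_ofReal (by positivity) hle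

theorem sqrt_growth_le {B L G D : ℝ} (hG : 0 ≤ G) (hD : 0 ≤ D) :
    √((G * B) ^ 2 + D * (G * B + G * L) ^ 2) = √(B ^ 2 + D * (B + L) ^ 2) * G := by
  have e : (G * B) ^ 2 + D * (G * B + G * L) ^ 2 = (B ^ 2 + D * (B + L) ^ 2) * G ^ 2 := by ring
  rw [e, Real.sqrt_mul (by positivity), Real.sqrt_sq hG]

variable {E : Type*} [NormedAddCommGroup E] {g : E → C(Torus d, ℝ)} {c b : ℝ}

namespace IsLipschitzRate

theorem integrableOn_growth {y : ℝ → E} {s : Set ℝ} (hs : volume s ≠ ∞)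
    (hi : IntegrableOn (fun u => ‖y u‖) s) :
    IntegrableOn (fun u => c * ‖y u‖ + b) s :=
  (hi.const_mul c).add (integrableOn_const hs)

variable [MeasurableSpace E] [BorelSpace E]

/-- The time integral of a rate against a fixed density. -/
theorem integral_pairX (h : IsLipschitzRate g c b) (r : L2x d) {ξ : Torus d → ℝ}
    (hξ : Continuous ξ) {y : ℝ → E} (hy : Measurable y) {t₁ t₂ : ℝ} (ht : t₁ ≤ t₂)
    (hi : IntegrableOn (fun u => ‖y u‖) (Ioc t₁ t₂)) :
    IntervalIntegrable (fun u => pairX r fun x => g (y u) x * ξ x) volume t₁ t₂ ∧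
    ∫ u in t₁..t₂, pairX r (fun x => g (y u) x * ξ x)
      = pairX r fun x => (∫ u in t₁..t₂, g (y u) x) * ξ x := by
  obtain ⟨B, hB0, hB⟩ := exists_bound_of_continuous hξ
  set lam : Measure ℝ := volume.restrict (Ioc t₁ t₂) with hlam
  have hr : Integrable (fun x => |r x|) (dx d) := ((Lp.memLp r).integrable (by norm_num)).norm
  have hgi : Integrable (fun u => c * ‖y u‖ + b) lam := integrableOn_growth (by simp) hi
  have hF : Integrable (fun z : Torus d × ℝ => r z.1 * (g (y z.2) z.1 * ξ z.1))
      ((dx d).prod lam) := by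
    refine ((hr.mul_prod hgi).mul_const B).mono' ?_ (ae_of_all _ fun z => ?_)
    · exact (Lp.aestronglyMeasurable r).comp_fst.mul ((h.measurable_uncurry hy).mul
        (hξ.measurable.comp measurable_fst)).aestronglyMeasurable
    · rw [norm_mul, norm_mul, Real.norm_eq_abs, Real.norm_eq_abs, Real.norm_eq_abs, mul_assoc]
      exact mul_le_mul_of_nonneg_left (mul_le_mul (h.abs_le _ _) (hB _) (abs_nonneg _)
        (h.growth_nonneg _)) (abs_nonneg _)
  refine ⟨(intervalIntegrable_iff_integrableOn_Ioc_of_le ht).2 hF.integral_prod_right, ?_⟩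
  rw [intervalIntegral.integral_of_le ht]
  unfold pairX
  rw [← integral_integral_swap (f := fun x u => r x * (g (y u) x * ξ x)) hF]
  refine integral_congr_ae (ae_of_all _ fun x => ?_)
  simp only []
  rw [intervalIntegral.integral_of_le ht, integral_const_mul, integral_mul_const]

/-- On a short time interval the density is almost constant in a negative Sobolev space, and the
time integral of the rate is small in `L²`. -/
theorem abs_integral_pairX_le (h : IsLipschitzRate g c b) {ξ : Torus d → ℝ} (hξ : Continuous ξ)
    {B L : ℝ} (hB : ∀ x, |ξ x| ≤ B) (hL : CoordLipschitz L ξ) {s : ℝ} (hs : 0 ≤ s)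
    (hs' : s ≤ 1) {ρ : ℝ → L2x d} {R : ℝ} (hR : ∀ u, ‖ρ u‖ ≤ R) {y : ℝ → E} (hy : Measurable y)
    {t₁ t₂ : ℝ} (ht : t₁ ≤ t₂) (hi : IntegrableOn (fun u => ‖y u‖) (Ioc t₁ t₂))
    (hint : IntervalIntegrable (fun u => pairX (ρ u) fun x => g (y u) x * ξ x) volume t₁ t₂)
    {w : ℝ} (hw : ∀ u ∈ Ioc t₁ t₂, ‖Hneg.ofL2 hs (ρ u) - Hneg.ofL2 hs (ρ t₁)‖ ≤ w)
    {q : ℝ} (hq0 : 0 ≤ q) (hq : ∫⁻ x, ENNReal.ofReal ((∫ u in t₁..t₂, g (y u) x) ^ 2) ∂(dx d)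
      ≤ ENNReal.ofReal (q ^ 2)) :
    |∫ u in t₁..t₂, pairX (ρ u) fun x => g (y u) x * ξ x|
      ≤ √(B ^ 2 + d * (B + L) ^ 2) * w * (∫ u in t₁..t₂, (c * ‖y u‖ + b)) + R * B * q := by
  have hB0 : 0 ≤ B := (abs_nonneg _).trans (hB 0)
  obtain ⟨i1, e1⟩ := h.integral_pairX (ρ t₁) hξ hy ht hi
  have hZ : AEStronglyMeasurable (fun x => ∫ u in t₁..t₂, g (y u) x) (dx d) := by
    simp only [intervalIntegral.integral_of_le ht]
    exact (h.measurable_uncurry hy).stronglyMeasurable.integral_prod_right.aestronglyMeasurable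
  have h1 := abs_pairX_mul_le (ρ t₁) hZ hξ hB hq0 hq
  have h2 : |(∫ u in t₁..t₂, pairX (ρ u) fun x => g (y u) x * ξ x)
      - ∫ u in t₁..t₂, pairX (ρ t₁) fun x => g (y u) x * ξ x|
      ≤ √(B ^ 2 + d * (B + L) ^ 2) * w * ∫ u in t₁..t₂, (c * ‖y u‖ + b) := by
    rw [← intervalIntegral.integral_sub hint i1, ← intervalIntegral.integral_const_mul]
    refine (Real.norm_eq_abs _).symm.le.trans ?_
    refine intervalIntegral.norm_integral_le_of_norm_le ht (ae_of_all _ fun u hu => ?_)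
      (((intervalIntegrable_iff_integrableOn_Ioc_of_le ht).2
        (integrableOn_growth (by simp) hi)).const_mul _)
    -- The norm of `g (y u) ξ` in `H^s` is at most a constant times `c ‖y u‖ + b`.
    have hG := h.growth_nonneg (y u)
    have hψ : Continuous fun x => g (y u) x * ξ x := (g (y u)).continuous.mul hξ
    have hψB : ∀ x, |g (y u) x * ξ x| ≤ (c * ‖y u‖ + b) * B := fun x => by
      rw [abs_mul]
      exact mul_le_mul (h.abs_le _ x) (hB x) (abs_nonneg _) hG
    have hψL := (h.coordLipschitz (y u)).mul hL (h.abs_le (y u)) hB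
    have h3 := (Hneg.exists_pair_bounds hψ hψB hψL hs').2 (Hneg.ofL2 hs (ρ u))
      (Hneg.ofL2 hs (ρ t₁))
    rw [Hneg.pair_ofL2 hs _ hψ, Hneg.pair_ofL2 hs _ hψ,
      sqrt_growth_le hG (Nat.cast_nonneg d)] at h3
    rw [Real.norm_eq_abs]
    refine h3.trans ?_
    rw [mul_right_comm]
    exact mul_le_mul_of_nonneg_right (mul_le_mul_of_nonneg_left (hw u hu) (Real.sqrt_nonneg _)) hG
  rw [e1] at h2
  have h4 : ‖ρ t₁‖ * B * q ≤ R * B * q := by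
    have := hR t₁
    gcongr
  have h5 := abs_sub_abs_le_abs_sub (∫ u in t₁..t₂, pairX (ρ u) fun x => g (y u) x * ξ x)
    (pairX (ρ t₁) fun x => (∫ u in t₁..t₂, g (y u) x) * ξ x)
  linarith

/-- The estimate of the contribution of a fluctuating rate, by a subdivision of `[0, t]` into `n`
intervals. -/
theorem abs_integral_pairX_le_of_subdivision (h : IsLipschitzRate g c b) {ξ : Torus d → ℝ}
    (hξ : Continuous ξ) {B L : ℝ} (hB : ∀ x, |ξ x| ≤ B) (hL : CoordLipschitz L ξ)
    {s : ℝ} (hs : 0 ≤ s) (hs' : s ≤ 1) {ρ : ℝ → L2x d} {R : ℝ} (hR : ∀ u, ‖ρ u‖ ≤ R)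
    {y : ℝ → E} (hy : Measurable y) {t : ℝ} (ht : 0 ≤ t)
    (hi : IntegrableOn (fun u => ‖y u‖) (Ioc 0 t))
    (hint : IntervalIntegrable (fun u => pairX (ρ u) fun x => g (y u) x * ξ x) volume 0 t)
    {n : ℕ} (hn : 0 < n) {w : ℝ}
    (hw : ∀ u ∈ Icc 0 t, ∀ v ∈ Icc 0 t, |u - v| ≤ t / n →
      ‖Hneg.ofL2 hs (ρ u) - Hneg.ofL2 hs (ρ v)‖ ≤ w)
    {q : ℝ} (hq0 : 0 ≤ q) (hq : ∀ j < n, ∫⁻ x, ENNReal.ofReal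
      ((∫ u in (j * (t / n))..((j + 1 : ℕ) * (t / n)), g (y u) x) ^ 2) ∂(dx d)
        ≤ ENNReal.ofReal (q ^ 2)) :
    |∫ u in (0 : ℝ)..t, pairX (ρ u) fun x => g (y u) x * ξ x|
      ≤ √(B ^ 2 + d * (B + L) ^ 2) * w * (c * (∫ u in (0 : ℝ)..t, ‖y u‖) + b * t)
        + n * (R * B * q) := by
  have hn' : (0 : ℝ) < n := by exact_mod_cast hn
  have hstep : 0 ≤ t / n := by positivity
  set τ : ℕ → ℝ := fun j => j * (t / n) with hτ
  have hτ0 : τ 0 = 0 := by simp [hτ]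
  have hτn : τ n = t := by simp only [hτ]; field_simp
  have hmono : Monotone τ := fun i j hij =>
    mul_le_mul_of_nonneg_right (by exact_mod_cast hij) hstep
  have hsucc : ∀ j, τ (j + 1) = τ j + t / n := fun j => by simp only [hτ]; push_cast; ring
  have hτ0' : ∀ j, 0 ≤ τ j := fun j => by simp only [hτ]; positivity
  have hτn' : ∀ j < n, τ (j + 1) ≤ t := fun j hj => (hmono hj).trans_eq hτn
  have hsub : ∀ j < n, Ioc (τ j) (τ (j + 1)) ⊆ Ioc 0 t := fun j hj =>
    Ioc_subset_Ioc (hτ0' j) (hτn' j hj)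
  have hin : ∀ {F : ℝ → ℝ}, IntegrableOn F (Ioc 0 t) → ∀ j < n,
      IntervalIntegrable F volume (τ j) (τ (j + 1)) := fun hF j hj =>
    (intervalIntegrable_iff_integrableOn_Ioc_of_le (hmono j.le_succ)).2 (hF.mono_set (hsub j hj))
  have hint' := (intervalIntegrable_iff_integrableOn_Ioc_of_le ht).1 hint
  have hgr : IntegrableOn (fun u => c * ‖y u‖ + b) (Ioc 0 t) := integrableOn_growth (by simp) hi
  have s1 := intervalIntegral.sum_integral_adjacent_intervals (hin hint')
  have s2 := intervalIntegral.sum_integral_adjacent_intervals (hin hgr)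
  rw [hτ0, hτn] at s1 s2
  have s3 : ∫ u in (0 : ℝ)..t, (c * ‖y u‖ + b) = c * (∫ u in (0 : ℝ)..t, ‖y u‖) + b * t := by
    have hi' := (intervalIntegrable_iff_integrableOn_Ioc_of_le ht).2 hi
    rw [intervalIntegral.integral_add (hi'.const_mul c) intervalIntegrable_const,
      intervalIntegral.integral_const_mul, intervalIntegral.integral_const]
    simp [mul_comm]
  rw [← s1, ← s3, ← s2, Finset.mul_sum]
  have hlast : (n : ℝ) * (R * B * q) = ∑ _j ∈ Finset.range n, R * B * q := by simp
  rw [hlast, ← Finset.sum_add_distrib]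
  refine (Finset.abs_sum_le_sum_abs _ _).trans (Finset.sum_le_sum fun j hj => ?_)
  have hj' := Finset.mem_range.1 hj
  refine h.abs_integral_pairX_le hξ hB hL hs hs' hR hy (hmono j.le_succ)
    (hi.mono_set (hsub j hj')) (hin hint' j hj') (fun u hu => ?_) hq0 (hq j hj')
  have hu' := hsub j hj' hu
  refine hw u ⟨hu'.1.le, hu'.2⟩ (τ j) ⟨hτ0' j, (hmono j.le_succ).trans (hτn' j hj')⟩ ?_
  rw [abs_of_nonneg (by linarith [hu.1])]
  have := hu.2
  rw [hsucc] at this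
  linarith

end IsLipschitzRate

end Averaging

/-! ### Probability estimates, uniform in the parameters -/

section Probability

variable {Ω : Type*} [MeasurableSpace Ω] {Pr : Measure Ω}

/-- Markov's inequality for a family of random variables with bounded means. -/
theorem exists_tail_bound {ι : Type*} {X : ι → Ω → ℝ≥0∞} (hX : ∀ i, AEMeasurable (X i) Pr)
    {M : ℝ≥0} (hM : ∀ i, ∫⁻ ω, X i ω ∂Pr ≤ M) {θ : ℝ≥0} (hθ : 0 < θ) :
    ∃ N : ℝ≥0, ∀ i, Pr {ω | N < X i ω} ≤ θ := by
  refine ⟨(M + 1) / θ, fun i => ?_⟩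
  have hN : 0 < (M + 1) / θ := by positivity
  have hN' : (((M + 1) / θ : ℝ≥0) : ℝ≥0∞) ≠ 0 := by simpa using hN.ne'
  have hsub : {ω | (((M + 1) / θ : ℝ≥0) : ℝ≥0∞) < X i ω}
      ⊆ {ω | (((M + 1) / θ : ℝ≥0) : ℝ≥0∞) ≤ X i ω} := fun ω hω => by
    rw [mem_ofPred_eq] at hω ⊢
    exact hω.le
  refine (measure_mono hsub).trans
    ((meas_ge_le_lintegral_div (hX i) hN' ENNReal.coe_ne_top).trans ?_)
  refine ENNReal.div_le_of_le_mul ((hM i).trans ?_)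
  rw [← ENNReal.coe_mul, mul_div_cancel₀ _ hθ.ne', ENNReal.coe_le_coe]
  exact le_self_add

theorem exists_norm_tail_bound {ι F : Type*} [NormedAddCommGroup F] {X : ι → Ω → F}
    (hX : ∀ i, AEStronglyMeasurable (X i) Pr) {k : ℕ} (hk : k ≠ 0)
    (hM : (⨆ i, ∫⁻ ω, ‖X i ω‖ₑ ^ k ∂Pr) < ∞) {θ : ℝ≥0} (hθ : 0 < θ) :
    ∃ N : ℝ, 0 ≤ N ∧ ∀ i, Pr {ω | N < ‖X i ω‖} ≤ θ := by
  obtain ⟨N, hN⟩ := exists_tail_bound (M := (⨆ i, ∫⁻ ω, ‖X i ω‖ₑ ^ k ∂Pr).toNNReal)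
    (fun i => (hX i).enorm.pow_const k)
    (fun i => (le_iSup (fun i => ∫⁻ ω, ‖X i ω‖ₑ ^ k ∂Pr) i).trans
      (ENNReal.coe_toNNReal hM.ne).ge) hθ
  refine ⟨1 + N, by positivity, fun i => le_trans (measure_mono fun ω hω => ?_) (hN i)⟩
  replace hω : 1 + (N : ℝ) < ‖X i ω‖ := hω
  have h1 : 1 ≤ ‖X i ω‖ := by have := N.coe_nonneg; linarith
  have h2 : (N : ℝ) < ‖X i ω‖ ^ k := by
    have := le_self_pow₀ h1 hk
    linarith
  change (N : ℝ≥0∞) < ‖X i ω‖ₑ ^ k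
  rw [enorm_eq_nnnorm, ← ENNReal.coe_pow, ENNReal.coe_lt_coe, ← NNReal.coe_lt_coe]
  simpa using h2

variable [IsProbabilityMeasure Pr] {E : Type*} [NormedAddCommGroup E] [MeasurableSpace E]
  [BorelSpace E] {P : ℝ≥0 → Kernel E E} {ν : Measure E} {ℓ₀ : E} {m : ℝ≥0 → Ω → E}

theorem measurable_rescaled {E : Type*} [MeasurableSpace E] {m : ℝ≥0 → Ω → E}
    (hm_meas : Measurable fun p : ℝ≥0 × Ω => m p.1 p.2) (δ : ℝ) :
    Measurable fun z : ℝ × Ω => m (z.1 / δ ^ 2).toNNReal z.2 :=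
  hm_meas.comp (f := fun z : ℝ × Ω => ((z.1 / δ ^ 2).toNNReal, z.2)) (by fun_prop)

/-- The driving paths are integrable in time, with a bound which is uniform in the acceleration and
holds with high probability. -/
theorem exists_driving_tail_bound (hm_meas : Measurable fun p : ℝ≥0 × Ω => m p.1 p.2)
    (hm_mom : HasUniformMoments Pr m) (T : ℝ) {θ : ℝ≥0} (hθ : 0 < θ) :
    ∃ N : ℝ, 0 ≤ N ∧ ∀ δ : ℝ, Pr {ω | ¬ (IntegrableOn (fun u => ‖m (u / δ ^ 2).toNNReal ω‖)
      (Ioc 0 T) ∧ ∫ u in Ioc 0 T, ‖m (u / δ ^ 2).toNNReal ω‖ ≤ N)} ≤ θ := by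
  obtain ⟨D, hD⟩ := exists_lintegral_norm_le hm_meas hm_mom
  have hX := fun δ => measurable_rescaled hm_meas δ
  obtain ⟨N, hN⟩ := exists_tail_bound (Pr := Pr) (M := D * T.toNNReal)
    (X := fun (δ : ℝ) ω => ∫⁻ u in Ioc (0 : ℝ) T, ‖m (u / δ ^ 2).toNNReal ω‖ₑ)
    (fun δ => ((hX δ).enorm.lintegral_prod_left').aemeasurable)
    (fun δ => by rw [ENNReal.coe_mul]; exact hD δ T) hθ
  refine ⟨N, N.coe_nonneg, fun δ => (measure_mono fun ω hω => ?_).trans (hN δ)⟩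
  by_contra hle
  simp only [mem_ofPred_eq, not_lt] at hle
  refine hω ?_
  have hmeas : Measurable fun u => m (u / δ ^ 2).toNNReal ω :=
    (hX δ).comp (measurable_id.prodMk measurable_const)
  refine ⟨⟨hmeas.norm.aestronglyMeasurable, ?_⟩, ?_⟩
  · simpa [HasFiniteIntegral] using hle.trans_lt ENNReal.coe_lt_top
  · rw [integral_eq_lintegral_of_nonneg_ae (ae_of_all _ fun u => norm_nonneg _)
      hmeas.norm.aestronglyMeasurable]
    simp only [ofReal_norm]
    exact ENNReal.toReal_le_coe_of_le_coe hle

/-- The time averages of a centred rate are small in `L²_x`, with high probability. -/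
theorem exists_average_tail_bound (hP : IsErgodicMarkovSemigroup P ν) (hmix : IsMixing P)
    (hm : IsMarkovFrom P ℓ₀ Pr m) (hm_meas : Measurable fun p : ℝ≥0 × Ω => m p.1 p.2)
    (hm_mom : HasUniformMoments Pr m) {d : ℕ} {g : E → C(Torus d, ℝ)} {c b : ℝ}
    (h : IsLipschitzRate g c b) (hg : ∀ x, ∫ ℓ, g ℓ x ∂ν = 0) {t : ℝ} (ht : 0 ≤ t) {n : ℕ}
    (hn : 0 < n) {q : ℝ} (hq : 0 < q) {θ : ℝ≥0} (hθ : 0 < θ) :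
    ∃ η > 0, ∀ δ > 0, δ < η → Pr {ω | ¬ ∀ j < n, ∫⁻ x, ENNReal.ofReal
      ((∫ u in (j * (t / n))..((j + 1 : ℕ) * (t / n)), g (m (u / δ ^ 2).toNNReal ω) x) ^ 2) ∂(dx d)
        ≤ ENNReal.ofReal (q ^ 2)} ≤ θ := by
  obtain ⟨D, hD0, hD⟩ := exists_variance_bound hP hmix hm hm_meas hm_mom h.c_nonneg
  have hn' : (0 : ℝ) < n := by exact_mod_cast hn
  have hstep : 0 ≤ t / n := by positivity
  have hq2 : 0 < q ^ 2 := by positivity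
  have hvar : ∀ δ > 0, ∀ j : ℕ, ∫⁻ ω, (∫⁻ x, ENNReal.ofReal
      ((∫ u in (j * (t / n))..((j + 1 : ℕ) * (t / n)), g (m (u / δ ^ 2).toNNReal ω) x) ^ 2)
        ∂(dx d)) ∂Pr ≤ ENNReal.ofReal (D * δ ^ 2 * (t / n)) ∧
      Measurable fun ω => ∫⁻ x, ENNReal.ofReal
      ((∫ u in (j * (t / n))..((j + 1 : ℕ) * (t / n)), g (m (u / δ ^ 2).toNNReal ω) x) ^ 2)
        ∂(dx d) := by
    intro δ hδ j
    have hle : (j : ℝ) * (t / n) ≤ (j + 1 : ℕ) * (t / n) := by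
      push_cast; linarith
    have h1 : Measurable fun z : (Ω × Torus d) × ℝ => g (m (z.2 / δ ^ 2).toNNReal z.1.1) z.1.2 :=
      (h.measurable_uncurry (measurable_rescaled hm_meas δ)).comp
        (f := fun z : (Ω × Torus d) × ℝ => (z.1.2, (z.2, z.1.1))) (by fun_prop)
    have h2 : Measurable fun z : Ω × Torus d => ENNReal.ofReal
      ((∫ u in (j * (t / n))..((j + 1 : ℕ) * (t / n)),
        g (m (u / δ ^ 2).toNNReal z.1) z.2) ^ 2) := by
      simp only [intervalIntegral.integral_of_le hle]
      exact (h1.stronglyMeasurable.integral_prod_right.measurable.pow_const 2).ennreal_ofReal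
    refine ⟨?_, h2.lintegral_prod_right'⟩
    rw [lintegral_lintegral_swap h2.aemeasurable]
    calc _ ≤ ∫⁻ _x, ENNReal.ofReal (D * δ ^ 2 * (t / n)) ∂(dx d) := by
          refine lintegral_mono fun x => ?_
          have := hD (fun ℓ => g ℓ x) (fun ℓ ℓ' => h.abs_sub_le ℓ ℓ' x) (hg x) δ hδ
            (j * (t / n)) ((j + 1 : ℕ) * (t / n)) (by positivity) hle
          refine this.trans (le_of_eq ?_)
          congr 1
          push_cast
          ring
      _ = _ := by simp
  -- By Markov's inequality and the variance bound, the event has probability at most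
  -- `n · D δ² (t / n) / q² = D δ² t / q²`.
  refine ⟨√(θ * q ^ 2 / (D * t + 1)), Real.sqrt_pos.2 (by positivity), fun δ hδ hδη => ?_⟩
  have hδ2 : D * δ ^ 2 * t / q ^ 2 ≤ θ := by
    have h1 : δ ^ 2 ≤ θ * q ^ 2 / (D * t + 1) := by
      have := pow_le_pow_left₀ hδ.le hδη.le 2
      rwa [Real.sq_sqrt (by positivity)] at this
    rw [le_div_iff₀ (by positivity)] at h1
    rw [div_le_iff₀ hq2]
    nlinarith [sq_nonneg δ]
  have hset : {ω | ¬ ∀ j < n, ∫⁻ x, ENNReal.ofReal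
      ((∫ u in (j * (t / n))..((j + 1 : ℕ) * (t / n)), g (m (u / δ ^ 2).toNNReal ω) x) ^ 2) ∂(dx d)
        ≤ ENNReal.ofReal (q ^ 2)} ⊆ ⋃ j ∈ Finset.range n, {ω | ENNReal.ofReal (q ^ 2) ≤
      ∫⁻ x, ENNReal.ofReal ((∫ u in (j * (t / n))..((j + 1 : ℕ) * (t / n)),
        g (m (u / δ ^ 2).toNNReal ω) x) ^ 2) ∂(dx d)} := by
    intro ω hω
    simp only [mem_ofPred_eq, not_forall, not_le] at hω
    obtain ⟨j, hj, hlt⟩ := hω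
    exact mem_biUnion (Finset.mem_coe.2 (Finset.mem_range.2 hj)) hlt.le
  calc _ ≤ ∑ j ∈ Finset.range n, ENNReal.ofReal (D * δ ^ 2 * (t / n)) / ENNReal.ofReal (q ^ 2) := by
        refine (measure_mono hset).trans ((measure_biUnion_finset_le _ _).trans
          (Finset.sum_le_sum fun j _ => ?_))
        refine (meas_ge_le_lintegral_div (hvar δ hδ j).2.aemeasurable
          (ENNReal.ofReal_pos.2 hq2).ne' ENNReal.ofReal_ne_top).trans ?_
        exact ENNReal.div_le_div_right (hvar δ hδ j).1 _
    _ = ENNReal.ofReal (D * δ ^ 2 * t / q ^ 2) := by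
        rw [← ENNReal.ofReal_div_of_pos hq2, Finset.sum_const, Finset.card_range,
          ← ENNReal.ofReal_nsmul]
        congr 1
        simp only [nsmul_eq_mul]
        field_simp
    _ ≤ θ := by
        rw [← ENNReal.ofReal_coe_nnreal]
        exact ENNReal.ofReal_le_ofReal hδ2

end Probability

/-! ### Convergence in distribution of continuous paths -/

section Paths

/-- A limit in distribution charges an open set by at most the asymptotic bound for its
approximations; the latter is only needed on each of the open sets `U n` that exhaust the space. -/
theorem measure_le_of_tendstoInDistribution {F : Type*} [TopologicalSpace F]
    [HasOuterApproxClosed F] [MeasurableSpace F]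
    [BorelSpace F] {Ω Ω' : Type*} [MeasurableSpace Ω] [MeasurableSpace Ω'] {Pr : Measure Ω}
    [IsProbabilityMeasure Pr] {Pr' : Measure Ω'} [IsProbabilityMeasure Pr'] {X : ℕ → Ω → F}
    {Z : Ω' → F} (hXZ : TendstoInDistribution X atTop Z (fun _ => Pr) Pr') {G : Set F}
    (hG : IsOpen G) {U : ℕ → Set F} (hU : ∀ n, IsOpen (U n)) (hmono : Monotone U)
    (huniv : ⋃ n, U n = univ) {θ : ℝ≥0∞}
    (hθ : ∀ n, ∀ᶠ i in atTop, Pr {ω | X i ω ∈ G ∩ U n} ≤ θ) : Pr' {ω | Z ω ∈ G} ≤ θ := by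
  have h1 : ∀ n, Pr'.map Z (G ∩ U n) ≤ θ := fun n => by
    have ho := hG.inter (hU n)
    have h2 := ProbabilityMeasure.le_liminf_measure_open_of_tendsto hXZ.tendsto ho
    refine h2.trans (liminf_le_of_frequently_le' ((hθ n).mono fun i hi => ?_).frequently)
    change Pr.map (X i) (G ∩ U n) ≤ θ
    rwa [Measure.map_apply_of_aemeasurable (hXZ.forall_aemeasurable i) ho.measurableSet]
  have h2 : Pr'.map Z G = ⨆ n, Pr'.map Z (G ∩ U n) := by
    rw [← Monotone.measure_iUnion fun i j hij => inter_subset_inter_right G (hmono hij),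
      ← inter_iUnion, huniv, inter_univ]
  have h3 : Pr' {ω | Z ω ∈ G} = Pr'.map Z G :=
    (Measure.map_apply_of_aemeasurable hXZ.aemeasurable_limit hG.measurableSet).symm
  rw [h3, h2]
  exact iSup_le h1

variable {F : Type*} [PseudoMetricSpace F] {T : ℝ}

/-- The continuous paths whose modulus of continuity at the scale `h` is less than `w`. -/
def slowPaths (F : Type*) [PseudoMetricSpace F] (T h w : ℝ) : Set C(Icc (0 : ℝ) T, F) :=
  {u | ∃ r < w, ∀ x y : Icc (0 : ℝ) T, |(x : ℝ) - y| ≤ h → dist (u x) (u y) ≤ r}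

theorem isOpen_slowPaths (h w : ℝ) : IsOpen (slowPaths F T h w) := by
  refine Metric.isOpen_iff.2 fun u ⟨r, hr, hu⟩ => ⟨(w - r) / 4, by linarith, fun v hv => ?_⟩
  refine ⟨r + (w - r) / 2, by linarith, fun x y hxy => ?_⟩
  have h1 := hu x y hxy
  have h2 : ∀ z, dist (v z) (u z) ≤ (w - r) / 4 := fun z =>
    (ContinuousMap.dist_apply_le_dist z).trans (Metric.mem_ball.1 hv).le
  have h3 := dist_triangle4 (v x) (u x) (u y) (v y)
  have h4 := h2 y
  rw [dist_comm] at h4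
  linarith [h2 x]

theorem slowPaths_anti {h h' : ℝ} (hh : h ≤ h') (w : ℝ) :
    slowPaths F T h' w ⊆ slowPaths F T h w := fun _ ⟨r, hr, hu⟩ =>
  ⟨r, hr, fun x y hxy => hu x y (hxy.trans hh)⟩

theorem iUnion_slowPaths {w : ℝ} (hw : 0 < w) :
    ⋃ n : ℕ, slowPaths F T (T / (n + 1)) w = univ := by
  refine eq_univ_of_forall fun u => ?_
  obtain ⟨η, hη, H⟩ := Metric.uniformContinuous_iff.1
    (CompactSpace.uniformContinuous_of_continuous u.continuous) (w / 2) (by positivity)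
  obtain ⟨n, hn⟩ := exists_nat_gt (T / η)
  refine mem_iUnion.2 ⟨n, w / 2, by linarith, fun x y hxy => (H ?_).le⟩
  rw [Subtype.dist_eq, Real.dist_eq]
  refine hxy.trans_lt ?_
  rw [div_lt_iff₀ hη] at hn
  rw [div_lt_iff₀ (by positivity)]
  nlinarith

end Paths

/-! ### The weak form of the limit equation -/

section Limit

variable {d : ℕ} {s T : ℝ}

/-- The defect of a path `u` in the weak form of an equation `∂_t u = 𝒜* u` on `[0, t]`, tested
against `ξ`; here `A` stands for `𝒜 ξ`. The path is extended to a function of `t : ℝ` by its values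
at the endpoints. -/
def defect (hT : 0 ≤ T) (ξ A : Torus d → ℝ) (t : ℝ) (u : PathSpace d s T) : ℝ :=
  Hneg.pair (IccExtend hT u t) ξ - Hneg.pair (IccExtend hT u 0) ξ
    - ∫ τ in (0 : ℝ)..t, Hneg.pair (IccExtend hT u τ) A

theorem continuous_IccExtend_uncurry (hT : 0 ≤ T) :
    Continuous fun z : PathSpace d s T × ℝ => IccExtend hT z.1 z.2 :=
  continuous_eval.comp (continuous_fst.prodMk ((continuous_projIcc (h := hT)).comp continuous_snd))

theorem continuous_defect (hT : 0 ≤ T) {ξ A : Torus d → ℝ}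
    (hξ : Continuous fun u : Hneg d s => Hneg.pair u ξ)
    (hA : Continuous fun u : Hneg d s => Hneg.pair u A) :
    Continuous fun z : PathSpace d s T × ℝ => defect hT ξ A z.2 z.1 := by
  have h0 := continuous_IccExtend_uncurry (d := d) (s := s) hT
  refine ((hξ.comp h0).sub (hξ.comp (h0.comp (continuous_fst.prodMk continuous_const)))).sub ?_
  refine intervalIntegral.continuous_parametric_intervalIntegral_of_continuous
    (f := fun (z : PathSpace d s T × ℝ) τ => Hneg.pair (IccExtend hT z.1 τ) A) ?_ continuous_snd
  exact hA.comp (h0.comp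
    (f := fun y : (PathSpace d s T × ℝ) × ℝ => (y.1.1, y.2)) (by fun_prop))

theorem continuous_defect_time (hT : 0 ≤ T) {ξ A : Torus d → ℝ}
    (hξ : Continuous fun u : Hneg d s => Hneg.pair u ξ)
    (hA : Continuous fun u : Hneg d s => Hneg.pair u A) (u : PathSpace d s T) :
    Continuous fun t : ℝ => defect hT ξ A t u :=
  Continuous.comp (g := fun z : PathSpace d s T × ℝ => defect hT ξ A z.2 z.1)
    (f := fun t : ℝ => (u, t)) (continuous_defect hT hξ hA) (by fun_prop)

theorem continuous_defect_path (hT : 0 ≤ T) {ξ A : Torus d → ℝ}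
    (hξ : Continuous fun u : Hneg d s => Hneg.pair u ξ)
    (hA : Continuous fun u : Hneg d s => Hneg.pair u A) (t : ℝ) :
    Continuous fun u : PathSpace d s T => defect hT ξ A t u :=
  Continuous.comp (g := fun z : PathSpace d s T × ℝ => defect hT ξ A z.2 z.1)
    (f := fun u : PathSpace d s T => (u, t)) (continuous_defect hT hξ hA) (by fun_prop)

/-- As the defect is continuous in time, the exceptional null sets of a dense sequence of times
suffice. -/
theorem ae_forall_defect_eq_zero {Ω' : Type*} [MeasurableSpace Ω'] {Pr' : Measure Ω'}
    (hT : 0 ≤ T) {ξ A : Torus d → ℝ}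
    (hξ : Continuous fun u : Hneg d s => Hneg.pair u ξ)
    (hA : Continuous fun u : Hneg d s => Hneg.pair u A) {ρ : Ω' → PathSpace d s T}
    (h : ∀ t ∈ Icc 0 T, ∀ᵐ ω ∂Pr', defect hT ξ A t (ρ ω) = 0) :
    ∀ᵐ ω ∂Pr', ∀ t ∈ Icc 0 T, defect hT ξ A t (ρ ω) = 0 := by
  have : Nonempty (Icc (0 : ℝ) T) := ⟨⟨0, le_rfl, hT⟩⟩
  have hd : ∀ n : ℕ, ∀ᵐ ω ∂Pr',
      defect hT ξ A (TopologicalSpace.denseSeq (Icc (0 : ℝ) T) n) (ρ ω) = 0 := fun n =>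
    h _ (TopologicalSpace.denseSeq (Icc (0 : ℝ) T) n).2
  refine (ae_all_iff.2 hd).mono fun ω hω t ht => ?_
  have hc : Continuous ((fun t : ℝ => defect hT ξ A t (ρ ω)) ∘ ((↑) : Icc (0 : ℝ) T → ℝ)) :=
    (continuous_defect_time hT hξ hA (ρ ω)).comp continuous_subtype_val
  exact congrFun ((TopologicalSpace.denseRange_denseSeq (Icc (0 : ℝ) T)).equalizer hc
    continuous_const (funext hω)) ⟨t, ht⟩

/-- The chain rule for a test function along a path without defect. -/
theorem integral_deriv_comp_of_defect_eq_zero (hT : 0 ≤ T) {ξ A : Torus d → ℝ}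
    (hξ : Continuous fun u : Hneg d s => Hneg.pair u ξ)
    (hA : Continuous fun u : Hneg d s => Hneg.pair u A) {u : PathSpace d s T}
    (hu : ∀ t ∈ Icc 0 T, defect hT ξ A t u = 0) {χ : ℝ → ℝ} (hχ : ContDiff ℝ 1 χ) {t : ℝ}
    (ht : t ∈ Icc 0 T) :
    IntervalIntegrable (fun τ => deriv χ (Hneg.pair (IccExtend hT u τ) ξ)
      * Hneg.pair (IccExtend hT u τ) A) volume 0 t ∧
    χ (Hneg.pair (IccExtend hT u t) ξ) - χ (Hneg.pair (IccExtend hT u 0) ξ)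
      - ∫ τ in (0 : ℝ)..t, deriv χ (Hneg.pair (IccExtend hT u τ) ξ)
        * Hneg.pair (IccExtend hT u τ) A = 0 := by
  have hcu : Continuous (IccExtend hT u) := u.continuous.Icc_extend'
  have hχ' : Continuous (deriv χ) := hχ.continuous_deriv le_rfl
  set h : ℝ → ℝ := fun τ => Hneg.pair (IccExtend hT u τ) A with hh
  have hc : Continuous h := hA.comp hcu
  set W : ℝ → ℝ := fun τ => Hneg.pair (IccExtend hT u 0) ξ + ∫ x in (0 : ℝ)..τ, h x with hW
  have hWd : ∀ τ, HasDerivAt W (h τ) τ := fun τ =>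
    (intervalIntegral.integral_hasDerivAt_right (hc.intervalIntegrable _ _)
      (hc.stronglyMeasurableAtFilter _ _) hc.continuousAt).const_add _
  have hWc : Continuous W := continuous_iff_continuousAt.2 fun τ => (hWd τ).continuousAt
  have hWu : ∀ τ ∈ Icc 0 T, W τ = Hneg.pair (IccExtend hT u τ) ξ := fun τ hτ => by
    have := hu τ hτ
    unfold defect at this
    simp only [hW, hh]
    linarith
  refine ⟨((hχ'.comp (hξ.comp hcu)).mul hc).intervalIntegrable _ _, ?_⟩
  have h1 := intervalIntegral.integral_eq_sub_of_hasDerivAt (a := 0) (b := t)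
    (f := fun τ => χ (W τ)) (f' := fun τ => deriv χ (W τ) * h τ)
    (fun τ _ => ((hχ.differentiable one_ne_zero _).hasDerivAt).comp τ (hWd τ))
    (((hχ'.comp hWc).mul hc).intervalIntegrable _ _)
  have h2 : ∫ τ in (0 : ℝ)..t, deriv χ (W τ) * h τ
      = ∫ τ in (0 : ℝ)..t, deriv χ (Hneg.pair (IccExtend hT u τ) ξ) * h τ := by
    refine intervalIntegral.integral_congr fun τ hτ => ?_
    rw [uIcc_of_le ht.1] at hτ
    simp only [hWu τ ⟨hτ.1, hτ.2.trans ht.2⟩]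
  rw [h2, hWu t ht, hWu 0 ⟨le_rfl, hT⟩] at h1
  rw [h1, sub_self]

variable {V : Type*} [MeasurableSpace V] {μ : Measure V} {C : VelocityModel d μ}

theorem isCk_driftTest {ξ : Torus d → ℝ} (hξ : IsCk 3 ξ) : IsCk 1 (C.driftTest ξ) := by
  have h1 : ∀ i, IsCk 1 (partialD i ξ) := fun i => (IsCk.partialD (n := 2) hξ i).mono (by norm_num)
  have h2 : ∀ i j, IsCk 1 (partialD i (partialD j ξ)) := fun i j =>
    IsCk.partialD (n := 1) (IsCk.partialD (n := 2) hξ j) i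
  exact ContDiff.add (ContDiff.sum fun j _ => ContDiff.sum fun i _ => contDiff_const.mul (h2 i j))
    (ContDiff.sum fun i _ => contDiff_const.mul (h1 i))

/-- As a distribution, the drift of the limit equation acts on `ξ` by the test function of the
kinetic part. -/
theorem limitDrift_eq {c : Torus d → ℝ} {ξ : Torus d → ℝ} (hξ : IsCk 3 ξ) (u : Hneg d s) :
    limitDrift C.K C.J c u ξ = Hneg.pair u fun x => C.driftTest ξ x - c x * ξ x := by
  have h1 : ∀ i, IsCk 1 (partialD i ξ) := fun i => (IsCk.partialD (n := 2) hξ i).mono (by norm_num)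
  unfold limitDrift VelocityModel.driftTest
  simp only [partialD_sum_mul _ _ h1]
  congr 1
  funext x
  rw [Finset.sum_comm]

variable [SigmaFinite μ]

theorem continuous_pairX_density (hT : 0 ≤ T) (f : C(Icc (0 : ℝ) T, C.L2M)) {η : Torus d → ℝ}
    (hη : Continuous η) : Continuous fun τ => pairX (C.density (IccExtend hT f τ)) η := by
  simpa only [VelocityModel.mom_one _ hη] using
    VelocityModel.continuous_mom (hT := hT) f (fun _ => 1) η

theorem IccExtend_densityPath (hs : 0 ≤ s) (hT : 0 ≤ T) (f : C(Icc (0 : ℝ) T, C.L2M)) (t : ℝ) :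
    IccExtend hT (C.densityPath hs f) t = Hneg.ofL2 hs (C.density (IccExtend hT f t)) := rfl

variable {E : Type*} [NormedAddCommGroup E] [MeasurableSpace E] [BorelSpace E]

/-- The defect of the density of a solution of the kinetic equation in the limit equation, on the
event that the initial value and the driving path are bounded, the density varies slowly, and the
time averages of the fluctuation `g = σ - σ̄` of the rate are small. -/
theorem exists_abs_defect_le (hT : 0 ≤ T) {ξ : Torus d → ℝ} (hξ : IsCk 3 ξ)
    {σ g : E → C(Torus d, ℝ)} {c b : ℝ} (hσ : IsLipschitzRate σ c b) (hg : IsLipschitzRate g c b)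
    {σ' : Torus d → ℝ} (hσ' : Continuous σ') (hgσ : ∀ ℓ x, g ℓ x = σ ℓ x - σ' x)
    (hs : 0 ≤ s) (hs' : s ≤ 1) (N₁ N₂ : ℝ) :
    ∃ K, 0 ≤ K ∧ ∀ {ε : ℝ} {y : ℝ → E} {f₀ : C.L2M} {f : C(Icc (0 : ℝ) T, C.L2M)}, 0 < ε →
      Measurable y → IntegrableOn (fun u => ‖y u‖) (Ioc 0 T) →
      ∫ u in Ioc 0 T, ‖y u‖ ≤ N₂ → ‖f₀‖ ≤ N₁ → C.IsMildSolution hT ε (fun u => σ (y u)) f₀ f →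
      ∀ t ∈ Icc 0 T, ∀ n : ℕ, 0 < n → ∀ w, C.densityPath hs f ∈ slowPaths (Hneg d s) T (T / n) w →
      ∀ q, 0 ≤ q → (∀ j < n, ∫⁻ x, ENNReal.ofReal
        ((∫ u in (j * (t / n))..((j + 1 : ℕ) * (t / n)), g (y u) x) ^ 2) ∂(dx d)
          ≤ ENNReal.ofReal (q ^ 2)) →
      |defect hT ξ (fun x => C.driftTest ξ x - σ' x * ξ x) t (C.densityPath hs f)|
        ≤ K * (ε + ε ^ 2) + K * w + K * (n * q) := by
  obtain ⟨D, hD0, hD⟩ := VelocityModel.exists_diffusion_approx (C := C) hT hξ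
  have hξc := hξ.continuous
  obtain ⟨B, hB0, hB⟩ := exists_bound_of_continuous hξc
  obtain ⟨L, hL0, hL⟩ := (hξ.mono (by norm_num : 1 ≤ 3)).exists_coordLipschitz
  -- `k` bounds the integral of the rate on `[0, T]`, and `R` bounds the solution.
  set k := |c * N₂ + b * T| with hk
  set R := |N₁| * Real.exp k with hR
  set S := √(B ^ 2 + d * (B + L) ^ 2) with hS
  have hR0 : 0 ≤ R := by positivity
  have hk0 : 0 ≤ k := abs_nonneg _
  refine ⟨D * (R * (1 + k)) + S * k + R * B, by positivity, ?_⟩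
  intro ε y f₀ f hε hy hi hN₂ hN₁ hf t ht n hn w hw q hq0 hq
  have hgrow : IntervalIntegrable (fun u => c * ‖y u‖ + b) volume 0 T :=
    (intervalIntegrable_iff_integrableOn_Ioc_of_le hT).2
      (IsLipschitzRate.integrableOn_growth (by simp) hi)
  have hi' : IntervalIntegrable (fun u => ‖y u‖) volume 0 T :=
    (intervalIntegrable_iff_integrableOn_Ioc_of_le hT).2 hi
  have hgrow_le : ∫ u in (0 : ℝ)..T, (c * ‖y u‖ + b) ≤ k := by
    rw [intervalIntegral.integral_add (hi'.const_mul c) intervalIntegrable_const,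
      intervalIntegral.integral_const_mul, intervalIntegral.integral_const,
      intervalIntegral.integral_of_le hT, smul_eq_mul, sub_zero, mul_comm T]
    exact (add_le_add_left (mul_le_mul_of_nonneg_left hN₂ hσ.c_nonneg) _).trans (le_abs_self _)
  have hrate : IntervalIntegrable (fun u => ‖σ (y u)‖) volume 0 T := by
    refine hgrow.mono_fun ?_ (ae_of_all _ fun u => ?_)
    · exact (hσ.continuous.norm.measurable.comp hy).aestronglyMeasurable
    · simp only [norm_norm]
      exact (hσ.norm_le _).trans (le_abs_self _)
  have hsol : C.IsBoundedSolution hT ε R k (fun u => σ (y u)) f := by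
    refine ⟨hε, ⟨f₀, hf⟩, hrate, ?_, fun τ => ?_⟩
    · exact (intervalIntegral.integral_mono_on hT hrate hgrow fun u _ => hσ.norm_le _).trans hgrow_le
    · have h1 := hf.norm_le hgrow (fun u => hσ.norm_le _) (projIcc 0 T hT τ).2
      rw [IccExtend_val] at h1
      refine h1.trans (mul_le_mul (hN₁.trans (le_abs_self _)) (Real.exp_le_exp.2 hgrow_le)
        (Real.exp_nonneg _) (abs_nonneg _))
  obtain ⟨hint, happ⟩ := hD hsol t ht
  set ρ : ℝ → L2x d := fun τ => C.density (IccExtend hT f τ) with hρ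
  have hρR : ∀ τ, ‖ρ τ‖ ≤ R := fun τ => (C.norm_density_le _).trans (hsol.norm_le τ)
  have hdc : Continuous (C.driftTest ξ) := (isCk_driftTest hξ).continuous
  have hσξ : Continuous fun x => σ' x * ξ x := hσ'.mul hξc
  have hAc : Continuous fun x => C.driftTest ξ x - σ' x * ξ x := hdc.sub hσξ
  have i1 : IntervalIntegrable (fun τ => pairX (ρ τ) (C.driftTest ξ)) volume 0 t :=
    (continuous_pairX_density hT f hdc).intervalIntegrable _ _
  have i2 : IntervalIntegrable (fun τ => pairX (ρ τ) fun x => σ' x * ξ x) volume 0 t :=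
    (continuous_pairX_density hT f hσξ).intervalIntegrable _ _
  have e1 : ∀ τ, pairX (ρ τ) (fun x => g (y τ) x * ξ x)
      = pairX (ρ τ) (fun x => σ (y τ) x * ξ x) - pairX (ρ τ) fun x => σ' x * ξ x := fun τ => by
    simp only [hgσ, sub_mul]
    exact pairX_sub _ ((σ (y τ)).continuous.mul hξc) hσξ
  have hgint : IntervalIntegrable (fun τ => pairX (ρ τ) fun x => g (y τ) x * ξ x) volume 0 t := by
    simp only [e1]
    exact hint.sub i2
  have e2 : ∫ τ in (0 : ℝ)..t, pairX (ρ τ) (fun x => g (y τ) x * ξ x)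
      = (∫ τ in (0 : ℝ)..t, pairX (ρ τ) fun x => σ (y τ) x * ξ x)
        - ∫ τ in (0 : ℝ)..t, pairX (ρ τ) fun x => σ' x * ξ x := by
    simp only [e1]
    exact intervalIntegral.integral_sub hint i2
  have e3 : ∫ τ in (0 : ℝ)..t, pairX (ρ τ) (fun x => C.driftTest ξ x - σ' x * ξ x)
      = (∫ τ in (0 : ℝ)..t, pairX (ρ τ) (C.driftTest ξ))
        - ∫ τ in (0 : ℝ)..t, pairX (ρ τ) fun x => σ' x * ξ x := by
    simp only [pairX_sub _ hdc hσξ]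
    exact intervalIntegral.integral_sub i1 i2
  have hdef : defect hT ξ (fun x => C.driftTest ξ x - σ' x * ξ x) t (C.densityPath hs f)
      = (pairX (ρ t) ξ - pairX (ρ 0) ξ - (∫ τ in (0 : ℝ)..t, pairX (ρ τ) (C.driftTest ξ))
          + ∫ τ in (0 : ℝ)..t, pairX (ρ τ) fun x => σ (y τ) x * ξ x)
        - ∫ τ in (0 : ℝ)..t, pairX (ρ τ) fun x => g (y τ) x * ξ x := by
    unfold defect
    simp only [IccExtend_densityPath, Hneg.pair_ofL2 hs _ hξc, Hneg.pair_ofL2 hs _ hAc]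
    change _ - _ - ∫ τ in (0 : ℝ)..t, pairX (ρ τ) (fun x => C.driftTest ξ x - σ' x * ξ x) = _
    rw [e2, e3]
    ring
  obtain ⟨r, hrw, hr⟩ := hw
  have hr0 : 0 ≤ r := by
    have h0 : (0 : ℝ) ∈ Icc 0 T := ⟨le_rfl, hT⟩
    exact dist_nonneg.trans (hr ⟨0, h0⟩ ⟨0, h0⟩ (by simp only [sub_self, abs_zero]; positivity))
  have hslow : ∀ u ∈ Icc 0 t, ∀ v ∈ Icc 0 t, |u - v| ≤ t / n →
      ‖Hneg.ofL2 hs (ρ u) - Hneg.ofL2 hs (ρ v)‖ ≤ w := fun u hu v hv huv => by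
    have hu' : u ∈ Icc 0 T := ⟨hu.1, hu.2.trans ht.2⟩
    have hv' : v ∈ Icc 0 T := ⟨hv.1, hv.2.trans ht.2⟩
    have h1 := hr ⟨u, hu'⟩ ⟨v, hv'⟩ (huv.trans (div_le_div_of_nonneg_right ht.2 (by positivity)))
    rw [← IccExtend_of_mem hT (C.densityPath hs f) hu',
      ← IccExtend_of_mem hT (C.densityPath hs f) hv', IccExtend_densityPath,
      IccExtend_densityPath, dist_eq_norm] at h1
    exact h1.trans hrw.le
  have hy_t : ∫ u in (0 : ℝ)..t, ‖y u‖ ≤ N₂ := by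
    rw [intervalIntegral.integral_of_le ht.1]
    exact (setIntegral_mono_set hi (ae_of_all _ fun u => norm_nonneg _)
      (Ioc_subset_Ioc_right ht.2).eventuallyLE).trans hN₂
  have hfl := hg.abs_integral_pairX_le_of_subdivision hξc hB hL hs hs' hρR hy ht.1
    (hi.mono_set (Ioc_subset_Ioc_right ht.2)) hgint hn hslow hq0 hq
  have hkt : c * (∫ u in (0 : ℝ)..t, ‖y u‖) + b * t ≤ k :=
    (add_le_add (mul_le_mul_of_nonneg_left hy_t hσ.c_nonneg)
      (mul_le_mul_of_nonneg_left ht.2 hσ.b_nonneg)).trans (le_abs_self _)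
  have hS0 : 0 ≤ S := Real.sqrt_nonneg _
  have hw0 : 0 ≤ w := hr0.trans hrw.le
  have hfl2 : S * w * (c * (∫ u in (0 : ℝ)..t, ‖y u‖) + b * t) ≤ S * w * k :=
    mul_le_mul_of_nonneg_left hkt (by positivity)
  rw [hdef]
  refine (abs_sub _ _).trans ?_
  have p1 : 0 ≤ (S * k + R * B) * (ε + ε ^ 2) := by positivity
  have p2 : 0 ≤ (D * (R * (1 + k)) + R * B) * w := by positivity
  have p3 : 0 ≤ (D * (R * (1 + k)) + S * k) * (n * q) := by positivity
  nlinarith [happ, hfl, hfl2, p1, p2, p3]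

end Limit

/-! ### Identification of the limit -/

section LimitEquation

variable {d : ℕ} {V : Type*} [MeasurableSpace V] {μ : Measure V} {C : VelocityModel d μ}

/-- The drift of the limit equation, tested against `ξ`, is a continuous function on `H^{-s}`. -/
theorem continuous_pair_drift {s : ℝ} (hs' : s ≤ 1) {ξ : Torus d → ℝ} (hξ : IsCk 3 ξ)
    {c : Torus d → ℝ} (hc : Continuous c) {L : ℝ} (hL : CoordLipschitz L c) :
    Continuous fun u : Hneg d s => Hneg.pair u fun x => C.driftTest ξ x - c x * ξ x := by
  have h1 := isCk_driftTest (C := C) hξ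
  obtain ⟨L₁, -, hL₁⟩ := h1.exists_coordLipschitz
  obtain ⟨L₂, -, hL₂⟩ := (hξ.mono (by norm_num : 1 ≤ 3)).exists_coordLipschitz
  obtain ⟨B, -, hB⟩ := exists_bound_of_continuous hc
  obtain ⟨B₂, -, hB₂⟩ := exists_bound_of_continuous hξ.continuous
  have hA : Continuous fun x => C.driftTest ξ x - c x * ξ x :=
    h1.continuous.sub (hc.mul hξ.continuous)
  obtain ⟨B₃, -, hB₃⟩ := exists_bound_of_continuous hA
  exact (Hneg.exists_pair_bounds hA hB₃ (hL₁.sub (hL.mul hL₂ hB hB₂)) hs').1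

theorem continuous_pair_test {s : ℝ} (hs' : s ≤ 1) {ξ : Torus d → ℝ} (hξ : IsCk 3 ξ) :
    Continuous fun u : Hneg d s => Hneg.pair u ξ := by
  obtain ⟨L, -, hL⟩ := (hξ.mono (by norm_num : 1 ≤ 3)).exists_coordLipschitz
  obtain ⟨B, -, hB⟩ := exists_bound_of_continuous hξ.continuous
  exact (Hneg.exists_pair_bounds hξ.continuous hB hL hs').1

variable [SigmaFinite μ] {E : Type*} [NormedAddCommGroup E] [MeasurableSpace E] [BorelSpace E]
  {Ω : Type*} [MeasurableSpace Ω] {Pr : Measure Ω} [IsProbabilityMeasure Pr]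
  {P : ℝ≥0 → Kernel E E} {ν : Measure E} {ℓ₀ : E} {m : ℝ≥0 → Ω → E}
  {Ω' : Type*} [MeasurableSpace Ω'] {Pr' : Measure Ω'} [IsProbabilityMeasure Pr']

/-- Limits in distribution of the densities satisfy the weak form of the limit equation at each
time. -/
theorem ae_defect_eq_zero {σ : E → C(Torus d, ℝ)} {c b : ℝ} (hσ : IsLipschitzRate σ c b)
    (hP : IsErgodicMarkovSemigroup P ν) (hmix : IsMixing P) (hm : IsMarkovFrom P ℓ₀ Pr m)
    (hm_meas : Measurable fun p : ℝ≥0 × Ω => m p.1 p.2) (hm_mom : HasUniformMoments Pr m)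
    {T : ℝ} (hT : 0 ≤ T) {ε δ : ℕ → ℝ} (hε : ∀ i, 0 < ε i) (hδ : ∀ i, 0 < δ i)
    (hε0 : Tendsto ε atTop (𝓝 0)) (hδ0 : Tendsto δ atTop (𝓝 0)) {f₀ : ℕ → Ω → C.L2M}
    (hf₀ : ∀ θ : ℝ≥0, 0 < θ → ∃ N : ℝ, 0 ≤ N ∧ ∀ i, Pr {ω | N < ‖f₀ i ω‖} ≤ θ)
    {f : ℕ → Ω → C(Icc (0 : ℝ) T, C.L2M)} (hf : ∀ i, ∀ᵐ ω ∂Pr, C.IsMildSolution hT (ε i)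
      (fun u => σ (m (u / δ i ^ 2).toNNReal ω)) (f₀ i ω) (f i ω))
    {s : ℝ} (hs : 0 ≤ s) (hs' : s ≤ 1) {ρ : Ω' → PathSpace d s T}
    (hρ : TendstoInDistribution (fun i ω => C.densityPath hs (f i ω)) atTop ρ (fun _ => Pr) Pr')
    {ξ : Torus d → ℝ} (hξ : IsCk 3 ξ) {t : ℝ} (ht : t ∈ Icc 0 T) :
    ∀ᵐ ω ∂Pr', defect hT ξ (fun x => C.driftTest ξ x - meanRate σ ν x * ξ x) t (ρ ω) = 0 := by
  have := hP.isProbabilityMeasure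
  have hσc := hσ.continuous_meanRate hP.integrable
  have hA := continuous_pair_drift (C := C) hs' hξ hσc (hσ.coordLipschitz_meanRate hP.integrable)
  obtain ⟨g, b', hbb, hg, hgσ, hgν⟩ := hσ.exists_fluctuation hP.integrable
  set A : Torus d → ℝ := fun x => C.driftTest ξ x - meanRate σ ν x * ξ x
  have hcont : Continuous fun u : PathSpace d s T => defect hT ξ A t u :=
    continuous_defect_path hT (continuous_pair_test hs' hξ) hA t
  have key : ∀ η : ℝ, 0 < η → ∀ θ : ℝ≥0, 0 < θ →
      Pr' {ω | ρ ω ∈ {u | η < |defect hT ξ A t u|}} ≤ θ + θ + θ := by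
    intro η hη θ hθ
    obtain ⟨N₁, -, hN₁⟩ := hf₀ θ hθ
    obtain ⟨N₂, -, hN₂⟩ := exists_driving_tail_bound hm_meas hm_mom T hθ
    obtain ⟨K, hK0, hK⟩ := exists_abs_defect_le (C := C) hT hξ (hσ.mono hbb) hg hσc hgσ hs hs'
      N₁ N₂
    -- The modulus of continuity `w` is chosen before the scale `T / (n + 1)` at which it is imposed,
    -- whereas `q`, and then `ε` and `δ`, may depend on `n`.
    set w := η / (3 * (K + 1)) with hw
    have hw0 : 0 < w := by positivity
    have hKw : K * w ≤ η / 3 := by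
      rw [hw, mul_div_assoc', div_le_div_iff₀ (by positivity) (by norm_num)]
      nlinarith
    refine measure_le_of_tendstoInDistribution hρ (isOpen_lt continuous_const hcont.abs)
      (U := fun n : ℕ => slowPaths (Hneg d s) T (T / (n + 1)) w) (fun n => isOpen_slowPaths _ _)
      (fun i j hij => slowPaths_anti (div_le_div_of_nonneg_left hT (by positivity)
        (by exact_mod_cast Nat.succ_le_succ hij)) w) (iUnion_slowPaths hw0) fun n => ?_
    set q := η / (3 * ((n + 1 : ℕ) * (K + 1))) with hq
    have hq0 : 0 < q := by positivity
    have hKq : K * ((n + 1 : ℕ) * q) ≤ η / 3 := by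
      have e : K * ((n + 1 : ℕ) * q) = K * w := by
        rw [hq, hw]; field_simp
      rw [e]
      exact hKw
    obtain ⟨δ₁, hδ₁, hδ₁'⟩ := exists_average_tail_bound hP hmix hm hm_meas hm_mom hg hgν ht.1
      n.succ_pos hq0 hθ
    have hlim : Tendsto (fun i => K * (ε i + ε i ^ 2)) atTop (𝓝 (K * (0 + 0 ^ 2))) :=
      (hε0.add (hε0.pow 2)).const_mul K
    have h3 : ∀ᶠ i in atTop, K * (ε i + ε i ^ 2) < η / 3 :=
      hlim.eventually_lt_const (by norm_num; exact hη)
    filter_upwards [h3, hδ0.eventually_lt_const hδ₁] with i hi1 hi2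
    have hnull := ae_iff.1 (hf i)
    -- Nothing is known about the measurability of `f`: only its path of densities, the initial value
    -- and the driving path enter the exceptional events.
    have hsub : {ω | C.densityPath hs (f i ω) ∈ {u | η < |defect hT ξ A t u|}
          ∩ slowPaths (Hneg d s) T (T / (n + 1)) w}
        ⊆ (({ω | N₁ < ‖f₀ i ω‖} ∪ {ω | ¬ (IntegrableOn
              (fun u => ‖m (u / δ i ^ 2).toNNReal ω‖) (Ioc 0 T) ∧
              ∫ u in Ioc 0 T, ‖m (u / δ i ^ 2).toNNReal ω‖ ≤ N₂)})
          ∪ {ω | ¬ ∀ j < n + 1, ∫⁻ x, ENNReal.ofReal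
              ((∫ u in (j * (t / (n + 1 : ℕ)))..((j + 1 : ℕ) * (t / (n + 1 : ℕ))),
                g (m (u / δ i ^ 2).toNNReal ω) x) ^ 2) ∂(dx d) ≤ ENNReal.ofReal (q ^ 2)})
          ∪ {ω | ¬ C.IsMildSolution hT (ε i) (fun u => σ (m (u / δ i ^ 2).toNNReal ω))
              (f₀ i ω) (f i ω)} := by
      rintro ω ⟨hω1, hω2⟩
      by_contra hcon
      simp only [mem_union, mem_ofPred_eq, not_or, not_not, not_lt] at hcon hω1
      obtain ⟨⟨⟨c1, c2, c3⟩, c4⟩, c5⟩ := hcon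
      have hy : Measurable fun u => m (u / δ i ^ 2).toNNReal ω :=
        (measurable_rescaled hm_meas (δ i)).comp (measurable_id.prodMk measurable_const)
      have := hK (hε i) hy c2 c3 c1 c5 t ht (n + 1) n.succ_pos w (by push_cast; exact hω2) q hq0.le c4
      linarith
    calc _ ≤ _ := measure_mono hsub
      _ ≤ θ + θ + θ + 0 := by
          refine (measure_union_le _ _).trans (add_le_add ((measure_union_le _ _).trans (add_le_add
            ((measure_union_le _ _).trans (add_le_add (hN₁ i) (hN₂ (δ i)))) ?_)) hnull.le)
          exact hδ₁' (δ i) (hδ i) hi2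
      _ = _ := add_zero _
  have hzero : ∀ n : ℕ, ∀ᵐ ω ∂Pr', |defect hT ξ A t (ρ ω)| ≤ 1 / ((n : ℝ) + 1) := by
    intro n
    rw [ae_iff]
    refine le_antisymm (ENNReal.le_of_forall_pos_le_add fun θ hθ _ => ?_) zero_le
    have h1 := key (1 / ((n : ℝ) + 1)) (by positivity) (θ / 3) (by positivity)
    have e : ((θ / 3 : ℝ≥0) : ℝ≥0∞) + (θ / 3 : ℝ≥0) + (θ / 3 : ℝ≥0) = θ := by
      rw [← ENNReal.coe_add, ← ENNReal.coe_add]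
      congr 1
      ring
    rw [e] at h1
    simpa only [not_le, zero_add, mem_ofPred_eq] using h1
  refine (ae_all_iff.2 hzero).mono fun ω hω => ?_
  refine abs_nonpos_iff.1 (le_of_forall_pos_le_add fun e he => ?_)
  obtain ⟨n, hn⟩ := exists_nat_one_div_lt he
  linarith [hω n]

end LimitEquation

end KineticLimit

end

theorem proposition4p6
    {d : ℕ} {V : Type*} [MeasurableSpace V] {μ : Measure V} [SigmaFinite μ]
    (C : KineticLimit.VelocityModel d μ)
    {E : Type*} [NormedAddCommGroup E] [NormedSpace ℝ E] [CompleteSpace E]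
    [MeasurableSpace E] [BorelSpace E]
    (σ : E → C(KineticLimit.Torus d, ℝ)) (hσ : KineticLimit.LipschitzIntoCk (d / 2 + 2) σ)
    -- the driving process `m = m_ℓ₀`
    (P : ℝ≥0 → Kernel E E) (ν : Measure E) (hP : KineticLimit.IsErgodicMarkovSemigroup P ν)
    (hmix : KineticLimit.IsMixing P)
    {Ω : Type*} [MeasurableSpace Ω] (Pr : Measure Ω) [IsProbabilityMeasure Pr]
    (ℓ₀ : E) (m : ℝ≥0 → Ω → E) (hm : KineticLimit.IsMarkovFrom P ℓ₀ Pr m)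
    (hm_meas : Measurable fun p : ℝ≥0 × Ω => m p.1 p.2)
    (hm_mom : KineticLimit.HasUniformMoments Pr m)
    (T ε₀ δ₀ : ℝ) (hT : 0 < T) (hε₀ : 0 < ε₀) (hδ₀ : 0 < δ₀)
    -- the initial conditions
    (f₀ : KineticLimit.Params ε₀ δ₀ → Ω → C.L2M)
    (hf₀_meas : ∀ p, AEStronglyMeasurable (f₀ p) Pr)
    (hf₀_mom : (⨆ p, ∫⁻ ω, ‖f₀ p ω‖ₑ ^ 12 ∂Pr) < ∞)
    {Ω₀ : Type*} [MeasurableSpace Ω₀] (Pr₀ : Measure Ω₀) [IsProbabilityMeasure Pr₀]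
    (ρ₀ : Ω₀ → KineticLimit.L2x d)
    (hρ₀ : TendstoInDistribution (fun p ω => C.density (f₀ p ω)) (KineticLimit.toZero ε₀ δ₀)
      ρ₀ (fun _ => Pr) Pr₀)
    -- the solutions of the stochastic kinetic equation
    (f : KineticLimit.Params ε₀ δ₀ → Ω → C(Icc (0 : ℝ) T, C.L2M))
    (hf : ∀ p, ∀ᵐ ω ∂Pr, C.IsMildSolution hT.le p.1
      (fun s => σ (m (s / (p.2 : ℝ) ^ 2).toNNReal ω)) (f₀ p ω) (f p ω))
    -- a limit in distribution of the densities along a sequence of parameters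
    (ς : ℝ) (hς : 0 < ς) (hς' : ς ≤ 1)
    (p : ℕ → KineticLimit.Params ε₀ δ₀) (hp : Tendsto p atTop (KineticLimit.toZero ε₀ δ₀))
    {Ω' : Type*} [MeasurableSpace Ω'] (Pr' : Measure Ω') [IsProbabilityMeasure Pr']
    (ρ : Ω' → KineticLimit.PathSpace d ς T)
    (hρ : TendstoInDistribution (fun i ω => C.densityPath hς.le (f (p i) ω)) atTop
      ρ (fun _ => Pr) Pr')
    (φ : KineticLimit.TestFunction d) :
    ∀ᵐ ω ∂Pr', ∀ t : Icc (0 : ℝ) T,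
      let Lφ : ℝ → ℝ := fun s =>
        φ.limitGenerator C.K C.J (KineticLimit.meanRate σ ν) (ρ ω (projIcc 0 T hT.le s))
      IntervalIntegrable Lφ volume 0 t ∧
        φ.eval (ρ ω t) - φ.eval (ρ ω (projIcc 0 T hT.le 0)) - ∫ s in (0 : ℝ)..t, Lφ s = 0 := by
  have hP' := hP.isProbabilityMeasure
  obtain ⟨c, b, hrate⟩ := hσ.exists_isLipschitzRate (by omega)
  have hlim : Tendsto (fun i => (((p i).1 : ℝ), ((p i).2 : ℝ))) atTop (𝓝 (0, 0)) :=
    tendsto_comap_iff.1 hp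
  have hξ := KineticLimit.continuous_pair_test hς' φ.contDiff_ξ
  have hA := KineticLimit.continuous_pair_drift (C := C) hς' φ.contDiff_ξ
    (hrate.continuous_meanRate hP.integrable) (hrate.coordLipschitz_meanRate hP.integrable)
  have hdef := KineticLimit.ae_forall_defect_eq_zero hT.le hξ hA fun t ht =>
    KineticLimit.ae_defect_eq_zero (C := C) hrate hP hmix hm hm_meas hm_mom hT.le
      (fun i => (p i).1.2.1) (fun i => (p i).2.2.1) ((continuous_fst.tendsto _).comp hlim)
      ((continuous_snd.tendsto _).comp hlim) (fun θ hθ => by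
        obtain ⟨N, hN0, hN⟩ := KineticLimit.exists_norm_tail_bound hf₀_meas
          (by norm_num : 12 ≠ 0) hf₀_mom hθ
        exact ⟨N, hN0, fun i => hN (p i)⟩) (fun i => hf (p i)) hς.le hς' hρ φ.contDiff_ξ ht
  filter_upwards [hdef] with ω hω t
  have hχ : ContDiff ℝ 1 φ.χ := φ.contDiff_χ.of_le (by norm_num)
  obtain ⟨h1, h2⟩ := KineticLimit.integral_deriv_comp_of_defect_eq_zero hT.le hξ hA hω hχ t.2
  rw [IccExtend_val] at h2
  simp only [KineticLimit.TestFunction.limitGenerator, KineticLimit.TestFunction.eval,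
    KineticLimit.limitDrift_eq φ.contDiff_ξ]
  exact ⟨h1, h2⟩
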